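/- Let $q$ be an odd prime power and let $\rho_1,\rho_2,\rho_3\in\mathrm{PSL}(3,q)$ be involutions, $G:=\langle\rho_1,\rho_2,\rho_3\rangle$, such that $(G,\{\rho_1,\rho_2,\rho_3\})$ is a string C-group of rank $3$; that is, $\rho_1$ and $\rho_3$ commute and $$\langle\rho_i\mid i\in I\rangle\cap\langle\rho_j\mid j\in J\rangle=\langle\rho_k\mid k\in I\cap J\rangle\quad\text{for all } I,J\subseteq\{1,2,3\}.$$ Suppose that $G$, acting naturally on the projective plane $\mathrm{PG}(2,q)$, does not stabilise any point or any line. Then $G$ preserves a conic of $\mathrm{PG}(2,q)$ (the zero locus of a nondegenerate ternary quadratic form over $\mathbb{F}_q$; preserved both as a set of points and as a curve, i.e. matrix representatives of elements of $G$ multiply the form by nonzero scalars). Moreover $G$ is isomorphic to one of $$\mathrm{Sym}(4),\quad \mathrm{Alt}(5),\quad \mathrm{P}\Omega(3,q'),\quad \mathrm{PSO}(3,q'),$$ where $q'$ is a root of $q$, i.e. $q=q'^n$ for some integer $n\ge 1$ (equivalently, $\mathbb{F}_{q'}$ is a subfield of $\mathbb{F}_q$). Here $\mathrm{PSO}(3,q')$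 and $\mathrm{P}\Omega(3,q')$ are the images in $\mathrm{PGL}(3,q')$ of the special orthogonal group and of the commutator subgroup of the full orthogonal group of a nondegenerate ternary quadratic form over $\mathbb{F}_{q'}$ (up to conjugacy independent of the form). -/

import Mathlib

open scoped MatrixGroups LinearAlgebra.Projectivization

/-- `(G, (ρ 0, …, ρ (r-1)))` is a string C-group of rank `r` (inside an ambient group `H`): the
`ρ i` are involutions generating `G`, non-consecutive ones commute, and the intersection
property holds for all pairs of index sets. -/
structure IsStringCGroup {H : Type*} [Group H] {r : ℕ} (G : Subgroup H) (ρ : Fin r → H) :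
    Prop where
  involution : ∀ i, orderOf (ρ i) = 2
  generates : Subgroup.closure (Set.range ρ) = G
  string_property : ∀ i j : Fin r, i.val + 1 < j.val → Commute (ρ i) (ρ j)
  intersection_property : ∀ I J : Set (Fin r),
    Subgroup.closure (ρ '' I) ⊓ Subgroup.closure (ρ '' J) = Subgroup.closure (ρ '' (I ∩ J))

section Plane

variable {F : Type*} [Field F]

/-- `G` stabilises a point of the projective plane `PG(2, F)`. -/
def StabilisesPoint (G : Subgroup PSL(3, F)) : Prop :=
  ∃ P : ℙ F (Fin 3 → F), ∀ g ∈ G, g • P = P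

/-- `G` stabilises a line of the projective plane `PG(2, F)`; the line given by a
two-dimensional subspace `W` consists of the points contained in `W`. -/
def StabilisesLine (G : Subgroup PSL(3, F)) : Prop :=
  ∃ W : Submodule F (Fin 3 → F), Module.finrank F W = 2 ∧
    ∀ g ∈ G, ∀ P : ℙ F (Fin 3 → F), P.submodule ≤ W → (g • P).submodule ≤ W

/-- The points of `PG(2, F)` at which a ternary quadratic form vanishes. -/
def conicPoints (Q : QuadraticForm F (Fin 3 → F)) : Set (ℙ F (Fin 3 → F)) :=
  {P | ∀ v ∈ P.submodule, Q v = 0}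

/-- `G` preserves a conic of `PG(2, F)`: there is a nondegenerate ternary quadratic form `Q`
such that every projectivity in `G` maps the conic `Q = 0` to itself, both as a curve (its
matrix representatives multiply `Q` by nonzero scalars) and as a set of points. -/
def PreservesConic (G : Subgroup PSL(3, F)) : Prop :=
  ∃ Q : QuadraticForm F (Fin 3 → F), Q.Nondegenerate ∧
    (∀ A : SL(3, F), (A : PSL(3, F)) ∈ G →
      ∃ c : F, c ≠ 0 ∧ ∀ v : Fin 3 → F, Q (A.1.mulVec v) = c * Q v) ∧
    (∀ g ∈ G, ∀ P : ℙ F (Fin 3 → F), g • P ∈ conicPoints Q ↔ P ∈ conicPoints Q)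

end Plane

section Orthogonal

variable {K : Type*} [Field K]

/-- The group of matrices preserving a quadratic form on `Kⁿ`. -/
def orthogonalGroupOf {n : ℕ} (Q : QuadraticForm K (Fin n → K)) : Subgroup (GL (Fin n) K) where
  carrier := {A | ∀ v, Q (A.1.mulVec v) = Q v}
  one_mem' := by intro v; simp
  mul_mem' := by
    intro A B hA hB v
    have h : (A * B).1.mulVec v = A.1.mulVec (B.1.mulVec v) := by simp
    rw [h, hA, hB]
  inv_mem' := by
    intro A hA v
    have h : A.1.mulVec (A⁻¹.1.mulVec v) = v := by
      rw [Matrix.mulVec_mulVec, ← Units.val_mul, mul_inv_cancel]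
      simp
    rw [← hA, h]

/-- The group of isometries of `Q` of determinant one. -/
def specialOrthogonalGroupOf {n : ℕ} (Q : QuadraticForm K (Fin n → K)) :
    Subgroup (GL (Fin n) K) :=
  orthogonalGroupOf Q ⊓ (Matrix.GeneralLinearGroup.det (n := Fin n) (R := K)).ker

/-- The group `Ω` of `Q`: the commutator subgroup of the orthogonal group (used here for
nondegenerate ternary forms over finite fields of odd order). -/
def omegaGroupOf {n : ℕ} (Q : QuadraticForm K (Fin n → K)) : Subgroup (GL (Fin n) K) :=
  ⁅orthogonalGroupOf Q, orthogonalGroupOf Q⁆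

variable (K)

/-- The ternary form `x₀ x₂ - x₁²`. Over a finite field of odd order, every
nondegenerate ternary form is equivalent to a nonzero multiple of it, so that its orthogonal
groups are the groups usually denoted by `(3, q)`. -/
noncomputable def standardTernaryForm : QuadraticForm K (Fin 3 → K) :=
  QuadraticMap.linMulLin (LinearMap.proj 0) (LinearMap.proj 2) -
    QuadraticMap.linMulLin (LinearMap.proj 1) (LinearMap.proj 1)

/-- `PSO(3, K)`: the special orthogonal group modulo scalars. -/
noncomputable def PSO3 : Subgroup PGL(3, K) :=
  (specialOrthogonalGroupOf (standardTernaryForm K)).map Matrix.ProjGenLinGroup.mk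

/-- `PΩ(3, K)`: the group `Ω(3, K)` modulo scalars. -/
noncomputable def POmega3 : Subgroup PGL(3, K) :=
  (omegaGroupOf (standardTernaryForm K)).map Matrix.ProjGenLinGroup.mk

end Orthogonal

/-! The scalars in SL(3,q) have order dividing 3, so each generator lifts to an involution of
SL(3,q), and commuting classes of involutions have commuting lifts. An involution of determinant one
is a homology v ↦ -v + 2 f(v) p with centre p and axis ker f (`exists_homology`). Commutation puts
the centres of the outer two on each other's axes; the intersection property serves to make these
two distinct. As no point and no line is fixed, centres and axes are in general position
(`dot_ne_zero`, `sum_ne_one`), and an invariant nondegenerate quadratic form can be written down.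
Over a finite field of odd order it is a multiple of x₀x₂ - x₁² in suitable coordinates
(`exists_conj_mem`), so G is isomorphic to a subgroup Γ of the special orthogonal group of that
form.

What remains is Dickson's classification of subgroups of SO(3,q) by Klein's counting. A nontrivial
isometry of determinant one fixes the vectors of exactly one point, its axis (`exists_fixed`,
`eq_one_of_fixed`), so the groups `axisFixer Γ x` partition the nontrivial elements. Summing over
orbits of points gives Σ (e - 1)/s = 1 - 1/N, where e is the order of the fixer, s that of the
stabiliser and N that of Γ (`sum_orbits`). Off the conic, s is e or 2e, because a stabilising
isometry has eigenvalue ±1. On the conic, fixers are p-groups for the characteristic p, and the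
nontrivial ones form at most one orbit by Sylow's theorem (`mem_orbit_of_isotropic`); if Q
translations and k multipliers occur at infinity, then e = Q, s = Qk and k divides Q - 1.

The three generators and the product of the outer two give four axes of involutions. Together with
the absence of fixed points they exclude the cyclic and dihedral solutions, and the tetrahedral one
when no axis is on the conic. There remain N = 24, N = 60, and N = Qk(Q + 1) with k equal to Q - 1
or (Q - 1)/2. The first two are recognised by the actions on four axes and on five Sylow
2-subgroups. In the third, the translations become a subfield K after rescaling
(`exists_subfield_of_units`), the orbit of infinity is the conic over K, and Γ is SO(3,K) or its
commutator subgroup (`eq_rationalSO`, `eq_commutator`). -/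

/-! ### Equivariant partitions of a finite group and their class equation -/

section Partition

open MulAction

variable {Γ X : Type*} [Group Γ] [MulAction Γ X]

/-- A family of subgroups indexed by an acted-on set, compatible with conjugation, whose nontrivial
elements partition the nontrivial elements of the group. -/
structure IsEquivariantPartition (C : X → Subgroup Γ) : Prop where
  conj : ∀ g h x, h ∈ C x → g * h * g⁻¹ ∈ C (g • x)
  existsUnique : ∀ g, g ≠ 1 → ∃! x, g ∈ C x

/-- The order of the stabiliser of a point of an orbit. -/
noncomputable def orbitStab (ω : orbitRel.Quotient Γ X) : ℕ :=
  Quotient.liftOn' ω (fun x => Nat.card (stabilizer Γ x)) (by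
    rintro _ y ⟨g, rfl⟩
    exact (Nat.card_congr
      (stabilizerEquivStabilizer (g := g) (a := y) (b := g • y) rfl).toEquiv).symm)

theorem card_orbit_mul_card_stabilizer (x : X) :
    Nat.card (orbit Γ x) * Nat.card (stabilizer Γ x) = Nat.card Γ := by
  rw [← Nat.card_prod]
  exact Nat.card_congr (orbitProdStabilizerEquivGroup Γ x)

namespace IsEquivariantPartition

variable {C : X → Subgroup Γ}

theorem conj_iff (hC : IsEquivariantPartition C) (g h : Γ) (x : X) :
    g * h * g⁻¹ ∈ C (g • x) ↔ h ∈ C x := by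
  refine ⟨fun H => ?_, hC.conj g h x⟩
  have := hC.conj g⁻¹ _ _ H
  simpa [mul_assoc] using this

theorem smul_eq_map (hC : IsEquivariantPartition C) (g : Γ) (x : X) :
    C (g • x) = (C x).map (MulAut.conj g).toMonoidHom := by
  ext h
  constructor
  · intro hh
    refine ⟨g⁻¹ * h * g, ?_, by simp [mul_assoc]⟩
    have := hC.conj_iff g (g⁻¹ * h * g) x
    simp only [mul_assoc, mul_inv_cancel_left, mul_inv_cancel, mul_one] at this
    simpa [mul_assoc] using this.1 hh
  · rintro ⟨k, hk, rfl⟩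
    simpa using hC.conj g k x hk

theorem card_smul (hC : IsEquivariantPartition C) (g : Γ) (x : X) :
    Nat.card (C (g • x)) = Nat.card (C x) := by
  rw [hC.smul_eq_map]
  exact (Nat.card_congr ((C x).equivMapOfInjective _ (MulAut.conj g).injective).toEquiv).symm

theorem eq_of_mem (hC : IsEquivariantPartition C) {g : Γ} (hg : g ≠ 1) {x y : X}
    (hx : g ∈ C x) (hy : g ∈ C y) : x = y :=
  (hC.existsUnique g hg).unique hx hy

/-- The order of the member of the partition attached to an orbit. -/
noncomputable def orbitCard (hC : IsEquivariantPartition C) (ω : orbitRel.Quotient Γ X) : ℕ :=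
  Quotient.liftOn' ω (fun x => Nat.card (C x)) (by
    rintro _ y ⟨g, rfl⟩
    exact hC.card_smul g y)

variable [Finite Γ] [Finite X]

theorem card_sub_one (hC : IsEquivariantPartition C) :
    Nat.card Γ - 1 = ∑ᶠ x : X, (Nat.card (C x) - 1) := by
  classical
  have := Fintype.ofFinite Γ
  have := Fintype.ofFinite X
  have hN (H : Subgroup Γ) :
    Nat.card {g : Γ // g ∈ H ∧ g ≠ 1} = Nat.card H - 1 := by
    rw [Nat.card_eq_fintype_card, Nat.card_eq_fintype_card, Fintype.card_subtype,
      ← Fintype.card_coe (Finset.univ.filter _)]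
    have h1 : (Finset.univ.filter fun g : Γ => g ∈ H ∧ g ≠ 1) =
        (Finset.univ.filter fun g : Γ => g ∈ H).erase 1 := by
      ext g; simp [and_comm]
    rw [Fintype.card_coe, h1, Finset.card_erase_of_mem (by simp [H.one_mem]),
      ← Fintype.card_subtype]
  have e : {g : Γ // g ∈ (⊤ : Subgroup Γ) ∧ g ≠ 1} ≃ Σ x : X, {g : Γ // g ∈ C x ∧ g ≠ 1} :=
    { toFun := fun g => ⟨(hC.existsUnique g.1 g.2.2).choose, g.1,
        (hC.existsUnique g.1 g.2.2).choose_spec.1, g.2.2⟩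
      invFun := fun p => ⟨p.2.1, trivial, p.2.2.2⟩
      left_inv := fun g => rfl
      right_inv := by
        rintro ⟨x, g, hg, h1⟩
        have : (hC.existsUnique g h1).choose = x :=
          hC.eq_of_mem h1 (hC.existsUnique g h1).choose_spec.1 hg
        subst this
        rfl }
  have h2 := Nat.card_congr e
  rw [hN, Nat.card_sigma] at h2
  simp only [hN, Subgroup.card_top] at h2
  rw [h2, finsum_eq_sum_of_fintype]

/-- Counting nontrivial elements by axis, the orbit of x contributes (N / s)(e - 1); dividing by N
gives Klein's equation, on which the whole classification rests. -/
theorem sum_orbits (hC : IsEquivariantPartition C) [Fintype (orbitRel.Quotient Γ X)] :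
    ∑ ω : orbitRel.Quotient Γ X, ((hC.orbitCard ω : ℚ) - 1) / orbitStab ω
      = 1 - 1 / (Nat.card Γ : ℚ) := by
  classical
  have := Fintype.ofFinite Γ
  have := Fintype.ofFinite X
  have hN : (Nat.card Γ : ℚ) ≠ 0 := by exact_mod_cast Nat.card_pos.ne'
  have h1 : (Nat.card Γ : ℚ) - 1 = ∑ x : X, ((Nat.card (C x) : ℚ) - 1) := by
    have h := hC.card_sub_one
    rw [finsum_eq_sum_of_fintype] at h
    have h' := congrArg (Nat.cast (R := ℚ)) h
    rw [Nat.cast_sub Nat.card_pos, Nat.cast_sum] at h'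
    rw [Nat.cast_one] at h'
    rw [h']
    refine Finset.sum_congr rfl fun x _ => ?_
    rw [Nat.cast_sub Nat.card_pos, Nat.cast_one]
  have h2 : ∑ x : X, ((Nat.card (C x) : ℚ) - 1) =
      ∑ ω : orbitRel.Quotient Γ X, ∑ x ∈ Finset.univ.filter (fun x : X => Quotient.mk'' x = ω),
        ((Nat.card (C x) : ℚ) - 1) := by
    rw [Finset.sum_fiberwise]
  have h3 (ω : orbitRel.Quotient Γ X) :
      ∑ x ∈ Finset.univ.filter (fun x : X => Quotient.mk'' x = ω), ((Nat.card (C x) : ℚ) - 1)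
        = Nat.card Γ * (((hC.orbitCard ω : ℚ) - 1) / orbitStab ω) := by
    induction ω using Quotient.inductionOn' with | _ x => ?_
    have hc : ((Finset.univ.filter (fun y : X => (Quotient.mk'' y : orbitRel.Quotient Γ X) =
        Quotient.mk'' x)).card : ℚ) * Nat.card (stabilizer Γ x) = Nat.card Γ := by
      have := Nat.card_congr (orbitProdStabilizerEquivGroup Γ x)
      rw [Nat.card_prod] at this
      rw [← this]
      push_cast
      congr 2
      rw [Nat.card_eq_fintype_card, ← Set.toFinset_card]
      congr 1
      ext y
      simp [Quotient.eq'', orbitRel_apply]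
    have hs : (Nat.card (stabilizer Γ x) : ℚ) ≠ 0 := by exact_mod_cast Nat.card_pos.ne'
    rw [Finset.sum_congr rfl (g := fun _ => (Nat.card (C x) : ℚ) - 1)]
    · change _ = (Nat.card Γ : ℚ) * (((Nat.card (C x) : ℚ) - 1) / (Nat.card (stabilizer Γ x) : ℕ))
      rw [Finset.sum_const, nsmul_eq_mul, ← hc]
      field_simp
    · intro y hy
      have hy : (Quotient.mk'' y : orbitRel.Quotient Γ X) = Quotient.mk'' x := by simpa using hy
      rw [Quotient.eq''] at hy
      obtain ⟨g, rfl⟩ := hy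
      rw [show (fun m => m • x) g = g • x from rfl, hC.card_smul]
  rw [h2, Finset.sum_congr rfl fun ω _ => h3 ω, ← Finset.mul_sum] at h1
  field_simp
  rw [mul_comm]
  linarith

end IsEquivariantPartition
end Partition

/-! ### Numerical solutions of the class equation -/

section Numeric

variable {Ω : Type*} [Fintype Ω]

theorem exists_notMem_of_sum_ne {W : Ω → ℚ} {c : ℚ} (h : ∑ ω, W ω = c) (T : Finset Ω)
    (hT : ∑ ω ∈ T, W ω ≠ c) : ∃ ω ∉ T, W ω ≠ 0 := by
  by_contra! H
  exact hT (h ▸ Finset.sum_subset (Finset.subset_univ T) fun ω _ hω => H ω hω)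

theorem sum_le_of_nonneg {W : Ω → ℚ} {c : ℚ} (h : ∑ ω, W ω = c) (hW : ∀ ω, 0 ≤ W ω)
    (T : Finset Ω) : ∑ ω ∈ T, W ω ≤ c :=
  h ▸ Finset.sum_le_univ_sum_of_nonneg hW

/-- The weight of a class whose stabiliser is the class member itself, or twice as large. -/
theorem weight_cases {e s N : ℕ} (hN : 0 < N) (he : 2 ≤ e) (hs : s = e ∨ s = 2 * e)
    (hsN : 2 * s ≤ N) :
    (s = e ∧ ((e : ℚ) - 1) / s = 1 - 1 / (e : ℚ) ∧ 2 * (1 / (N : ℚ)) ≤ 1 / e) ∨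
    (s = 2 * e ∧ ((e : ℚ) - 1) / s = 1 / 2 - 1 / 2 * (1 / (e : ℚ)) ∧
      4 * (1 / (N : ℚ)) ≤ 1 / e) := by
  have he' : (0 : ℚ) < e := by exact_mod_cast (by omega : 0 < e)
  have hN' : (0 : ℚ) < N := by exact_mod_cast hN
  have hsN' : 2 * (s : ℚ) ≤ N := by exact_mod_cast hsN
  rcases hs with h | h
  · left
    refine ⟨h, ?_, ?_⟩
    · rw [h]; field_simp
    · rw [h] at hsN'
      rw [mul_one_div, div_le_div_iff₀ hN' he']; linarith
  · right
    have h' : (s : ℚ) = 2 * e := by rw [h]; push_cast; ring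
    refine ⟨h, ?_, ?_⟩
    · rw [h']; field_simp
    · rw [h'] at hsN'
      rw [mul_one_div, div_le_div_iff₀ hN' he']; linarith

theorem inv_le_of_le {a n : ℕ} (ha : 0 < a) (h : a ≤ n) : 1 / (n : ℚ) ≤ 1 / a :=
  one_div_le_one_div_of_le (by exact_mod_cast ha) (by exact_mod_cast h)

theorem lt_of_one_div_gt {a n : ℕ} (ha : 0 < a) (h : 1 / (a : ℚ) < 1 / n) : n < a := by
  by_contra! H
  exact absurd (inv_le_of_le ha H) (not_le.2 h)

theorem eq_of_one_div_eq {a n : ℕ} (h : 1 / (n : ℚ) = 1 / a) : n = a := by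
  simpa using h

/-- The data of the orbits of a partition, with the restrictions used to classify them: `e` is the
order of the member of the partition, `s` the order of the stabiliser. -/
structure OrbitData (e s : Ω → ℕ) (N : ℕ) : Prop where
  two_le : 2 ≤ N
  one_le : ∀ ω, 1 ≤ e ω
  sum_eq : ∑ ω, ((e ω : ℚ) - 1) / s ω = 1 - 1 / (N : ℚ)
  not_fixed : ∀ ω, 2 * s ω ≤ N
  four_even : ∀ ω, (∀ ω', 2 ∣ e ω' → ω' = ω) → 4 * s ω ≤ N

/-- The orbit structure of the symmetric group of degree four. -/
def IsOctahedral (e s : Ω → ℕ) (N : ℕ) : Prop :=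
  N = 24 ∧ ∃ ω, e ω = 3 ∧ s ω = 6 ∧ ∀ ω', 3 ∣ e ω' → ω' = ω

/-- The orbit structure of the alternating group of degree five. -/
def IsIcosahedral (e s : Ω → ℕ) (N : ℕ) : Prop :=
  N = 60 ∧ (∀ ω, 2 ≤ e ω → (e ω = 2 ∧ s ω = 4) ∨ (e ω = 3 ∧ s ω = 6) ∨ (e ω = 5 ∧ s ω = 10)) ∧
    ∃ ω, e ω = 2 ∧ ∀ ω', 2 ∣ e ω' → ω' = ω

variable {e s : Ω → ℕ} {N : ℕ}

namespace OrbitData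

theorem nonneg (h : OrbitData e s N) (ω : Ω) : 0 ≤ ((e ω : ℚ) - 1) / s ω := by
  have : (1 : ℚ) ≤ e ω := by exact_mod_cast h.one_le ω
  exact div_nonneg (by linarith) (by positivity)

theorem two_le_of_ne_zero (h : OrbitData e s N) {ω : Ω} (hω : ((e ω : ℚ) - 1) / s ω ≠ 0) :
    2 ≤ e ω := by
  have := h.one_le ω
  by_contra! H
  have : e ω = 1 := by omega
  simp [this] at hω

/-- The orbits outside `T` are trivial when the weights of `T` fill up the sum. -/
theorem one_of_notMem (h : OrbitData e s N) (T : Finset Ω)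
    (hT : ∑ ω ∈ T, ((e ω : ℚ) - 1) / s ω = 1 - 1 / (N : ℚ)) (hs : ∀ ω, 2 ≤ e ω → s ω ≠ 0) (ω : Ω)
    (hω : ω ∉ T) : e ω = 1 := by
  classical
  have h1 := sum_le_of_nonneg h.sum_eq h.nonneg (insert ω T)
  rw [Finset.sum_insert hω, hT] at h1
  have h2 := h.nonneg ω
  have h3 : ((e ω : ℚ) - 1) / s ω = 0 := le_antisymm (by linarith) h2
  by_contra hne
  have h4 : 2 ≤ e ω := by have := h.one_le ω; omega
  have h5 := hs ω h4
  rw [div_eq_zero_iff] at h3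
  rcases h3 with h3 | h3
  · have : (2 : ℚ) ≤ e ω := by exact_mod_cast h4
    linarith
  · exact h5 (by exact_mod_cast h3)

theorem one_div_facts {n : ℕ} (hn : 2 ≤ n) : 0 < 1 / (n : ℚ) ∧ 1 / (n : ℚ) ≤ 1 / 2 :=
  ⟨by have : (0 : ℚ) < n := by exact_mod_cast (by omega : 0 < n)
      positivity, by simpa using inv_le_of_le (a := 2) (by norm_num) hn⟩

/-- The equation 1/a + 1/b + 1/c = 1 + 2/N with a ≤ b ≤ c is that of the finite rotation groups: its
solutions are (2,2,n), (2,3,3), (2,3,4), (2,3,5). -/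
theorem classify_three_sorted (h : OrbitData e s N) {a b c : Ω} (hab : a ≠ b) (hac : a ≠ c)
    (hbc : b ≠ c) (ha : 2 ≤ e a) (hle : e a ≤ e b) (hle' : e b ≤ e c)
    (hsa : s a = 2 * e a) (hsb : s b = 2 * e b) (hsc : s c = 2 * e c)
    (hother : ∀ ω, ω ≠ a → ω ≠ b → ω ≠ c → e ω = 1)
    (hc4 : 4 * (1 / (N : ℚ)) ≤ 1 / e c)
    (hsum : 1 / (e a : ℚ) + 1 / e b + 1 / e c = 1 + 2 * (1 / (N : ℚ))) :
    IsOctahedral e s N ∨ IsIcosahedral e s N := by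
  have hN := one_div_facts h.two_le
  have hNi : (0 : ℚ) < (N : ℚ)⁻¹ := by rw [← one_div]; exact hN.1
  have hb : 2 ≤ e b := ha.trans hle
  have hc : 2 ≤ e c := hb.trans hle'
  have ea : e a = 2 := by
    by_contra H
    have h1 : 1 / (e a : ℚ) ≤ 1 / (3 : ℕ) := inv_le_of_le (by norm_num) (by omega)
    have h2 : 1 / (e b : ℚ) ≤ 1 / (3 : ℕ) := inv_le_of_le (by norm_num) (by omega)
    have h3 : 1 / (e c : ℚ) ≤ 1 / (3 : ℕ) := inv_le_of_le (by norm_num) (by omega)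
    norm_num at h1 h2 h3 hsum
    linarith
  have eb : e b = 3 := by
    by_contra H
    rcases lt_or_gt_of_ne H with H | H
    -- The dihedral solution gives 1/c = 2/N, against 4/N ≤ 1/c.
    · have : e b = 2 := by omega
      rw [ea, this] at hsum
      norm_num at hsum hc4
      linarith
    · have h2 : 1 / (e b : ℚ) ≤ 1 / (4 : ℕ) := inv_le_of_le (by norm_num) (by omega)
      have h3 : 1 / (e c : ℚ) ≤ 1 / (4 : ℕ) := inv_le_of_le (by norm_num) (by omega)
      rw [ea] at hsum
      norm_num at h2 h3 hsum
      linarith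
  have ec : e c < 6 := by
    apply lt_of_one_div_gt (by norm_num)
    rw [ea, eb] at hsum
    norm_num at hsum ⊢
    linarith
  have hNe : (n m : ℕ) → 0 < m → 1 / (n : ℚ) = 1 / m → n = m := fun n m _ => eq_of_one_div_eq
  have hcase : e c = 3 ∨ e c = 4 ∨ e c = 5 := by omega
  rw [ea, eb] at hsum
  rcases hcase with ec | ec | ec
  -- The tetrahedral solution: its only even orbit has stabiliser of order 4 and so length 3, too
  -- short for four axes of involutions.
  · exfalso
    have hN12 : N = 12 := by
      apply hNe N 12 (by norm_num)
      rw [ec] at hsum; norm_num at hsum ⊢; linarith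
    have := h.four_even a (by
      intro ω hω
      by_contra H
      by_cases h1 : ω = b
      · rw [h1, eb] at hω; omega
      by_cases h2 : ω = c
      · rw [h2, ec] at hω; omega
      rw [hother ω H h1 h2] at hω; omega)
    omega
  · left
    refine ⟨?_, b, eb, by omega, ?_⟩
    · apply hNe N 24 (by norm_num)
      rw [ec] at hsum; norm_num at hsum ⊢; linarith
    · intro ω hω
      by_contra H
      by_cases h1 : ω = a
      · rw [h1, ea] at hω; omega
      by_cases h2 : ω = c
      · rw [h2, ec] at hω; omega
      rw [hother ω h1 H h2] at hω; omega
  · right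
    refine ⟨?_, ?_, a, ea, ?_⟩
    · apply hNe N 60 (by norm_num)
      rw [ec] at hsum; norm_num at hsum ⊢; linarith
    · intro ω hω
      by_cases h0 : ω = a
      · subst h0; omega
      by_cases h1 : ω = b
      · subst h1; omega
      by_cases h2 : ω = c
      · subst h2; omega
      have := hother ω h0 h1 h2
      omega
    · intro ω hω
      by_contra H
      by_cases h1 : ω = b
      · rw [h1, eb] at hω; omega
      by_cases h2 : ω = c
      · rw [h2, ec] at hω; omega
      rw [hother ω H h1 h2] at hω; omega

theorem classify_three (h : OrbitData e s N) {a b c : Ω} (hab : a ≠ b) (hac : a ≠ c)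
    (hbc : b ≠ c) (ha : 2 ≤ e a) (hb : 2 ≤ e b) (hc : 2 ≤ e c)
    (hsa : s a = 2 * e a) (hsb : s b = 2 * e b) (hsc : s c = 2 * e c)
    (hother : ∀ ω, ω ≠ a → ω ≠ b → ω ≠ c → e ω = 1)
    (ha4 : 4 * (1 / (N : ℚ)) ≤ 1 / e a) (hb4 : 4 * (1 / (N : ℚ)) ≤ 1 / e b)
    (hc4 : 4 * (1 / (N : ℚ)) ≤ 1 / e c)
    (hsum : 1 / (e a : ℚ) + 1 / e b + 1 / e c = 1 + 2 * (1 / (N : ℚ))) :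
    IsOctahedral e s N ∨ IsIcosahedral e s N := by
  rcases le_total (e a) (e b) with h1 | h1 <;> rcases le_total (e b) (e c) with h2 | h2 <;>
    rcases le_total (e a) (e c) with h3 | h3
  · exact classify_three_sorted h hab hac hbc ha h1 h2 hsa hsb hsc hother hc4 hsum
  · exact classify_three_sorted h hab hac hbc ha h1 h2 hsa hsb hsc hother hc4 hsum
  · exact classify_three_sorted h hac hab hbc.symm ha h3 h2 hsa hsc hsb
      (fun ω x y z => hother ω x z y) hb4 (by linarith)
  · exact classify_three_sorted h hac.symm hbc.symm hab hc h3 h1 hsc hsa hsb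
      (fun ω x y z => hother ω y z x) hb4 (by linarith)
  · exact classify_three_sorted h hab.symm hbc hac hb h1 h3 hsb hsa hsc
      (fun ω x y z => hother ω y x z) hc4 (by linarith)
  · exact classify_three_sorted h hbc hab.symm hac.symm hb h2 h3 hsb hsc hsa
      (fun ω x y z => hother ω z x y) ha4 (by linarith)
  · exact classify_three_sorted h hbc.symm hac.symm hab.symm hc h2 h1 hsc hsb hsa
      (fun ω x y z => hother ω z y x) ha4 (by linarith)
  · exact classify_three_sorted h hbc.symm hac.symm hab.symm hc h2 h1 hsc hsb hsa
      (fun ω x y z => hother ω z y x) ha4 (by linarith)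

/-- The equation becomes 1/a + 1/(2b) = 1/2 + 1/N. Its solutions are the odd dihedral groups (a =
2), which have a fixed axis, and the tetrahedral group (a = 3, b = 2), whose single even orbit has
only three axes. -/
theorem classify_two_false (h : OrbitData e s N) {a b : Ω}
    (ha : 2 ≤ e a) (hb : 2 ≤ e b) (hsa : s a = e a) (hsb : s b = 2 * e b)
    (hother : ∀ ω, ω ≠ a → ω ≠ b → e ω = 1)
    (hb4 : 4 * (1 / (N : ℚ)) ≤ 1 / e b)
    (hsum : (1 - 1 / (e a : ℚ)) + (1 / 2 - 1 / 2 * (1 / (e b : ℚ))) = 1 - 1 / (N : ℚ)) : False := by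
  have hN := one_div_facts h.two_le
  have hNi : (0 : ℚ) < (N : ℚ)⁻¹ := by rw [← one_div]; exact hN.1
  have hu := one_div_facts ha
  have hv := one_div_facts hb
  have ea : e a ≠ 2 := by
    intro ea
    rw [ea] at hsum
    norm_num at hsum hb4
    linarith
  have h1 : 1 / (e a : ℚ) ≤ 1 / (3 : ℕ) := inv_le_of_le (by norm_num) (by omega)
  have eb : e b < 3 := by
    apply lt_of_one_div_gt (by norm_num)
    norm_num at hsum h1 ⊢
    linarith
  have eb : e b = 2 := by omega
  rw [eb] at hsum
  have ea' : e a < 4 := by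
    apply lt_of_one_div_gt (by norm_num)
    norm_num at hsum h1 ⊢
    linarith
  have ea : e a = 3 := by omega
  have hN12 : N = 12 := by
    apply eq_of_one_div_eq
    rw [ea] at hsum
    norm_num at hsum ⊢
    linarith
  have := h.four_even b (by
      intro ω hω
      by_contra H
      by_cases h1 : ω = a
      · rw [h1, ea] at hω; omega
      rw [hother ω h1 H] at hω; omega)
  omega

/-- A nontrivial orbit weighs at least 1/4, and at least 1/2 if s = e, while the total is below 1.
Hence there are at most three nontrivial orbits, and if there are three, all have s = 2e. -/
theorem classify_anisotropic (h : OrbitData e s N)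
    (hs : ∀ ω, 2 ≤ e ω → s ω = e ω ∨ s ω = 2 * e ω) :
    IsOctahedral e s N ∨ IsIcosahedral e s N := by
  classical
  have hN := one_div_facts h.two_le
  have hNi : (0 : ℚ) < (N : ℚ)⁻¹ := by rw [← one_div]; exact hN.1
  have hpos : 0 < N := by have := h.two_le; omega
  have hs0 : ∀ ω, 2 ≤ e ω → s ω ≠ 0 := fun ω hω => by rcases hs ω hω with h1 | h1 <;> omega
  have key (ω : Ω) (hω : 2 ≤ e ω) := weight_cases hpos hω (hs ω hω) (h.not_fixed ω)
  obtain ⟨a, -, ha⟩ := exists_notMem_of_sum_ne h.sum_eq ∅ (by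
    rw [Finset.sum_empty]; linarith)
  replace ha := h.two_le_of_ne_zero ha
  have hua := one_div_facts ha
  obtain ⟨b, hba, hb⟩ := exists_notMem_of_sum_ne h.sum_eq {a} (by
    rw [Finset.sum_singleton]
    rcases key a ha with ⟨-, h1, h2⟩ | ⟨-, h1, h2⟩ <;> rw [h1] <;> intro h3 <;> linarith)
  replace hb := h.two_le_of_ne_zero hb
  rw [Finset.mem_singleton] at hba
  have hub := one_div_facts hb
  -- Two orbits do not suffice: two of type s = e weigh at least 1, two of type s = 2e weigh too
  -- little because neither is a fixed axis, and the mixed case is `classify_two_false`.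
  obtain ⟨c, hcab, hc⟩ := exists_notMem_of_sum_ne h.sum_eq {b, a} (by
    intro hsum
    have hother : ∀ ω, ω ≠ b → ω ≠ a → e ω = 1 := fun ω h1 h2 =>
      h.one_of_notMem {b, a} hsum hs0 ω (by simp [h1, h2])
    rw [Finset.sum_pair hba] at hsum
    rcases key a ha with ⟨ka, h1, h2⟩ | ⟨ka, h1, h2⟩ <;>
      rcases key b hb with ⟨kb, h3, h4⟩ | ⟨kb, h3, h4⟩ <;> rw [h1, h3] at hsum
    · linarith
    · exact classify_two_false h ha hb ka kb (fun ω x y => hother ω y x) h4 (by linarith)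
    · exact classify_two_false h hb ha kb ka hother h2 (by linarith)
    · linarith)
  replace hc := h.two_le_of_ne_zero hc
  have huc := one_div_facts hc
  obtain ⟨hcb, hca⟩ : c ≠ b ∧ c ≠ a := by simpa [not_or] using hcab
  have hle := sum_le_of_nonneg h.sum_eq h.nonneg {c, b, a}
  rw [Finset.sum_insert (by simp [hcb, hca]), Finset.sum_pair hba] at hle
  have hmem : ∑ ω ∈ {c, b, a}, ((e ω : ℚ) - 1) / s ω = 1 - 1 / (N : ℚ) := by
    by_contra H
    obtain ⟨d, hd, hd'⟩ := exists_notMem_of_sum_ne h.sum_eq {c, b, a} H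
    replace hd' := h.two_le_of_ne_zero hd'
    have hud := one_div_facts hd'
    have hle := sum_le_of_nonneg h.sum_eq h.nonneg {d, c, b, a}
    rw [Finset.sum_insert hd, Finset.sum_insert (by simp [hcb, hca]),
      Finset.sum_pair hba] at hle
    have quarter (ω : Ω) (hω : 2 ≤ e ω) : 1 / 4 ≤ ((e ω : ℚ) - 1) / s ω := by
      have := one_div_facts hω
      rcases key ω hω with ⟨-, h1, -⟩ | ⟨-, h1, -⟩ <;> rw [h1] <;> linarith
    have := quarter a ha
    have := quarter b hb
    have := quarter c hc
    have := quarter d hd'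
    linarith
  have hother : ∀ ω, ω ≠ a → ω ≠ b → ω ≠ c → e ω = 1 := fun ω h1 h2 h3 =>
      h.one_of_notMem {c, b, a} hmem hs0 ω (by simp [h1, h2, h3])
  rw [Finset.sum_insert (by simp [hcb, hca]), Finset.sum_pair hba] at hmem
  -- Of the eight combinations only the last, s = 2e throughout, is possible; the others already
  -- weigh 1/2 + 1/4 + 1/4.
  rcases key a ha with ⟨ka, h1, h2⟩ | ⟨ka, h1, h2⟩ <;>
    rcases key b hb with ⟨kb, h3, h4⟩ | ⟨kb, h3, h4⟩ <;>
    rcases key c hc with ⟨kc, h5, h6⟩ | ⟨kc, h5, h6⟩ <;> rw [h1, h3, h5] at hle hmem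
  pick_goal 8
  · exact classify_three h (Ne.symm hba) hca.symm hcb.symm ha hb hc ka kb kc hother h2 h4 h6
      (by linarith)
  all_goals exfalso; linarith

/-- The numerical heart of the modular case. -/
theorem torus_arithmetic {N e k Q : ℕ} (hQ : 3 ≤ Q) (hk : 2 ≤ k) (hdvd : k ∣ Q - 1)
    (hN : Q * k * (Q + 1) ≤ N) (hek : k < e)
    (heq : (N : ℤ) * (k * Q - e * (Q - 2)) = 2 * e * k * Q) :
    (N = Q * k * (Q + 1) ∧ (k = Q - 1 ∨ 2 * k = Q - 1)) ∨
      (N = 60 ∧ Q = 3 ∧ k = 2 ∧ e = 5) := by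
  obtain ⟨d, hd⟩ := hdvd
  obtain ⟨j, rfl⟩ := Nat.exists_eq_add_of_lt hek
  have hNpos : (0 : ℤ) < N := by
    have : 0 < Q * k * (Q + 1) := by positivity
    exact_mod_cast this.trans_le hN
  have hQ' : Q = k * d + 1 := by omega
  have hd0 : d ≠ 0 := by rintro rfl; omega
  -- With e = k + j + 1 the factor of N in the equation is 2k - (j + 1)(Q - 2). Its positivity
  -- bounds both j and d = (Q - 1)/k.
  have hpos : (0 : ℤ) < k * Q - ((k + j + 1 : ℕ) : ℤ) * (Q - 2) := by
    have h1 : (0 : ℤ) < 2 * ((k + j + 1 : ℕ) : ℤ) * k * Q := by positivity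
    rw [← heq] at h1
    exact pos_of_mul_pos_right h1 hNpos.le
  push_cast at hpos heq
  have hmain : ((j : ℤ) + 1) * (Q - 2) < 2 * k := by nlinarith
  have hQz : (Q : ℤ) = k * d + 1 := by exact_mod_cast hQ'
  have hkz : (2 : ℤ) ≤ k := by exact_mod_cast hk
  have hjz : (0 : ℤ) ≤ j := by positivity
  have hd3 : d < 3 := by
    by_contra! H
    have hdz : (3 : ℤ) ≤ d := by exact_mod_cast H
    rw [hQz] at hmain
    nlinarith
  obtain rfl | rfl : d = 1 ∨ d = 2 := by omega
  · have hk1 : (Q : ℤ) = k + 1 := by rw [hQz]; push_cast; ring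
    rw [hk1] at hmain heq
    have hkq : k = Q - 1 := by omega
    have hj : j = 0 ∨ j = 1 ∨ 2 ≤ j := by omega
    rcases hj with rfl | rfl | hj
    -- Here e = k + 1 forces N = 2k(k + 1), less than the lower bound Qk(Q + 1).
    · exfalso
      have h2 : (N : ℤ) * (k + 1) = (2 * k * (k + 1)) * (k + 1) := by
        push_cast at heq; linear_combination heq
      have h3 : (N : ℤ) = 2 * k * (k + 1) := mul_right_cancel₀ (by positivity) h2
      have h4 : (Q : ℤ) * k * (Q + 1) ≤ N := by exact_mod_cast hN
      rw [hk1, h3] at h4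
      nlinarith
    · left
      refine ⟨?_, Or.inl hkq⟩
      have h3 : (N : ℤ) = Q * k * (Q + 1) := by
        rw [hk1]; push_cast at heq; linarith
      exact_mod_cast h3
    -- The exceptional solution Q = 3, k = 2, e = 5 is the icosahedral group in characteristic 3.
    · right
      have hjz : (2 : ℤ) ≤ j := by exact_mod_cast hj
      have hk2 : k = 2 := by
        have : (k : ℤ) < 3 := by nlinarith
        have : k < 3 := by exact_mod_cast this
        omega
      subst hk2
      have hj2 : j = 2 := by push_cast at hmain; omega
      subst hj2
      refine ⟨?_, by omega, rfl, rfl⟩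
      push_cast at heq
      omega
  · left
    have hk1 : (Q : ℤ) = 2 * k + 1 := by rw [hQz]; push_cast; ring
    have hj : j = 0 := by
      by_contra H
      have hjz : (1 : ℤ) ≤ j := by exact_mod_cast Nat.one_le_iff_ne_zero.2 H
      rw [hk1] at hmain
      nlinarith
    subst hj
    refine ⟨?_, Or.inr (by omega)⟩
    have h3 : (N : ℤ) = Q * k * (Q + 1) := by
      rw [hk1] at heq ⊢; push_cast at heq; linear_combination heq
    exact_mod_cast h3

/-- The isotropic orbit weighs 1/k - 1/(ke). If k = 1, room remains for only one further orbit, of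
weight 1/4, and N = 12. If k ≥ 2, the torus orbit and exactly one more orbit occur, both with s =
2e, and the equation reduces to `torus_arithmetic`. -/
theorem classify_isotropic (h : OrbitData e s N) {i : Ω} {k : ℕ}
    (hodd : Odd (e i)) (he : 2 ≤ e i) (hk : 1 ≤ k) (hsi : s i = e i * k) (hdvd : k ∣ e i - 1)
    (hN : s i * (e i + 1) ≤ N)
    (hs : ∀ ω, ω ≠ i → 2 ≤ e ω → s ω = e ω ∨ s ω = 2 * e ω)
    (htorus : 2 ≤ k → ∃ u, u ≠ i ∧ e u = k) :
    IsOctahedral e s N ∨ IsIcosahedral e s N ∨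
      (N = s i * (e i + 1) ∧ (k = e i - 1 ∨ 2 * k = e i - 1)) := by
  classical
  have hN2 := one_div_facts h.two_le
  have hNi : (0 : ℚ) < (N : ℚ)⁻¹ := by rw [← one_div]; exact hN2.1
  have hpos : 0 < N := by have := h.two_le; omega
  have hQ : 3 ≤ e i := by obtain ⟨t, ht⟩ := hodd; omega
  have key (ω : Ω) (hi : ω ≠ i) (hω : 2 ≤ e ω) :=
    weight_cases hpos hω (hs ω hi hω) (h.not_fixed ω)
  have quarter (ω : Ω) (hi : ω ≠ i) (hω : 2 ≤ e ω) : 1 / 4 ≤ ((e ω : ℚ) - 1) / s ω := by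
    have := one_div_facts hω
    rcases key ω hi hω with ⟨-, h1, -⟩ | ⟨-, h1, -⟩ <;> rw [h1] <;> linarith
  have hs0 : ∀ ω, 2 ≤ e ω → s ω ≠ 0 := fun ω hω => by
    by_cases hi : ω = i
    · rw [hi, hsi]; positivity
    · rcases hs ω hi hω with h1 | h1 <;> omega
  have hQ0 : (0 : ℚ) < e i := by exact_mod_cast (by omega : 0 < e i)
  have hk0 : (0 : ℚ) < k := by exact_mod_cast (by omega : 0 < k)
  have hN0 : (0 : ℚ) < N := by exact_mod_cast hpos
  have hNq : (e i : ℚ) * k * (e i + 1) ≤ N := by rw [hsi] at hN; exact_mod_cast hN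
  have hQ3 : (3 : ℚ) ≤ e i := by exact_mod_cast hQ
  set κ : ℚ := 1 / k with hκ
  set π : ℚ := 1 / (k * e i) with hπ
  have hκpos : 0 < κ := by positivity
  have hπpos : 0 < π := by positivity
  have hWi : ((e i : ℚ) - 1) / s i = κ - π := by
    rw [hsi, hκ, hπ]; push_cast; field_simp
  have hπκ : π ≤ κ / 3 := by
    rw [hκ, hπ, div_div]
    exact one_div_le_one_div_of_le (by positivity) (by nlinarith)
  have hνπ : 1 / (N : ℚ) ≤ π / 4 := by
    rw [hπ, div_div]
    exact one_div_le_one_div_of_le (by positivity) (by nlinarith [mul_pos hk0 hQ0])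
  rcases Nat.lt_or_ge k 2 with hk2 | hk2
  · have hk1 : k = 1 := by omega
    subst hk1
    have hκ1 : κ = 1 := by rw [hκ]; norm_num
    have hπ1 : π = 1 / e i := by rw [hπ]; norm_num
    rw [hκ1] at hWi hπκ
    obtain ⟨b, hbi, hb⟩ := exists_notMem_of_sum_ne h.sum_eq {i} (by
      rw [Finset.sum_singleton, hWi]; intro H; linarith)
    replace hb := h.two_le_of_ne_zero hb
    rw [Finset.mem_singleton] at hbi
    have hqb := quarter b hbi hb
    have hle := sum_le_of_nonneg h.sum_eq h.nonneg {b, i}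
    rw [Finset.sum_pair hbi, hWi] at hle
    have hQ4 : e i < 4 := by
      apply lt_of_one_div_gt (by norm_num)
      rw [← hπ1]; norm_num at hle ⊢; linarith
    have hQ3 : e i = 3 := by omega
    have hπ3 : π = 1 / 3 := by rw [hπ1, hQ3]; norm_num
    have hWb : ((e b : ℚ) - 1) / s b = 1 / 4 := by
      rcases key b hbi hb with ⟨-, h1, -⟩ | ⟨-, h1, -⟩
      · have := one_div_facts hb
        rw [h1] at hle; linarith
      · have : e b < 3 := by
          apply lt_of_one_div_gt (by norm_num)
          rw [h1] at hle; norm_num at hle ⊢; linarith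
        have hb2 : e b = 2 := by omega
        rw [h1, hb2]; norm_num
    have hsum : ∑ ω ∈ {b, i}, ((e ω : ℚ) - 1) / s ω = 1 - 1 / (N : ℚ) := by
      by_contra H
      obtain ⟨d, hd, hd'⟩ := exists_notMem_of_sum_ne h.sum_eq {b, i} H
      have hdi : d ≠ i := by rintro rfl; simp at hd
      have := quarter d hdi (h.two_le_of_ne_zero hd')
      have hle := sum_le_of_nonneg h.sum_eq h.nonneg {d, b, i}
      rw [Finset.sum_insert hd, Finset.sum_pair hbi, hWi, hWb, hπ3] at hle
      linarith
    rw [Finset.sum_pair hbi, hWi, hWb, hπ3] at hsum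
    -- The tetrahedral group in characteristic 3: Q = 3 and k = 1 satisfy 2k = Q - 1, so it falls
    -- under the third alternative.
    have hN12 : N = 12 := by
      apply eq_of_one_div_eq; norm_num at hsum ⊢; linarith
    right; right
    rw [hsi, hQ3]
    omega
  · obtain ⟨u, hui, huk⟩ := htorus hk2
    have hu : 2 ≤ e u := by omega
    have hκ2 := (one_div_facts hk2).2
    rw [← hκ] at hκ2
    have hku := key u hui hu
    rw [huk, ← hκ] at hku
    have hsum_ne : ∑ ω ∈ {u, i}, ((e ω : ℚ) - 1) / s ω ≠ 1 - 1 / (N : ℚ) := by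
      rw [Finset.sum_pair hui, hWi, huk]
      rcases hku with ⟨-, h1, -⟩ | ⟨-, h1, -⟩ <;> rw [h1] <;> intro H <;> linarith
    obtain ⟨b, hb, hb'⟩ := exists_notMem_of_sum_ne h.sum_eq {u, i} hsum_ne
    replace hb' := h.two_le_of_ne_zero hb'
    obtain ⟨hbu, hbi⟩ : b ≠ u ∧ b ≠ i := by simpa [not_or] using hb
    have hqb := quarter b hbi hb'
    have hub := one_div_facts hb'
    have hle := sum_le_of_nonneg h.sum_eq h.nonneg {b, u, i}
    rw [Finset.sum_insert hb, Finset.sum_pair hui, hWi, huk] at hle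
    -- If s were e at the torus, the torus and isotropic orbits would weigh 1 - π together, with π ≤
    -- 1/6, leaving no room for the orbit of b.
    have hku' : s u = 2 * k ∧ ((k : ℚ) - 1) / s u = 1 / 2 - 1 / 2 * κ := by
      rcases hku with ⟨-, h1, -⟩ | ⟨h0, h1, -⟩
      · rw [h1] at hle; exfalso; linarith
      · exact ⟨h0, h1⟩
    obtain ⟨hsu, hWu⟩ := hku'
    have hkb : s b = 2 * e b ∧ ((e b : ℚ) - 1) / s b = 1 / 2 - 1 / 2 * (1 / (e b : ℚ)) := by
      rcases key b hbi hb' with ⟨-, h1, -⟩ | ⟨h0, h1, -⟩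
      · rw [h1, hWu] at hle; exfalso; linarith
      · exact ⟨h0, h1⟩
    obtain ⟨hsb, hWb⟩ := hkb
    have hsum : ∑ ω ∈ {b, u, i}, ((e ω : ℚ) - 1) / s ω = 1 - 1 / (N : ℚ) := by
      by_contra H
      obtain ⟨d, hd, hd'⟩ := exists_notMem_of_sum_ne h.sum_eq {b, u, i} H
      have hdi : d ≠ i := by rintro rfl; simp at hd
      have := quarter d hdi (h.two_le_of_ne_zero hd')
      have hle := sum_le_of_nonneg h.sum_eq h.nonneg {d, b, u, i}
      rw [Finset.sum_insert hd, Finset.sum_insert hb, Finset.sum_pair hui, hWi, huk, hWu,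
        hWb] at hle
      linarith
    have hother := h.one_of_notMem {b, u, i} hsum hs0
    rw [Finset.sum_insert hb, Finset.sum_pair hui, hWi, huk, hWu, hWb] at hsum
    have heb : 1 / (e b : ℚ) = κ - 2 * π + 2 * (1 / (N : ℚ)) := by linarith
    have hkeb : k < e b := by
      apply lt_of_one_div_gt (by omega)
      rw [← hκ]; linarith
    have hb0 : (0 : ℚ) < e b := by exact_mod_cast (by omega : 0 < e b)
    have heq : (N : ℤ) * (k * e i - e b * (e i - 2)) = 2 * e b * k * e i := by
      have : (N : ℚ) * (k * e i - e b * (e i - 2)) = 2 * e b * k * e i := by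
        rw [hκ, hπ] at heb
        field_simp at heb
        linear_combination heb
      exact_mod_cast this
    rcases torus_arithmetic hQ hk2 hdvd (by rw [← hsi]; exact hN) hkeb heq with
      ⟨h1, h2⟩ | ⟨h1, h2, h3, h4⟩
    · right; right
      exact ⟨by rw [hsi, h1], h2⟩
    · right; left
      refine ⟨h1, ?_, u, by omega, ?_⟩
      · intro ω hω
        by_cases hωi : ω = i
        · subst hωi; rw [hsi, h2, h3]; omega
        by_cases hωu : ω = u
        · subst hωu; omega
        by_cases hωb : ω = b
        · subst hωb; omega
        have := hother ω (by simp [hωi, hωu, hωb])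
        omega
      · intro ω hω
        by_contra hωu
        by_cases hωi : ω = i
        · subst hωi; omega
        by_cases hωb : ω = b
        · subst hωb; omega
        have := hother ω (by simp [hωi, hωu, hωb])
        omega

end OrbitData
end Numeric

/-! ### Isometries of the standard ternary form -/

section TernaryForm

variable {F : Type*} [Field F]

theorem GL_smul_eq_mulVec (g : GL (Fin 3) F) (v : Fin 3 → F) : g • v = g.1.mulVec v := rfl

theorem standardTernaryForm_apply (v : Fin 3 → F) :
    standardTernaryForm F v = v 0 * v 2 - v 1 ^ 2 := by
  simp [standardTernaryForm, sq]

/-- The bilinear form attached to the standard ternary form. -/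
def ternaryPolar (u v : Fin 3 → F) : F := u 0 * v 2 + u 2 * v 0 - 2 * (u 1 * v 1)

theorem ternaryPolar_eq (u v : Fin 3 → F) : ternaryPolar u v =
    standardTernaryForm F (u + v) - standardTernaryForm F u - standardTernaryForm F v := by
  simp only [standardTernaryForm_apply, ternaryPolar, Pi.add_apply]; ring

theorem mem_specialOrthogonal {g : GL (Fin 3) F} :
    g ∈ specialOrthogonalGroupOf (standardTernaryForm F) ↔
      (∀ v, standardTernaryForm F (g • v) = standardTernaryForm F v) ∧ g.1.det = 1 := by
  simp only [specialOrthogonalGroupOf, Subgroup.mem_inf, MonoidHom.mem_ker]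
  refine and_congr Iff.rfl ?_
  rw [← Units.val_inj]; rfl

theorem ternaryPolar_smul {g : GL (Fin 3) F}
    (hg : g ∈ specialOrthogonalGroupOf (standardTernaryForm F)) (u v : Fin 3 → F) :
    ternaryPolar (g • u) (g • v) = ternaryPolar u v := by
  have h := (mem_specialOrthogonal.1 hg).1
  rw [ternaryPolar_eq, ternaryPolar_eq, ← smul_add, h, h, h]

theorem eq_of_ternaryPolar_eq [NeZero (2 : F)] {u v : Fin 3 → F}
    (h : ∀ x, ternaryPolar u x = ternaryPolar v x) : u = v := by
  have h0 := h ![1, 0, 0]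
  have h1 := h ![0, 1, 0]
  have h2 := h ![0, 0, 1]
  simp [ternaryPolar] at h0 h1 h2
  have h1 : u 1 = v 1 := h1.resolve_right two_ne_zero
  ext i; fin_cases i <;> simp [h0, h1, h2]

/-- The projectivity of the standard conic acting on its parameter as `t ↦ a t + c`. -/
def affineElt (a : Fˣ) (c : F) : GL (Fin 3) F where
  val := !![(a⁻¹ : Fˣ), 0, 0; (a⁻¹ : Fˣ) * c, 1, 0; (a⁻¹ : Fˣ) * c ^ 2, 2 * c, a]
  inv := !![(a : F), 0, 0; - c, 1, 0; (a⁻¹ : Fˣ) * c ^ 2, - 2 * c * (a⁻¹ : Fˣ), (a⁻¹ : Fˣ)]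
  val_inv := by
    ext i j; fin_cases i <;> fin_cases j <;> simp [Matrix.mul_apply, Fin.sum_univ_three] <;>
      field_simp <;> ring
  inv_val := by
    ext i j; fin_cases i <;> fin_cases j <;> simp [Matrix.mul_apply, Fin.sum_univ_three] <;>
      field_simp <;> ring

/-- The projectivity of the standard conic acting on its parameter as `t ↦ - 1 / t`. -/
def swapElt : GL (Fin 3) F where
  val := !![0, 0, 1; 0, -1, 0; 1, 0, 0]
  inv := !![0, 0, 1; 0, -1, 0; 1, 0, 0]
  val_inv := by ext i j; fin_cases i <;> fin_cases j <;> simp [Matrix.mul_apply, Fin.sum_univ_three]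
  inv_val := by ext i j; fin_cases i <;> fin_cases j <;> simp [Matrix.mul_apply, Fin.sum_univ_three]

/-- The finite points of the standard conic. -/
def conicVec (t : F) : Fin 3 → F := ![1, t, t ^ 2]

/-- The infinite point of the standard conic. -/
def conicInf : Fin 3 → F := ![0, 0, 1]

theorem affineElt_smul (a : Fˣ) (c : F) (v : Fin 3 → F) : affineElt a c • v =
    ![(a⁻¹ : Fˣ) * v 0, (a⁻¹ : Fˣ) * c * v 0 + v 1,
      (a⁻¹ : Fˣ) * c ^ 2 * v 0 + 2 * c * v 1 + a * v 2] := by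
  rw [GL_smul_eq_mulVec]
  ext i; fin_cases i <;> simp [affineElt, Matrix.mulVec, dotProduct, Fin.sum_univ_three]

theorem swapElt_smul (v : Fin 3 → F) : (swapElt : GL (Fin 3) F) • v = ![v 2, - v 1, v 0] := by
  rw [GL_smul_eq_mulVec]
  ext i; fin_cases i <;> simp [swapElt, Matrix.mulVec, dotProduct, Fin.sum_univ_three]

theorem GL_ext_smul {g h : GL (Fin 3) F} (H : ∀ v : Fin 3 → F, g • v = h • v) : g = h := by
  apply Units.ext
  apply Matrix.ext_of_mulVec_single
  intro i
  exact H _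

theorem affineElt_mul (a b : Fˣ) (c d : F) :
    affineElt a c * affineElt b d = affineElt (a * b) (a * d + c) := by
  apply GL_ext_smul
  intro v
  rw [mul_smul]
  simp only [affineElt_smul]
  ext i; fin_cases i <;> simp <;> field_simp <;> ring

theorem affineElt_one : affineElt (1 : Fˣ) (0 : F) = 1 := by
  apply GL_ext_smul
  intro v
  rw [affineElt_smul, one_smul]
  ext i; fin_cases i <;> simp

theorem affineElt_inv (a : Fˣ) (c : F) :
    (affineElt a c)⁻¹ = affineElt a⁻¹ (- ((a⁻¹ : Fˣ) * c)) := by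
  rw [inv_eq_iff_mul_eq_one, affineElt_mul, ← affineElt_one]
  simp

theorem affineElt_injective {a b : Fˣ} {c d : F} (h : affineElt a c = affineElt b d) :
    a = b ∧ c = d := by
  have h1 := congrArg (fun g : GL (Fin 3) F => g • ![(1 : F), 0, 0]) h
  simp only [affineElt_smul] at h1
  have h2 := congrFun h1 0
  have h3 := congrFun h1 1
  simp at h2 h3
  obtain rfl : a = b := Units.ext h2
  simpa using h3

theorem affineElt_mem (a : Fˣ) (c : F) :
    affineElt a c ∈ specialOrthogonalGroupOf (standardTernaryForm F) := by
  rw [mem_specialOrthogonal]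
  constructor
  · intro v
    rw [affineElt_smul, standardTernaryForm_apply, standardTernaryForm_apply]
    simp; field_simp; ring
  · simp [affineElt, Matrix.det_fin_three]

theorem swapElt_mem : (swapElt : GL (Fin 3) F) ∈
    specialOrthogonalGroupOf (standardTernaryForm F) := by
  rw [mem_specialOrthogonal]
  constructor
  · intro v
    rw [swapElt_smul, standardTernaryForm_apply, standardTernaryForm_apply]
    simp; ring
  · simp [swapElt, Matrix.det_fin_three]

theorem swapElt_mul_self : (swapElt : GL (Fin 3) F) * swapElt = 1 := swapElt.val_inv |> Units.ext

theorem affineElt_smul_conicVec (a : Fˣ) (c t : F) :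
    affineElt a c • conicVec t = (a⁻¹ : Fˣ).1 • conicVec (a * t + c) := by
  rw [affineElt_smul]
  ext i; fin_cases i <;> simp [conicVec] <;> field_simp <;> ring

theorem affineElt_smul_conicInf (a : Fˣ) (c : F) :
    affineElt a c • (conicInf : Fin 3 → F) = a.1 • conicInf := by
  rw [affineElt_smul]
  ext i; fin_cases i <;> simp [conicInf]

theorem swapElt_smul_conicInf : (swapElt : GL (Fin 3) F) • conicInf = conicVec (0 : F) := by
  rw [swapElt_smul]
  ext i; fin_cases i <;> simp [conicInf, conicVec]

theorem isotropic_cases {v : Fin 3 → F} (h : standardTernaryForm F v = 0) :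
    v = v 2 • conicInf ∨ (v 0 ≠ 0 ∧ v = v 0 • conicVec (v 1 / v 0)) := by
  rw [standardTernaryForm_apply] at h
  by_cases h0 : v 0 = 0
  · left
    have h1 : v 1 = 0 := by simpa [h0] using h
    ext i; fin_cases i <;> simp [conicInf, h0, h1]
  · right
    refine ⟨h0, ?_⟩
    ext i; fin_cases i
    · simp [conicVec]
    · simp [conicVec]; field_simp
    · simp [conicVec]; field_simp; linear_combination h

theorem standardTernaryForm_conicVec (t : F) : standardTernaryForm F (conicVec t) = 0 := by
  simp [standardTernaryForm_apply, conicVec]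

theorem standardTernaryForm_conicInf : standardTernaryForm F conicInf = 0 := by
  simp [standardTernaryForm_apply, conicInf]

/-- The stabiliser of the infinite point consists of the affine elements. -/
theorem eq_affineElt [NeZero (2 : F)] {g : GL (Fin 3) F}
    (hg : g ∈ specialOrthogonalGroupOf (standardTernaryForm F)) {l : F}
    (h : g • (conicInf : Fin 3 → F) = l • conicInf) :
    ∃ (a : Fˣ) (c : F), g = affineElt a c ∧ (a : F) = l := by
  have hl : l ≠ 0 := by
    rintro rfl
    rw [zero_smul, smul_eq_zero_iff_eq] at h
    simpa [conicInf] using congrFun h 2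
  obtain ⟨a, rfl⟩ : ∃ a : Fˣ, (a : F) = l := ⟨Units.mk0 l hl, rfl⟩
  obtain ⟨h1, h2⟩ := mem_specialOrthogonal.1 hg
  set u := g • (![1, 0, 0] : Fin 3 → F) with hu
  set v := g • (![0, 1, 0] : Fin 3 → F) with hv
  -- The columns of g are u, v and a multiple of `conicInf`; invariance of the form and its polar
  -- form, together with the determinant, fixes all entries but two parameters.
  have e1 : ternaryPolar u (g • conicInf) = 1 := by
    rw [hu, ternaryPolar_smul hg]; simp [ternaryPolar, conicInf]
  have e2 : ternaryPolar v (g • conicInf) = 0 := by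
    rw [hv, ternaryPolar_smul hg]; simp [ternaryPolar, conicInf]
  have e3 : ternaryPolar u v = 0 := by
    rw [hv, ternaryPolar_smul hg]; simp [ternaryPolar]
  have e4 : standardTernaryForm F u = 0 := by
    rw [hu, h1]; simp [standardTernaryForm_apply]
  have hcol (j : Fin 3) (i : Fin 3) : g.1 i j = (g • (Pi.single j 1 : Fin 3 → F)) i := by
    rw [GL_smul_eq_mulVec]; simp
  have s0 : (Pi.single 0 1 : Fin 3 → F) = ![1, 0, 0] := by ext i; fin_cases i <;> simp
  have s1 : (Pi.single 1 1 : Fin 3 → F) = ![0, 1, 0] := by ext i; fin_cases i <;> simp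
  have s2 : (Pi.single 2 1 : Fin 3 → F) = conicInf := by
    ext i; fin_cases i <;> simp [conicInf]
  have hdet : g.1 = !![u 0, v 0, 0; u 1, v 1, 0; u 2, v 2, (a : F)] := by
    ext i j
    rw [hcol]
    fin_cases j
    · rw [show (⟨0, by omega⟩ : Fin 3) = 0 from rfl, s0, ← hu]; fin_cases i <;> rfl
    · rw [show (⟨1, by omega⟩ : Fin 3) = 1 from rfl, s1, ← hv]; fin_cases i <;> rfl
    · rw [show (⟨2, by omega⟩ : Fin 3) = 2 from rfl, s2, h]; fin_cases i <;> simp [conicInf]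
  rw [h] at e1 e2
  simp [ternaryPolar, conicInf] at e1 e2
  rw [hdet] at h2
  simp [Matrix.det_fin_three, e2] at h2
  have hv1 : v 1 = 1 := by
    linear_combination h2 - v 1 * e1
  rw [standardTernaryForm_apply] at e4
  simp [ternaryPolar, e2, hv1] at e3
  have hu0 : u 0 = (a⁻¹ : Fˣ) := by
    rw [Units.val_inv_eq_inv_val]; exact eq_inv_of_mul_eq_one_left e1
  have hainv : (a : F) * (a⁻¹ : Fˣ) = 1 := by simp
  refine ⟨a, a * u 1, ?_, rfl⟩
  apply Units.ext
  rw [hdet]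
  ext i j
  fin_cases i <;> fin_cases j <;> simp [affineElt, e2, hv1, hu0]
  · rw [hu0, Units.val_inv_eq_inv_val] at e4
    field_simp at e4 ⊢
    linear_combination e4
  · rw [hu0, Units.val_inv_eq_inv_val] at e3
    field_simp at e3 ⊢
    linear_combination e3

/-- Isometries of determinant one fixing the middle basis vector are diagonal. -/
theorem smul_conicInf_of_fixed [NeZero (2 : F)] {g : GL (Fin 3) F}
    (hg : g ∈ specialOrthogonalGroupOf (standardTernaryForm F))
    (h : g • (![0, 1, 0] : Fin 3 → F) = ![0, 1, 0]) :
    ∃ l : F, g • (conicInf : Fin 3 → F) = l • conicInf := by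
  obtain ⟨h1, h2⟩ := mem_specialOrthogonal.1 hg
  set u := g • (![1, 0, 0] : Fin 3 → F) with hu
  set v := g • (conicInf : Fin 3 → F) with hv
  have e1 : ternaryPolar u (g • ![0, 1, 0]) = 0 := by
    rw [hu, ternaryPolar_smul hg]; simp [ternaryPolar]
  have e2 : ternaryPolar v (g • ![0, 1, 0]) = 0 := by
    rw [hv, ternaryPolar_smul hg]; simp [ternaryPolar, conicInf]
  have e3 : ternaryPolar u v = 1 := by
    rw [hv, ternaryPolar_smul hg]; simp [ternaryPolar, conicInf]
  have e4 : standardTernaryForm F v = 0 := by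
    rw [hv, h1]; simp [standardTernaryForm_apply, conicInf]
  have hcol (j : Fin 3) (i : Fin 3) : g.1 i j = (g • (Pi.single j 1 : Fin 3 → F)) i := by
    rw [GL_smul_eq_mulVec]; simp
  have s0 : (Pi.single 0 1 : Fin 3 → F) = ![1, 0, 0] := by ext i; fin_cases i <;> simp
  have s1 : (Pi.single 1 1 : Fin 3 → F) = ![0, 1, 0] := by ext i; fin_cases i <;> simp
  have s2 : (Pi.single 2 1 : Fin 3 → F) = conicInf := by
    ext i; fin_cases i <;> simp [conicInf]
  have hdet : g.1 = !![u 0, 0, v 0; u 1, 1, v 1; u 2, 0, v 2] := by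
    ext i j
    rw [hcol]
    fin_cases j
    · rw [show (⟨0, by omega⟩ : Fin 3) = 0 from rfl, s0, ← hu]; fin_cases i <;> rfl
    · rw [show (⟨1, by omega⟩ : Fin 3) = 1 from rfl, s1, h]; fin_cases i <;> rfl
    · rw [show (⟨2, by omega⟩ : Fin 3) = 2 from rfl, s2, ← hv]; fin_cases i <;> simp
  have t2 : (2 : F) ≠ 0 := two_ne_zero
  rw [h] at e1 e2
  simp [ternaryPolar, t2] at e1 e2
  rw [hdet] at h2
  simp [Matrix.det_fin_three] at h2
  simp [ternaryPolar, e1] at e3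
  rw [standardTernaryForm_apply, e2] at e4
  refine ⟨v 2, ?_⟩
  -- In the hyperbolic plane orthogonal to the fixed vector, an isometry preserves or swaps the two
  -- isotropic lines; a swap would have determinant -1 there.
  have hv0 : v 0 = 0 := by
    have h3 : 2 * (u 2 * v 0) = 0 := by linear_combination e3 - h2
    have h4 : u 2 * v 0 = 0 := by simpa [t2] using h3
    by_contra H
    have h5 : u 2 = 0 := by simpa [H] using h4
    have h6 : v 2 = 0 := by simpa [H] using e4
    rw [h5, h6] at h2
    simp at h2
  ext i; fin_cases i <;> simp [conicInf, hv0, e2]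

theorem det_rows_smul (g : GL (Fin 3) F) (u v x : Fin 3 → F) :
    (Matrix.of ![g • u, g • v, g • x]).det = g.1.det * (Matrix.of ![u, v, x]).det := by
  rw [← Matrix.det_transpose g.1, mul_comm, ← Matrix.det_mul]
  congr 1
  ext i j
  fin_cases i <;> fin_cases j <;>
    simp [GL_smul_eq_mulVec, Matrix.mul_apply, Matrix.mulVec, dotProduct, Fin.sum_univ_three,
      mul_comm]

open Matrix in
/-- An isometry of determinant one fixing two independent vectors is trivial. -/
theorem eq_one_of_fixed [NeZero (2 : F)] {g : GL (Fin 3) F}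
    (hg : g ∈ specialOrthogonalGroupOf (standardTernaryForm F)) {u v : Fin 3 → F}
    (huv : LinearIndependent F ![u, v]) (hu : g • u = u) (hv : g • v = v) : g = 1 := by
  have t2 : (2 : F) ≠ 0 := two_ne_zero
  obtain ⟨h1, h2⟩ := mem_specialOrthogonal.1 hg
  set w := crossProduct u v with hw
  have hw0 : w ≠ 0 := crossProduct_ne_zero_iff_linearIndependent.2 huv
  -- The normal vector of the plane of u and v: it represents 2 det(u, v, ·) through the polar form,
  -- and is therefore fixed by g.
  set n : Fin 3 → F := ![2 * w 2, - w 1, 2 * w 0] with hn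
  have hdet (x) : ternaryPolar n x = 2 * (Matrix.of ![u, v, x]).det := by
    simp [ternaryPolar, hn, hw, Matrix.det_fin_three, crossProduct]
    ring
  have hgn : g • n = n := by
    apply eq_of_ternaryPolar_eq
    intro x
    have h3 := ternaryPolar_smul hg n (g⁻¹ • x)
    rw [smul_inv_smul] at h3
    rw [h3, hdet, hdet]
    have h4 := det_rows_smul g u v (g⁻¹ • x)
    rw [smul_inv_smul, hu, hv, h2, one_mul] at h4
    rw [h4]
  have hn0 : n ≠ 0 := by
    intro H
    apply hw0
    have a0 := congrFun H 0
    have a1 := congrFun H 1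
    have a2 := congrFun H 2
    simp [hn, t2] at a0 a1 a2
    ext i; fin_cases i <;> simp [a0, a1, a2]
  -- The difference g • x - x is orthogonal to the fixed vectors u and v, hence a multiple of n; the
  -- cases choose a nonzero coordinate of u × v.
  have horth (x : Fin 3 → F) : ∃ f : F, g • x = x + f • n := by
    set d := g • x - x with hd
    have du : ternaryPolar d u = 0 := by
      have := ternaryPolar_smul hg x u
      rw [hu] at this
      simp only [ternaryPolar, hd, Pi.sub_apply] at this ⊢
      linear_combination this
    have dv : ternaryPolar d v = 0 := by
      have := ternaryPolar_smul hg x v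
      rw [hv] at this
      simp only [ternaryPolar, hd, Pi.sub_apply] at this ⊢
      linear_combination this
    have c0 : w 0 = u 1 * v 2 - u 2 * v 1 := by simp [hw, crossProduct]
    have c1 : w 1 = u 2 * v 0 - u 0 * v 2 := by simp [hw, crossProduct]
    have c2 : w 2 = u 0 * v 1 - u 1 * v 0 := by simp [hw, crossProduct]
    simp only [ternaryPolar] at du dv
    have k01 : d 2 * w 1 + 2 * d 1 * w 0 = 0 := by
      rw [c0, c1]; linear_combination (-v 2) * du + u 2 * dv
    have k02 : d 2 * w 2 - d 0 * w 0 = 0 := by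
      rw [c0, c2]; linear_combination v 1 * du - u 1 * dv
    have k12 : - 2 * d 1 * w 2 - d 0 * w 1 = 0 := by
      rw [c1, c2]; linear_combination (-v 0) * du + u 0 * dv
    have hx : g • x = x + d := by rw [hd]; abel
    rw [hx]
    by_cases hw0' : w 0 = 0
    · by_cases hw1' : w 1 = 0
      · have hw2 : w 2 ≠ 0 := by
          intro H
          apply hw0
          ext i; fin_cases i <;> assumption
        simp [hw0', hw1', hw2, t2] at k01 k02 k12
        refine ⟨d 0 / (2 * w 2), ?_⟩
        congr 1
        ext i; fin_cases i <;> simp [hn, hw0', hw1', k02, k12]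
        field_simp
      · refine ⟨- d 1 / w 1, ?_⟩
        congr 1
        ext i; fin_cases i
        · simp [hn]; field_simp; linear_combination -k12
        · simp [hn]; field_simp
        · simp [hn]; field_simp; linear_combination k01
    · refine ⟨d 2 / (2 * w 0), ?_⟩
      congr 1
      ext i; fin_cases i
      · simp [hn]; field_simp; linear_combination -k02
      · simp [hn]; field_simp; linear_combination k01
      · simp [hn]; field_simp
  apply GL_ext_smul
  intro x
  rw [one_smul]
  obtain ⟨f, hf⟩ := horth x
  by_contra hne
  have hf0 : f ≠ 0 := by rintro rfl; simp at hf; exact hne hf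
  -- If g moves x, then preservation of the form at x and of the polar form of x and n makes n
  -- isotropic and orthogonal to x. Then x lies in the plane of u and v, which is fixed.
  have b1 : ternaryPolar x n + f * standardTernaryForm F n = 0 := by
    have := h1 x
    rw [hf] at this
    have h3 : f * (ternaryPolar x n + f * standardTernaryForm F n) = 0 := by
      simp only [standardTernaryForm_apply, ternaryPolar, Pi.add_apply, Pi.smul_apply,
        smul_eq_mul] at this ⊢
      linear_combination this
    exact (mul_eq_zero.1 h3).resolve_left hf0
  have b2 : f * (2 * standardTernaryForm F n) = 0 := by
    have := ternaryPolar_smul hg x n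
    rw [hgn, hf] at this
    simp only [standardTernaryForm_apply, ternaryPolar, Pi.add_apply, Pi.smul_apply,
        smul_eq_mul] at this ⊢
    linear_combination this
  have b3 : standardTernaryForm F n = 0 := by simpa [hf0, t2] using b2
  rw [b3, mul_zero, add_zero] at b1
  have b4 : (Matrix.of ![u, v, x]).det = 0 := by
    have h5 := hdet x
    have : ternaryPolar n x = ternaryPolar x n := by simp only [ternaryPolar]; ring
    rw [this, b1] at h5
    simpa [t2] using h5.symm
  rw [← Matrix.det_transpose] at b4
  obtain ⟨k, hk0, hk⟩ := Matrix.exists_mulVec_eq_zero_iff.2 b4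
  have hsum : k 0 • u + k 1 • v + k 2 • x = 0 := by
    rw [← hk]
    ext i
    simp [Matrix.mulVec, dotProduct, Fin.sum_univ_three, mul_comm]
  have hfix : k 2 • (g • x - x) = 0 := by
    have h6 := congrArg (fun y => g • y) hsum
    simp only [smul_add, smul_zero, smul_comm g, hu, hv] at h6
    rw [smul_sub, sub_eq_zero]
    have := h6.trans hsum.symm
    simpa using this
  have hk2 : k 2 = 0 := by
    by_contra H
    exact hne (sub_eq_zero.1 ((smul_eq_zero.1 hfix).resolve_left H))
  rw [hk2, zero_smul, add_zero] at hsum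
  obtain ⟨hk0', hk1⟩ := LinearIndependent.pair_iff.1 huv _ _ hsum
  exact hk0 (by ext i; fin_cases i <;> assumption)

/-- Every isometry of determinant one of a ternary form fixes a nonzero vector. -/
theorem exists_fixed [NeZero (2 : F)] {g : GL (Fin 3) F}
    (hg : g ∈ specialOrthogonalGroupOf (standardTernaryForm F)) :
    ∃ v : Fin 3 → F, v ≠ 0 ∧ g • v = v := by
  have t2 : (2 : F) ≠ 0 := two_ne_zero
  obtain ⟨h1, h2⟩ := mem_specialOrthogonal.1 hg
  set J : Matrix (Fin 3) (Fin 3) F := !![0, 0, 1; 0, -2, 0; 1, 0, 0] with hJ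
  have hJ0 : J.det ≠ 0 := by simp [hJ, Matrix.det_fin_three, t2]
  have hpol (u v : Fin 3 → F) : dotProduct u (J.mulVec v) = ternaryPolar u v := by
    simp [hJ, ternaryPolar, Matrix.mulVec, dotProduct, Fin.sum_univ_three]; ring
  have hJg : g.1.transpose * J * g.1 = J := by
    apply Matrix.ext_of_mulVec_single
    intro j
    ext i
    have := ternaryPolar_smul hg (Pi.single i 1) (Pi.single j 1)
    rw [← hpol, ← hpol, GL_smul_eq_mulVec, GL_smul_eq_mulVec] at this
    rw [← single_one_dotProduct i (Matrix.mulVec _ _), ← single_one_dotProduct i (J.mulVec _),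
      ← this, ← Matrix.mulVec_mulVec, ← Matrix.mulVec_mulVec, Matrix.dotProduct_mulVec,
      Matrix.vecMul_transpose]
  have hdet : (g.1 - 1).det = 0 := by
    -- In odd dimension, taking determinants gives det(g - 1) = -det(g - 1).
    have h3 : g.1.transpose * J * (g.1 - 1) = - ((g.1 - 1).transpose * J) := by
      rw [mul_sub, hJg, Matrix.transpose_sub, Matrix.transpose_one, sub_mul]
      simp
    have h4 := congrArg Matrix.det h3
    rw [Matrix.det_neg, Matrix.det_mul, Matrix.det_mul, Matrix.det_mul, Matrix.det_transpose,
      Matrix.det_transpose, h2] at h4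
    have h5 : J.det * (2 * (g.1 - 1).det) = 0 := by
      simp at h4; linear_combination h4
    simpa [hJ0, t2] using h5
  obtain ⟨v, hv, hv'⟩ := Matrix.exists_mulVec_eq_zero_iff.2 hdet
  refine ⟨v, hv, ?_⟩
  rw [Matrix.sub_mulVec, Matrix.one_mulVec, sub_eq_zero] at hv'
  exact hv'

end TernaryForm

/-! ### Axes, their fixers and stabilisers, and points of the conic -/

section AxisFixer

open MulAction Projectivization

variable {F : Type*} [Field F]

/-- The elements of `Γ` fixing all vectors of a point of the plane. -/
def axisFixer (Γ : Subgroup (GL (Fin 3) F)) (x : ℙ F (Fin 3 → F)) : Subgroup Γ where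
  carrier := {g | ∀ v ∈ x.submodule, g • v = v}
  one_mem' v _ := one_smul _ v
  mul_mem' {a b} ha hb v hv := by rw [mul_smul, hb v hv, ha v hv]
  inv_mem' {a} ha v hv := by rw [inv_smul_eq_iff, ha v hv]

variable {Γ : Subgroup (GL (Fin 3) F)}

theorem subgroup_smul_pt (g : Γ) (x : ℙ F (Fin 3 → F)) : g • x = g.1 • x := rfl

theorem mem_axisFixer_mk {v : Fin 3 → F} (hv : v ≠ 0) {g : Γ} :
    g ∈ axisFixer Γ (mk F v hv) ↔ g • v = v := by
  constructor
  · intro h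
    exact h v (by rw [submodule_mk]; exact Submodule.mem_span_singleton_self v)
  · intro h w hw
    rw [submodule_mk, Submodule.mem_span_singleton] at hw
    obtain ⟨l, rfl⟩ := hw
    rw [smul_comm, h]

theorem mem_stabilizer_mk {v : Fin 3 → F} (hv : v ≠ 0) {g : Γ} :
    g ∈ stabilizer Γ (mk F v hv) ↔ ∃ l : Fˣ, g • v = l.1 • v := by
  rw [mem_stabilizer_iff, subgroup_smul_pt, smul_mk, mk_eq_mk_iff]
  exact ⟨fun ⟨l, hl⟩ => ⟨l, hl.symm⟩, fun ⟨l, hl⟩ => ⟨l, hl.symm⟩⟩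

/-- An axis exists by `exists_fixed`; a second one would give two independent fixed vectors,
excluded by `eq_one_of_fixed`. -/
theorem isEquivariantPartition_axisFixer [NeZero (2 : F)]
    (hΓ : Γ ≤ specialOrthogonalGroupOf (standardTernaryForm F)) :
    IsEquivariantPartition (axisFixer Γ) where
  conj g h x hh := by
    induction x using Projectivization.ind with | _ v hv => ?_
    rw [subgroup_smul_pt, smul_mk, mem_axisFixer_mk]
    rw [mem_axisFixer_mk] at hh
    change (g * h * g⁻¹) • (g • v) = g • v
    rw [mul_smul, mul_smul, inv_smul_smul, hh]
  existsUnique g hg := by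
    have hg1 : g.1 ≠ 1 := by simpa using hg
    obtain ⟨v, hv, hv'⟩ := exists_fixed (hΓ g.2)
    refine ⟨mk F v hv, (mem_axisFixer_mk hv).2 hv', ?_⟩
    intro y hy
    induction y using Projectivization.ind with | _ u hu => ?_
    replace hy := (mem_axisFixer_mk hu).1 hy
    by_contra hne
    refine hg1 (eq_one_of_fixed (hΓ g.2) (u := u) (v := v) ?_ hy hv')
    rw [LinearIndependent.pair_iff' hu]
    intro a ha
    apply hne
    rw [mk_eq_mk_iff']
    refine ⟨a⁻¹, ?_⟩
    have ha0 : a ≠ 0 := by rintro rfl; simp at ha; exact hv ha.symm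
    rw [← ha, smul_smul, inv_mul_cancel₀ ha0, one_smul]

theorem unit_smul_left_injective {v : Fin 3 → F} (hv : v ≠ 0) {l m : Fˣ}
    (h : l.1 • v = m.1 • v) : l = m :=
  Units.ext (smul_left_injective F hv h)

/-- The character by which the stabiliser of a point acts on it. -/
noncomputable def eigenChar (Γ : Subgroup (GL (Fin 3) F)) {v : Fin 3 → F} (hv : v ≠ 0) :
    stabilizer Γ (mk F v hv) →* Fˣ :=
  MonoidHom.mk' (fun g => ((mem_stabilizer_mk hv).1 g.2).choose) (by
    intro g h
    apply unit_smul_left_injective hv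
    rw [← ((mem_stabilizer_mk hv).1 (g * h).2).choose_spec]
    have h1 := ((mem_stabilizer_mk hv).1 g.2).choose_spec
    have h2 := ((mem_stabilizer_mk hv).1 h.2).choose_spec
    generalize ((mem_stabilizer_mk hv).1 g.2).choose = l at h1
    generalize ((mem_stabilizer_mk hv).1 h.2).choose = m at h2
    rw [Subgroup.coe_mul, mul_smul, h2, smul_comm, h1, smul_smul, mul_comm, Units.val_mul])

theorem eigenChar_spec {v : Fin 3 → F} (hv : v ≠ 0) (g : stabilizer Γ (mk F v hv)) :
    g.1 • v = (eigenChar Γ hv g).1 • v :=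
  ((mem_stabilizer_mk hv).1 g.2).choose_spec

theorem mem_range_eigenChar {v : Fin 3 → F} (hv : v ≠ 0) {l : Fˣ} :
    l ∈ (eigenChar Γ hv).range ↔ ∃ g ∈ Γ, g • v = l.1 • v := by
  constructor
  · rintro ⟨g, rfl⟩
    exact ⟨g.1.1, g.1.2, eigenChar_spec hv g⟩
  · rintro ⟨g, hg, h⟩
    refine ⟨⟨⟨g, hg⟩, (mem_stabilizer_mk hv).2 ⟨l, h⟩⟩, ?_⟩
    apply unit_smul_left_injective hv
    rw [← eigenChar_spec]
    exact h

theorem axisFixer_le_stabilizer (x : ℙ F (Fin 3 → F)) : axisFixer Γ x ≤ stabilizer Γ x := by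
  induction x using Projectivization.ind with | _ v hv => ?_
  intro g hg
  rw [mem_axisFixer_mk] at hg
  exact (mem_stabilizer_mk hv).2 ⟨1, by simpa using hg⟩

/-- The fixer is the kernel of the eigenvalue character on the stabiliser. -/
theorem card_stabilizer_eq {v : Fin 3 → F} (hv : v ≠ 0) :
    Nat.card (stabilizer Γ (mk F v hv)) =
      Nat.card (axisFixer Γ (mk F v hv)) * Nat.card (eigenChar Γ hv).range := by
  rw [← Subgroup.card_mul_index (eigenChar Γ hv).ker, Subgroup.index_ker]
  congr 1
  have : (eigenChar Γ hv).ker =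
      (axisFixer Γ (mk F v hv)).subgroupOf (stabilizer Γ (mk F v hv)) := by
    ext g
    rw [MonoidHom.mem_ker, Subgroup.mem_subgroupOf, mem_axisFixer_mk, eigenChar_spec hv g]
    constructor
    · intro h; rw [h]; simp
    · intro h; apply unit_smul_left_injective hv; rw [h]; simp
  rw [this]
  exact Nat.card_congr (Subgroup.subgroupOfEquivOfLe (axisFixer_le_stabilizer _)).toEquiv

/-- An eigenvalue l on v satisfies l² Q(v) = Q(v) with Q(v) ≠ 0, so l = ±1 and the character has
image of order at most two. -/
theorem card_stabilizer_anisotropic [Finite F]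
    (hΓ : Γ ≤ specialOrthogonalGroupOf (standardTernaryForm F))
    {v : Fin 3 → F} (hv : v ≠ 0) (hQ : standardTernaryForm F v ≠ 0) :
    Nat.card (stabilizer Γ (mk F v hv)) = Nat.card (axisFixer Γ (mk F v hv)) ∨
      Nat.card (stabilizer Γ (mk F v hv)) = 2 * Nat.card (axisFixer Γ (mk F v hv)) := by
  have hsub : ((eigenChar Γ hv).range : Set Fˣ) ⊆ {1, -1} := by
    intro l hl
    obtain ⟨g, hg, h⟩ := (mem_range_eigenChar hv).1 hl
    have h1 := (mem_specialOrthogonal.1 (hΓ hg)).1 v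
    rw [h, QuadraticMap.map_smul, smul_eq_mul] at h1
    have h2 : l.1 * l.1 = 1 := mul_right_cancel₀ hQ (by rw [h1, one_mul])
    rcases mul_self_eq_one_iff.1 h2 with h3 | h3
    · left; exact Units.ext h3
    · right; exact Units.ext h3
  have h2 : Nat.card (eigenChar Γ hv).range ≤ 2 := by
    have h3 := Set.ncard_le_ncard hsub (Set.toFinite _)
    have h4 : ({1, -1} : Set Fˣ).ncard ≤ 2 := by
      simpa using Set.ncard_insert_le (1 : Fˣ) {-1}
    exact (le_of_eq (Nat.card_coe_set_eq _)).trans (h3.trans h4)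
  have h1 : 0 < Nat.card (eigenChar Γ hv).range := Nat.card_pos
  rw [card_stabilizer_eq]
  obtain h | h : Nat.card (eigenChar Γ hv).range = 1 ∨ Nat.card (eigenChar Γ hv).range = 2 := by
    omega
  · left; rw [h, mul_one]
  · right; rw [h, mul_comm]

theorem conicInf_ne_zero : (conicInf : Fin 3 → F) ≠ 0 := fun h => by
  simpa [conicInf] using congrFun h 2

theorem conicVec_ne_zero (t : F) : conicVec t ≠ 0 := fun h => by
  simpa [conicVec] using congrFun h 0

/-- The infinite point of the standard conic. -/
def infPt : ℙ F (Fin 3 → F) := mk F conicInf conicInf_ne_zero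

/-- A finite point of the standard conic. -/
def finPt (t : F) : ℙ F (Fin 3 → F) := mk F (conicVec t) (conicVec_ne_zero t)

theorem finPt_ne_infPt (t : F) : finPt t ≠ infPt := by
  intro h
  obtain ⟨a, ha⟩ := (mk_eq_mk_iff' ..).1 h
  simpa [conicVec, conicInf] using congrFun ha 0

theorem finPt_injective : Function.Injective (finPt : F → ℙ F (Fin 3 → F)) := by
  intro s t h
  obtain ⟨a, ha⟩ := (mk_eq_mk_iff' ..).1 h
  have h0 := congrFun ha 0
  have h1 := congrFun ha 1
  simp [conicVec] at h0 h1
  rw [h0, one_mul] at h1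
  exact h1.symm

theorem affineElt_smul_finPt (a : Fˣ) (c t : F) : affineElt a c • finPt t = finPt (a * t + c) := by
  rw [finPt, smul_mk, finPt, mk_eq_mk_iff]
  exact ⟨a⁻¹, (affineElt_smul_conicVec a c t).symm⟩

theorem affineElt_smul_infPt (a : Fˣ) (c : F) :
    affineElt a c • (infPt : ℙ F (Fin 3 → F)) = infPt := by
  rw [infPt, smul_mk, mk_eq_mk_iff]
  exact ⟨a, (affineElt_smul_conicInf a c).symm⟩

theorem swapElt_smul_infPt :
    (swapElt : GL (Fin 3) F) • (infPt : ℙ F (Fin 3 → F)) = finPt (0 : F) := by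
  rw [infPt, smul_mk, finPt, mk_eq_mk_iff]
  exact ⟨1, by rw [swapElt_smul_conicInf]; simp⟩

theorem swapElt_smul_finPt_zero :
    (swapElt : GL (Fin 3) F) • (finPt (0 : F) : ℙ F (Fin 3 → F)) = infPt := by
  rw [← swapElt_smul_infPt, ← mul_smul, swapElt_mul_self, one_smul]

theorem smul_infPt_eq [NeZero (2 : F)] {g : GL (Fin 3) F}
    (hg : g ∈ specialOrthogonalGroupOf (standardTernaryForm F))
    (h : g • (infPt : ℙ F (Fin 3 → F)) = infPt) :
    ∃ (a : Fˣ) (c : F), g = affineElt a c := by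
  rw [infPt, smul_mk, mk_eq_mk_iff] at h
  obtain ⟨l, hl⟩ := h
  obtain ⟨a, c, h, -⟩ := eq_affineElt (l := l.1) hg hl.symm
  exact ⟨a, c, h⟩

/-- A point of the plane is on the standard conic. -/
def IsIsotropicPt (x : ℙ F (Fin 3 → F)) : Prop := standardTernaryForm F x.rep = 0

theorem isIsotropicPt_mk {v : Fin 3 → F} (hv : v ≠ 0) :
    IsIsotropicPt (mk F v hv) ↔ standardTernaryForm F v = 0 := by
  obtain ⟨a, ha⟩ := exists_smul_eq_mk_rep F v hv
  rw [IsIsotropicPt, ← ha, Units.smul_def, QuadraticMap.map_smul]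
  simp

theorem isIsotropicPt_iff (x : ℙ F (Fin 3 → F)) :
    IsIsotropicPt x ↔ x = infPt ∨ ∃ t, x = finPt t := by
  induction x using Projectivization.ind with | _ v hv => ?_
  rw [isIsotropicPt_mk]
  constructor
  · intro h
    rcases isotropic_cases h with h | ⟨h0, h⟩
    · left
      rw [infPt, mk_eq_mk_iff']
      exact ⟨_, h.symm⟩
    · right
      refine ⟨v 1 / v 0, ?_⟩
      rw [finPt, mk_eq_mk_iff']
      exact ⟨_, h.symm⟩
  · rw [← isIsotropicPt_mk hv]
    rintro (h | ⟨t, h⟩)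
    · rw [h, infPt, isIsotropicPt_mk, standardTernaryForm_conicInf]
    · rw [h, finPt, isIsotropicPt_mk, standardTernaryForm_conicVec]

theorem isIsotropicPt_smul {g : GL (Fin 3) F}
    (hg : g ∈ specialOrthogonalGroupOf (standardTernaryForm F)) (x : ℙ F (Fin 3 → F)) :
    IsIsotropicPt (g • x) ↔ IsIsotropicPt x := by
  induction x using Projectivization.ind with | _ v hv => ?_
  rw [smul_mk, isIsotropicPt_mk, isIsotropicPt_mk, (mem_specialOrthogonal.1 hg).1]

theorem exists_smul_eq_infPt {x : ℙ F (Fin 3 → F)} (h : IsIsotropicPt x) :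
    ∃ g ∈ specialOrthogonalGroupOf (standardTernaryForm F), g • x = infPt := by
  rcases (isIsotropicPt_iff x).1 h with rfl | ⟨t, rfl⟩
  · exact ⟨1, one_mem _, one_smul _ _⟩
  · refine ⟨swapElt * affineElt 1 (-t), mul_mem swapElt_mem (affineElt_mem _ _), ?_⟩
    rw [mul_smul, affineElt_smul_finPt, Units.val_one, one_mul, add_neg_cancel,
      swapElt_smul_finPt_zero]

end AxisFixer

/-! ### Translations, multipliers and the orbit of isotropic axes -/

section IsotropicOrbit

open MulAction Projectivization

/-- A group of units acts freely on the nonzero elements of an additive group stable under it. -/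
theorem card_dvd_card_sub_one {F : Type*} [Field F] [Finite F] (A : Subgroup Fˣ) (B : AddSubgroup F)
    (h : ∀ a ∈ A, ∀ b ∈ B, a.1 * b ∈ B) : Nat.card A ∣ Nat.card B - 1 := by
  classical
  have := Fintype.ofFinite F
  let X : SubMulAction A Fˣ :=
    { carrier := {u | u.1 ∈ B}
      smul_mem' := fun a u hu => h a a.2 u hu }
  have hfree : ∀ b : X, stabilizer A b = ⊥ := by
    intro b
    rw [eq_bot_iff]
    intro a ha
    have h1 : a • b = b := ha
    have h2 : a.1 * b.1 = b.1 := congrArg Subtype.val h1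
    rw [Subgroup.mem_bot]
    exact Subtype.ext (by simpa using h2)
  have h1 : Nat.card X = Nat.card B - 1 := by
    have e : X ≃ {b : B // b ≠ 0} :=
      { toFun := fun u => ⟨⟨u.1.1, u.2⟩, fun H => u.1.ne_zero (congrArg Subtype.val H)⟩
        invFun := fun b => ⟨Units.mk0 b.1.1 (fun H => b.2 (Subtype.ext H)), b.1.2⟩
        left_inv := fun u => by ext; rfl
        right_inv := fun b => by ext; rfl }
    rw [Nat.card_congr e, Nat.card_eq_fintype_card, Nat.card_eq_fintype_card,
      Fintype.card_subtype_compl, Fintype.card_subtype_eq]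
  have h2 := Nat.card_congr (selfEquivOrbitsQuotientProd hfree)
  rw [Nat.card_prod] at h2
  rw [← h1, h2]
  exact dvd_mul_left _ _

variable {F : Type*} [Field F]

/-- The translations contained in a group of projectivities of the standard conic. -/
def translationGroup (Γ : Subgroup (GL (Fin 3) F)) : AddSubgroup F where
  carrier := {c | affineElt 1 c ∈ Γ}
  zero_mem' := by
    change affineElt 1 0 ∈ Γ
    rw [affineElt_one]; exact one_mem _
  add_mem' {a b} ha hb := by
    have := mul_mem (S := Subgroup (GL (Fin 3) F)) ha hb
    rw [affineElt_mul] at this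
    simpa [add_comm] using this
  neg_mem' {a} ha := by
    have := inv_mem (S := Subgroup (GL (Fin 3) F)) ha
    rw [affineElt_inv] at this
    simpa using this

/-- The multipliers of the affine elements of a group of projectivities of the standard conic. -/
def multiplierGroup (Γ : Subgroup (GL (Fin 3) F)) : Subgroup Fˣ where
  carrier := {a | ∃ c, affineElt a c ∈ Γ}
  one_mem' := ⟨0, by rw [affineElt_one]; exact one_mem _⟩
  mul_mem' := by
    rintro a b ⟨c, hc⟩ ⟨d, hd⟩
    exact ⟨_, by rw [← affineElt_mul]; exact mul_mem hc hd⟩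
  inv_mem' := by
    rintro a ⟨c, hc⟩
    exact ⟨_, by rw [← affineElt_inv]; exact inv_mem hc⟩

variable {Γ : Subgroup (GL (Fin 3) F)}

theorem mem_translationGroup {c : F} : c ∈ translationGroup Γ ↔ affineElt 1 c ∈ Γ := Iff.rfl

theorem mem_multiplierGroup {a : Fˣ} : a ∈ multiplierGroup Γ ↔ ∃ c, affineElt a c ∈ Γ := Iff.rfl

/-- Conjugating t ↦ t + b by t ↦ at + c gives t ↦ t + ab. -/
theorem mul_mem_translationGroup {a : Fˣ} (ha : a ∈ multiplierGroup Γ) {b : F}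
    (hb : b ∈ translationGroup Γ) : a.1 * b ∈ translationGroup Γ := by
  obtain ⟨c, hc⟩ := ha
  have := mul_mem (mul_mem hc hb) (inv_mem hc)
  rw [affineElt_inv, affineElt_mul, affineElt_mul] at this
  rw [mem_translationGroup]
  convert this using 2
  · simp
  · simp

theorem mem_axisFixer_infPt [NeZero (2 : F)]
    (hΓ : Γ ≤ specialOrthogonalGroupOf (standardTernaryForm F)) {g : Γ} :
    g ∈ axisFixer Γ infPt ↔ ∃ c ∈ translationGroup Γ, g.1 = affineElt 1 c := by
  rw [infPt, mem_axisFixer_mk]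
  constructor
  · intro h
    obtain ⟨a, c, h1, h2⟩ := eq_affineElt (l := 1) (hΓ g.2) (by rw [one_smul]; exact h)
    obtain rfl : a = 1 := Units.ext h2
    exact ⟨c, by rw [mem_translationGroup, ← h1]; exact g.2, h1⟩
  · rintro ⟨c, -, h⟩
    rw [Subgroup.smul_def, h, affineElt_smul_conicInf]
    simp

theorem card_axisFixer_infPt [NeZero (2 : F)]
    (hΓ : Γ ≤ specialOrthogonalGroupOf (standardTernaryForm F)) :
    Nat.card (axisFixer Γ infPt) = Nat.card (translationGroup Γ) := by
  symm
  refine Nat.card_congr (Equiv.ofBijective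
    (fun c : translationGroup Γ => (⟨⟨affineElt 1 c, c.2⟩,
      (mem_axisFixer_infPt hΓ).2 ⟨c, c.2, rfl⟩⟩ : axisFixer Γ infPt)) ⟨?_, ?_⟩)
  · intro c d h
    have : affineElt 1 c.1 = affineElt 1 d.1 := congrArg (fun x => x.1.1) h
    exact Subtype.ext (affineElt_injective this).2
  · intro g
    obtain ⟨c, hc, h⟩ := (mem_axisFixer_infPt hΓ).1 g.2
    exact ⟨⟨c, hc⟩, Subtype.ext (Subtype.ext h.symm)⟩

theorem card_stabilizer_infPt [NeZero (2 : F)]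
    (hΓ : Γ ≤ specialOrthogonalGroupOf (standardTernaryForm F)) :
    Nat.card (stabilizer Γ (infPt : ℙ F (Fin 3 → F))) =
      Nat.card (axisFixer Γ infPt) * Nat.card (multiplierGroup Γ) := by
  have : (eigenChar Γ (conicInf_ne_zero (F := F))).range = multiplierGroup Γ := by
    ext l
    rw [mem_range_eigenChar, mem_multiplierGroup]
    constructor
    · rintro ⟨g, hg, h⟩
      obtain ⟨a, c, rfl, h2⟩ := eq_affineElt (hΓ hg) h
      obtain rfl : a = l := Units.ext h2
      exact ⟨c, hg⟩
    · rintro ⟨c, hc⟩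
      exact ⟨_, hc, affineElt_smul_conicInf _ _⟩
  rw [← this]
  exact card_stabilizer_eq _

theorem finPt_add_mem_orbit {t c : F} (ht : finPt t ∈ orbit Γ infPt) (hc : c ∈ translationGroup Γ) :
    finPt (t + c) ∈ orbit Γ infPt := by
  obtain ⟨g, hg⟩ := ht
  refine ⟨⟨affineElt 1 c, hc⟩ * g, ?_⟩
  change (_ * g) • _ = _
  rw [mul_smul]
  change _ • (fun m : Γ => m • infPt) g = _
  rw [hg, subgroup_smul_pt, affineElt_smul_finPt]
  simp

/-- The orbit of the infinite point contains the translates of any of its finite points. -/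
theorem translates_subset_orbit {t : F} (ht : finPt t ∈ orbit Γ infPt) :
    insert infPt ((fun c => finPt (t + c)) '' (translationGroup Γ : Set F)) ⊆ orbit Γ infPt := by
  rintro x (rfl | ⟨c, hc, rfl⟩)
  · exact mem_orbit_self _
  · exact finPt_add_mem_orbit ht hc

theorem ncard_translates [Finite F] (t : F) (B : AddSubgroup F) :
    (insert (infPt : ℙ F (Fin 3 → F)) ((fun c => finPt (t + c)) '' (B : Set F))).ncard
      = Nat.card B + 1 := by
  rw [Set.ncard_insert_of_notMem, Set.ncard_image_of_injective]
  · rfl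
  · exact finPt_injective.comp (add_right_injective t)
  · rintro ⟨c, -, h⟩
    exact finPt_ne_infPt _ h

/-- The translates of one finite point of the orbit are distinct, and infinity is one point more. -/
theorem card_translationGroup_lt [Finite F] {t : F} (ht : finPt t ∈ orbit Γ infPt) :
    Nat.card (translationGroup Γ) + 1 ≤ Nat.card (orbit Γ (infPt : ℙ F (Fin 3 → F))) := by
  rw [← ncard_translates t, Nat.card_coe_set_eq]
  exact Set.ncard_le_ncard (translates_subset_orbit ht) (Set.toFinite _)

theorem exists_finPt_mem_orbit (hΓ : Γ ≤ specialOrthogonalGroupOf (standardTernaryForm F))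
    (hfix : ∃ g : Γ, g • (infPt : ℙ F (Fin 3 → F)) ≠ infPt) :
    ∃ t : F, finPt t ∈ orbit Γ infPt := by
  obtain ⟨g, hg⟩ := hfix
  have h : IsIsotropicPt (g • (infPt : ℙ F (Fin 3 → F))) :=
    (isIsotropicPt_smul (hΓ g.2) infPt).2 ((isIsotropicPt_iff _).2 (Or.inl rfl))
  rcases (isIsotropicPt_iff _).1 h with h | ⟨t, h⟩
  · exact absurd h hg
  · exact ⟨t, h ▸ mem_orbit _ _⟩

/-- The elements with a given isotropic axis form a group of order a power of the
characteristic. -/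
theorem isPGroup_axisFixer [NeZero (2 : F)]
    (p : ℕ) [CharP F p]
    (hΓ : Γ ≤ specialOrthogonalGroupOf (standardTernaryForm F)) {x : ℙ F (Fin 3 → F)}
    (hx : IsIsotropicPt x) : IsPGroup p (axisFixer Γ x) := by
  rintro ⟨g, hg⟩
  refine ⟨1, ?_⟩
  obtain ⟨k, hk, rfl⟩ : ∃ k ∈ specialOrthogonalGroupOf (standardTernaryForm F),
      x = k⁻¹ • infPt := by
    obtain ⟨k, hk, h⟩ := exists_smul_eq_infPt hx
    exact ⟨k, hk, by rw [← h, inv_smul_smul]⟩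
  have hv : k⁻¹ • (conicInf : Fin 3 → F) ≠ 0 := by
    intro H
    rw [smul_eq_zero_iff_eq] at H
    exact conicInf_ne_zero H
  have h1 : g • (k⁻¹ • (conicInf : Fin 3 → F)) = k⁻¹ • conicInf := (mem_axisFixer_mk hv).1 hg
  -- Moving the axis to infinity turns g into a translation, whose p-th power is trivial.
  obtain ⟨a, c, h2, h3⟩ := eq_affineElt (g := k * g.1 * k⁻¹) (l := 1)
    (mul_mem (mul_mem hk (hΓ g.2)) (inv_mem hk)) (by
      rw [one_smul, mul_smul, mul_smul]
      change k • (g • k⁻¹ • (conicInf : Fin 3 → F)) = _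
      rw [h1, smul_inv_smul])
  obtain rfl : a = 1 := Units.ext h3
  have hpow (n : ℕ) : (affineElt 1 c : GL (Fin 3) F) ^ n = affineElt 1 (n * c) := by
    induction n with
    | zero => simp [affineElt_one]
    | succ n ih =>
      rw [pow_succ, ih, affineElt_mul]
      congr 1
      · simp
      · push_cast; simp; ring
  have h4 : g.1 = k⁻¹ * affineElt 1 c * (k⁻¹)⁻¹ := by rw [← h2]; group
  apply Subtype.ext
  apply Subtype.ext
  change g.1 ^ p ^ 1 = 1
  rw [pow_one, h4, conj_pow, hpow, CharP.cast_eq_zero, zero_mul, affineElt_one]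
  group

/-- All isotropic axes form a single orbit. -/
theorem mem_orbit_of_isotropic [NeZero (2 : F)] [Finite F]
    (hΓ : Γ ≤ specialOrthogonalGroupOf (standardTernaryForm F)) {x y : ℙ F (Fin 3 → F)}
    (hx : IsIsotropicPt x) (hy : IsIsotropicPt y) (hCx : axisFixer Γ x ≠ ⊥)
    (hCy : axisFixer Γ y ≠ ⊥) : y ∈ orbit Γ x := by
  obtain ⟨p, hp⟩ := CharP.exists F
  have : Fact p.Prime := ⟨CharP.char_is_prime F p⟩
  have hC := isEquivariantPartition_axisFixer hΓ
  -- A p-group acting on F³ fixes a number of vectors divisible by p, so P has a nonzero fixed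
  -- vector and lies in one fixer. Nontrivial isotropic fixers are thus Sylow subgroups, and these
  -- are conjugate.
  have key (P : Sylow p Γ) (z : ℙ F (Fin 3 → F)) (hz : axisFixer Γ z ≤ P)
      (hzne : axisFixer Γ z ≠ ⊥) : (P : Subgroup Γ) ≤ axisFixer Γ z := by
    have h1 := P.2.card_modEq_card_fixedPoints (Fin 3 → F)
    have hpV : p ∣ Nat.card (Fin 3 → F) := by
      rw [Nat.card_fun, Nat.card_fin]
      have := Fintype.ofFinite F
      refine Dvd.dvd.pow ?_ (by norm_num)
      rw [← CharP.cast_eq_zero_iff F p]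
      rw [Nat.card_eq_fintype_card]
      exact Nat.cast_card_eq_zero F
    have hpf : p ∣ Nat.card (fixedPoints P (Fin 3 → F)) :=
      (Nat.modEq_zero_iff_dvd.1 (h1.symm.trans (Nat.modEq_zero_iff_dvd.2 hpV)))
    have hmem : (0 : Fin 3 → F) ∈ fixedPoints P (Fin 3 → F) := fun g => smul_zero g
    obtain ⟨⟨v, hv⟩, hv0⟩ : ∃ w : fixedPoints P (Fin 3 → F), w ≠ ⟨0, hmem⟩ := by
      by_contra! H
      have : Nat.card (fixedPoints P (Fin 3 → F)) = 1 := by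
        rw [Nat.card_eq_one_iff_unique]
        exact ⟨⟨fun a b => (H a).trans (H b).symm⟩, ⟨⟨0, hmem⟩⟩⟩
      rw [this] at hpf
      exact (Fact.out : p.Prime).one_lt.ne' (Nat.dvd_one.1 hpf)
    have hv0 : v ≠ 0 := fun H => hv0 (Subtype.ext H)
    have hP : (P : Subgroup Γ) ≤ axisFixer Γ (mk F v hv0) := by
      intro g hg
      rw [mem_axisFixer_mk]
      exact hv ⟨g, hg⟩
    obtain ⟨⟨g, hg⟩, hg1⟩ := Subgroup.ne_bot_iff_exists_ne_one.1 hzne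
    have hg1 : g ≠ 1 := fun H => hg1 (Subtype.ext H)
    rwa [← hC.eq_of_mem hg1 (hP (hz hg)) hg]
  obtain ⟨P, hP⟩ := (isPGroup_axisFixer p hΓ hx).exists_le_sylow
  obtain ⟨R, hR⟩ := (isPGroup_axisFixer p hΓ hy).exists_le_sylow
  obtain ⟨g, hg⟩ := exists_smul_eq Γ R P
  obtain ⟨h, hh⟩ := Subgroup.ne_bot_iff_exists_ne_one.1 hCy
  have hh1 : h.1 ≠ 1 := fun H => hh (Subtype.ext H)
  have h1 : g * h.1 * g⁻¹ ∈ axisFixer Γ (g • y) := hC.conj g h.1 y h.2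
  have h2 : g * h.1 * g⁻¹ ∈ axisFixer Γ x := by
    apply key P x hP hCx
    rw [← hg]
    have := Subgroup.smul_mem_pointwise_smul h.1 (MulAut.conj g) (R : Subgroup Γ) (hR h.2)
    exact this
  have h3 : g • y = x := hC.eq_of_mem (by simpa using hh1) h1 h2
  exact ⟨g⁻¹, by change g⁻¹ • x = y; rw [← h3, inv_smul_smul]⟩

/-- A nontrivial multiplier group fixes a further point, whose fixer has the same order. -/
theorem exists_torus [NeZero (2 : F)]
    [Finite F] (hΓ : Γ ≤ specialOrthogonalGroupOf (standardTernaryForm F))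
    (hk : 2 ≤ Nat.card (multiplierGroup Γ)) :
    ∃ u : ℙ F (Fin 3 → F), ¬ IsIsotropicPt u ∧
      Nat.card (axisFixer Γ u) = Nat.card (multiplierGroup Γ) := by
  have : Finite Fˣ := inferInstance
  obtain ⟨⟨a, c, hc⟩, hgen⟩ := IsCyclic.exists_generator (α := multiplierGroup Γ)
  have ha1 : a.1 ≠ 1 := by
    intro H
    have ha : a = 1 := Units.ext H
    subst ha
    have : Nat.card (multiplierGroup Γ) = 1 := by
      rw [Nat.card_eq_one_iff_unique]
      refine ⟨⟨fun x y => ?_⟩, ⟨1⟩⟩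
      have hx (x : multiplierGroup Γ) : x = 1 := by
        obtain ⟨n, hn⟩ := hgen x
        rw [← hn]
        exact one_zpow n
      rw [hx x, hx y]
    omega
  -- The finite fixed point of t ↦ at + c, where a generates the cyclic group of multipliers. The
  -- axis sought is the pole of the chord joining it to infinity.
  set t : F := c / (1 - a.1) with ht
  have hta : a.1 * t + c = t := by
    have : 1 - a.1 ≠ 0 := sub_ne_zero.2 (Ne.symm ha1)
    rw [ht]; field_simp; ring
  set k : GL (Fin 3) F := affineElt 1 t with hk'
  have hkS : k ∈ specialOrthogonalGroupOf (standardTernaryForm F) := affineElt_mem _ _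
  have he : (![0, 1, 0] : Fin 3 → F) ≠ 0 := fun H => by simpa using congrFun H 1
  have hu : k • (![0, 1, 0] : Fin 3 → F) ≠ 0 := by
    intro H
    rw [smul_eq_zero_iff_eq] at H
    exact he H
  refine ⟨mk F _ hu, ?_, ?_⟩
  · rw [isIsotropicPt_mk, (mem_specialOrthogonal.1 hkS).1, standardTernaryForm_apply]
    simp
  have hdiag (g : GL (Fin 3) F) (hg : g ∈ Γ)
      (h : g • k • (![0, 1, 0] : Fin 3 → F) = k • ![0, 1, 0]) :
      ∃ l : F, g • (conicInf : Fin 3 → F) = l • conicInf := by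
    obtain ⟨l, hl⟩ := smul_conicInf_of_fixed (g := k⁻¹ * g * k)
      (mul_mem (mul_mem (inv_mem hkS) (hΓ hg)) hkS) (by
        rw [mul_smul, mul_smul, h, inv_smul_smul])
    refine ⟨l, ?_⟩
    have h1 := congrArg (fun y => k • y) hl
    simp only [mul_smul, smul_inv_smul] at h1
    have h2 : k • (conicInf : Fin 3 → F) = conicInf := by
      rw [hk', affineElt_smul_conicInf]; simp
    rwa [smul_comm k, h2] at h1
  have hfix : affineElt a c • k • (![0, 1, 0] : Fin 3 → F) = k • ![0, 1, 0] := by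
    rw [← mul_smul, hk', affineElt_mul, hta, affineElt_smul, affineElt_smul]
    ext i; fin_cases i <;> simp
  have hinf (x : axisFixer Γ (mk F _ hu)) : x.1 ∈ stabilizer Γ (infPt : ℙ F (Fin 3 → F)) := by
    obtain ⟨l, hl⟩ := hdiag x.1.1 x.1.2 ((mem_axisFixer_mk hu).1 x.2)
    obtain ⟨a, c, h1, h2⟩ := eq_affineElt (hΓ x.1.2) hl
    rw [mem_stabilizer_iff, subgroup_smul_pt, h1, affineElt_smul_infPt]
  have hA : (eigenChar Γ (conicInf_ne_zero (F := F))).range = multiplierGroup Γ := by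
    ext l
    rw [mem_range_eigenChar, mem_multiplierGroup]
    constructor
    · rintro ⟨g, hg, h⟩
      obtain ⟨a, c, rfl, h2⟩ := eq_affineElt (hΓ hg) h
      obtain rfl : a = l := Units.ext h2
      exact ⟨c, hg⟩
    · rintro ⟨c, hc⟩
      exact ⟨_, hc, affineElt_smul_conicInf _ _⟩
  let φ : axisFixer Γ (mk F _ hu) →* multiplierGroup Γ :=
    ((eigenChar Γ (conicInf_ne_zero (F := F))).comp
      (Subgroup.inclusion (fun x hx => hinf ⟨x, hx⟩))).codRestrict _ (fun x => by
        rw [← hA]; exact ⟨_, rfl⟩)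
  have hφ (x : axisFixer Γ (mk F _ hu)) :
      x.1 • (conicInf : Fin 3 → F) = (φ x).1.1 • conicInf :=
    eigenChar_spec conicInf_ne_zero ⟨x.1, hinf x⟩
  -- An element of the kernel has infinity as a second axis, hence is trivial; the image contains
  -- the generator a.
  refine Nat.card_congr (Equiv.ofBijective φ ⟨?_, ?_⟩)
  · rw [injective_iff_map_eq_one]
    intro x hx
    have h1 := hφ x
    rw [hx] at h1
    have h2 : x.1 ∈ axisFixer Γ infPt := (mem_axisFixer_mk conicInf_ne_zero).2 (by simpa using h1)
    by_contra hne
    have hne' : x.1 ≠ 1 := fun H => hne (Subtype.ext H)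
    have h3 := (isEquivariantPartition_axisFixer hΓ).eq_of_mem hne' x.2 h2
    have h4 : IsIsotropicPt (infPt : ℙ F (Fin 3 → F)) := (isIsotropicPt_iff _).2 (Or.inl rfl)
    rw [← h3, isIsotropicPt_mk, (mem_specialOrthogonal.1 hkS).1, standardTernaryForm_apply] at h4
    simp at h4
  · intro y
    obtain ⟨n, hn⟩ := hgen y
    let g : axisFixer Γ (mk F _ hu) := ⟨⟨_, hc⟩, (mem_axisFixer_mk hu).2 hfix⟩
    have hg : φ g = ⟨a, c, hc⟩ := by
      apply Subtype.ext
      apply unit_smul_left_injective (conicInf_ne_zero (F := F))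
      rw [← hφ g]
      exact affineElt_smul_conicInf a c
    exact ⟨g ^ n, by rw [map_zpow, hg]; exact hn⟩

end IsotropicOrbit

/-! ### The class equation applied to groups of isometries -/

section Classification

open MulAction Projectivization

variable {F : Type*} [Field F] [Finite F] {Γ : Subgroup (GL (Fin 3) F)}

theorem two_mul_card_stabilizer_le {x : ℙ F (Fin 3 → F)} (h : ∃ g : Γ, g • x ≠ x) :
    2 * Nat.card (stabilizer Γ x) ≤ Nat.card Γ := by
  rw [← card_orbit_mul_card_stabilizer (Γ := Γ) x]
  refine Nat.mul_le_mul_right _ ?_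
  obtain ⟨g, hg⟩ := h
  rw [Nat.card_coe_set_eq]
  have h1 : ({x, g • x} : Set _) ⊆ orbit Γ x := by
    rintro y (rfl | rfl)
    · exact mem_orbit_self _
    · exact mem_orbit _ _
  have h2 := Set.ncard_le_ncard h1 (Set.toFinite _)
  rwa [Set.ncard_pair (Ne.symm hg)] at h2

/-- If the fixers of even order form a single orbit, that orbit contains the four given axes, whence
the bound in `four_even`. -/
theorem orbitData_axisFixer [NeZero (2 : F)]
    [Fintype (orbitRel.Quotient Γ (ℙ F (Fin 3 → F)))]
    (hΓ : Γ ≤ specialOrthogonalGroupOf (standardTernaryForm F))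
    (hfix : ∀ x : ℙ F (Fin 3 → F), ∃ g : Γ, g • x ≠ x)
    (heven : ∃ T : Set (ℙ F (Fin 3 → F)), T.ncard = 4 ∧ ∀ x ∈ T, 2 ∣ Nat.card (axisFixer Γ x)) :
    OrbitData (isEquivariantPartition_axisFixer hΓ).orbitCard orbitStab (Nat.card Γ) where
  two_le := by
    obtain ⟨T, hT, hT2⟩ := heven
    obtain ⟨x, hx⟩ : T.Nonempty := by
      rw [Set.nonempty_iff_ne_empty]; rintro rfl; simp at hT
    exact Nat.le_of_dvd Nat.card_pos ((hT2 x hx).trans (Subgroup.card_subgroup_dvd_card _))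
  one_le ω := by
    induction ω using Quotient.inductionOn' with | _ x => exact Nat.card_pos
  sum_eq := (isEquivariantPartition_axisFixer hΓ).sum_orbits
  not_fixed ω := by
    induction ω using Quotient.inductionOn' with | _ x =>
      exact two_mul_card_stabilizer_le (hfix x)
  four_even ω hω := by
    induction ω using Quotient.inductionOn' with | _ x => ?_
    obtain ⟨T, hT, hT2⟩ := heven
    change 4 * Nat.card (stabilizer Γ x) ≤ _
    rw [← card_orbit_mul_card_stabilizer (Γ := Γ) x, ← hT]
    refine Nat.mul_le_mul_right _ ?_
    rw [Nat.card_coe_set_eq]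
    refine Set.ncard_le_ncard (fun y hy => ?_) (Set.toFinite _)
    have h1 := hω (Quotient.mk'' y) (hT2 y hy)
    rw [Quotient.eq''] at h1
    exact h1

theorem classify_of_no_isotropic [NeZero (2 : F)]
    [Fintype (orbitRel.Quotient Γ (ℙ F (Fin 3 → F)))]
    (hΓ : Γ ≤ specialOrthogonalGroupOf (standardTernaryForm F))
    (hfix : ∀ x : ℙ F (Fin 3 → F), ∃ g : Γ, g • x ≠ x)
    (heven : ∃ T : Set (ℙ F (Fin 3 → F)), T.ncard = 4 ∧ ∀ x ∈ T, 2 ∣ Nat.card (axisFixer Γ x))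
    (hiso : ∀ x : ℙ F (Fin 3 → F), IsIsotropicPt x → axisFixer Γ x = ⊥) :
    IsOctahedral (isEquivariantPartition_axisFixer hΓ).orbitCard orbitStab (Nat.card Γ) ∨
    IsIcosahedral (isEquivariantPartition_axisFixer hΓ).orbitCard orbitStab (Nat.card Γ) := by
  refine (orbitData_axisFixer hΓ hfix heven).classify_anisotropic fun ω hω => ?_
  induction ω using Quotient.inductionOn' with | _ x => ?_
  induction x using Projectivization.ind with | _ v hv => ?_
  refine card_stabilizer_anisotropic hΓ hv fun H => ?_
  have h1 : 2 ≤ Nat.card (axisFixer Γ (mk F v hv)) := hω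
  rw [hiso _ ((isIsotropicPt_mk hv).2 H)] at h1
  simp at h1

/-- The number of translations is a power of the odd characteristic, hence odd; all other nontrivial
orbits are anisotropic by `mem_orbit_of_isotropic`, and `exists_torus` supplies an orbit with fixers
of order k. -/
theorem classify_of_isotropic [NeZero (2 : F)]
    [Fintype (orbitRel.Quotient Γ (ℙ F (Fin 3 → F)))]
    (hΓ : Γ ≤ specialOrthogonalGroupOf (standardTernaryForm F))
    (hfix : ∀ x : ℙ F (Fin 3 → F), ∃ g : Γ, g • x ≠ x)
    (heven : ∃ T : Set (ℙ F (Fin 3 → F)), T.ncard = 4 ∧ ∀ x ∈ T, 2 ∣ Nat.card (axisFixer Γ x))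
    (hinf : axisFixer Γ infPt ≠ ⊥) :
    IsOctahedral (isEquivariantPartition_axisFixer hΓ).orbitCard orbitStab (Nat.card Γ) ∨
    IsIcosahedral (isEquivariantPartition_axisFixer hΓ).orbitCard orbitStab (Nat.card Γ) ∨
    (Nat.card (orbit Γ (infPt : ℙ F (Fin 3 → F))) = Nat.card (translationGroup Γ) + 1 ∧
      (Nat.card (multiplierGroup Γ) = Nat.card (translationGroup Γ) - 1 ∨
        2 * Nat.card (multiplierGroup Γ) = Nat.card (translationGroup Γ) - 1)) := by
  have hisoInf : IsIsotropicPt (infPt : ℙ F (Fin 3 → F)) := (isIsotropicPt_iff _).2 (Or.inl rfl)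
  have hcard := card_axisFixer_infPt hΓ
  have hei : (isEquivariantPartition_axisFixer hΓ).orbitCard (Quotient.mk'' infPt) =
      Nat.card (translationGroup Γ) := hcard
  have hs0 : 0 < Nat.card (stabilizer Γ (infPt : ℙ F (Fin 3 → F))) := Nat.card_pos
  have horb := card_orbit_mul_card_stabilizer (Γ := Γ) (infPt : ℙ F (Fin 3 → F))
  obtain ⟨t, ht⟩ := exists_finPt_mem_orbit hΓ (hfix infPt)
  have hodd : Odd (Nat.card (translationGroup Γ)) := by
    obtain ⟨p, hp⟩ := CharP.exists F
    have : Fact p.Prime := ⟨CharP.char_is_prime F p⟩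
    obtain ⟨n, hn⟩ := IsPGroup.iff_card.1 (isPGroup_axisFixer p hΓ hisoInf)
    rw [← hcard, hn]
    refine Odd.pow ((Nat.Prime.eq_two_or_odd' Fact.out).resolve_left ?_)
    rintro rfl
    exact two_ne_zero (α := F) (by exact_mod_cast CharP.cast_eq_zero F 2)
  have h2 : 2 ≤ Nat.card (translationGroup Γ) := by
    rw [← hcard]
    have := (Subgroup.one_lt_card_iff_ne_bot (axisFixer Γ infPt)).2 hinf
    omega
  have hmain := (orbitData_axisFixer hΓ hfix heven).classify_isotropic
    (i := Quotient.mk'' infPt) (k := Nat.card (multiplierGroup Γ))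
    (by rw [hei]; exact hodd) (by rw [hei]; exact h2) Nat.card_pos (card_stabilizer_infPt hΓ)
    (by
      rw [hei]
      exact card_dvd_card_sub_one _ _ fun a ha b hb => mul_mem_translationGroup ha hb)
    (by
      rw [hei, ← horb, mul_comm]
      exact Nat.mul_le_mul_right _ (card_translationGroup_lt ht))
    (by
      intro ω hne hω
      induction ω using Quotient.inductionOn' with | _ x => ?_
      have hb : axisFixer Γ x ≠ ⊥ :=
        (Subgroup.one_lt_card_iff_ne_bot (axisFixer Γ x)).1 hω
      have hx : ¬ IsIsotropicPt x := fun hx =>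
        hne (Quotient.eq''.2 (mem_orbit_of_isotropic hΓ hisoInf hx hinf hb))
      induction x using Projectivization.ind with | _ v hv => ?_
      exact card_stabilizer_anisotropic hΓ hv (fun H => hx ((isIsotropicPt_mk hv).2 H)))
    (by
      intro hk
      obtain ⟨u, hu, hu2⟩ := exists_torus hΓ hk
      refine ⟨Quotient.mk'' u, fun H => hu ?_, hu2⟩
      rw [Quotient.eq''] at H
      obtain ⟨g, hg⟩ := H
      rw [← hg]
      exact (isIsotropicPt_smul (hΓ g.2) infPt).2 hisoInf)
  rcases hmain with h | h | ⟨h, h'⟩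
  · exact Or.inl h
  · exact Or.inr (Or.inl h)
  · right; right
    rw [hei] at h h'
    refine ⟨?_, h'⟩
    change Nat.card Γ = Nat.card (stabilizer Γ (infPt : ℙ F (Fin 3 → F))) * _ at h
    rw [← horb, mul_comm] at h
    exact Nat.eq_of_mul_eq_mul_left hs0 h

end Classification

/-! ### Recognition of Sym(4) and Alt(5) -/

section SmallGroups

open MulAction

variable {Γ X : Type*} [Group Γ] [MulAction Γ X] {C : X → Subgroup Γ}

/-- The nontrivial elements lying in the members of a partition attached to an orbit. -/
def orbitElements (C : X → Subgroup Γ) (x : X) : Set Γ :=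
  {g | g ≠ 1 ∧ ∃ y ∈ orbit Γ x, g ∈ C y}

theorem card_ne_one [Finite Γ] (H : Subgroup Γ) :
    Nat.card {g : Γ // g ∈ H ∧ g ≠ 1} = Nat.card H - 1 := by
  classical
  have := Fintype.ofFinite Γ
  have e : {g : Γ // g ∈ H ∧ g ≠ 1} ≃ {h : H // h ≠ 1} :=
    { toFun := fun g => ⟨⟨g.1, g.2.1⟩, fun h => g.2.2 (congrArg Subtype.val h)⟩
      invFun := fun h => ⟨h.1.1, h.1.2, fun H => h.2 (Subtype.ext H)⟩
      left_inv := fun g => rfl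
      right_inv := fun h => rfl }
  rw [Nat.card_congr e, Nat.card_eq_fintype_card, Nat.card_eq_fintype_card,
      Fintype.card_subtype_compl, Fintype.card_subtype_eq]

theorem card_sigma_ne_one [Finite Γ] {ι : Type*} [Finite ι] (H : ι → Subgroup Γ) {n : ℕ}
    (hn : ∀ i, Nat.card (H i) = n) :
    Nat.card (Σ i, {g : Γ // g ∈ H i ∧ g ≠ 1}) = Nat.card ι * (n - 1) := by
  have := Fintype.ofFinite ι
  rw [Nat.card_sigma]
  simp [card_ne_one, hn]

namespace IsEquivariantPartition

theorem card_of_mem_orbit (hC : IsEquivariantPartition C) {x y : X} (h : y ∈ orbit Γ x) :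
    Nat.card (C y) = Nat.card (C x) := by
  obtain ⟨g, rfl⟩ := h
  exact hC.card_smul g x

theorem ncard_orbitElements [Finite Γ] [Finite X] (hC : IsEquivariantPartition C) (x : X) :
    (orbitElements C x).ncard = Nat.card (orbit Γ x) * (Nat.card (C x) - 1) := by
  rw [← card_sigma_ne_one (fun y : orbit Γ x => C y.1) (fun y => hC.card_of_mem_orbit y.2),
    ← Nat.card_coe_set_eq]
  symm
  refine Nat.card_congr (Equiv.ofBijective
    (fun p => (⟨p.2.1, p.2.2.2, p.1.1, p.1.2, p.2.2.1⟩ : orbitElements C x)) ⟨?_, ?_⟩)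
  · rintro ⟨⟨y, hy⟩, g, hg, hg1⟩ ⟨⟨z, hz⟩, h, hh, hh1⟩ H
    obtain rfl : g = h := congrArg Subtype.val H
    obtain rfl : y = z := hC.eq_of_mem hg1 hg hh
    rfl
  · rintro ⟨g, hg1, y, hy, hg⟩
    exact ⟨⟨⟨y, hy⟩, g, hg, hg1⟩, rfl⟩

theorem card_orbit_mul_le [Finite Γ] [Finite X]
    (hC : IsEquivariantPartition C) (K : Subgroup Γ) (x : X)
    (h : orbitElements C x ⊆ K) :
    Nat.card (orbit Γ x) * (Nat.card (C x) - 1) ≤ Nat.card K - 1 := by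
  rw [← hC.ncard_orbitElements, ← card_ne_one K]
  exact (Set.ncard_le_ncard (t := {g | g ∈ K ∧ g ≠ 1}) (fun g hg => ⟨h hg, hg.1⟩)
    (Set.toFinite _)).trans (Nat.card_coe_set_eq _).ge

/-- A normal subgroup meeting a member of prime order contains the whole orbit of it. -/
theorem orbitElements_subset (hC : IsEquivariantPartition C) {K : Subgroup Γ} [hK : K.Normal]
    {x : X} (hp : (Nat.card (C x)).Prime) {g : Γ} (hg : g ∈ K) (hgx : g ∈ C x) (hg1 : g ≠ 1) :
    orbitElements C x ⊆ K := by
  have : Fact (Nat.card (C x)).Prime := ⟨hp⟩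
  have hle : C x ≤ K := by
    rw [← Subgroup.subgroupOf_eq_top]
    refine (Subgroup.eq_bot_or_eq_top_of_prime_card (K.subgroupOf (C x))).resolve_left ?_
    intro H
    have h1 : (⟨g, hgx⟩ : C x) ∈ K.subgroupOf (C x) := hg
    rw [H, Subgroup.mem_bot] at h1
    exact hg1 (congrArg Subtype.val h1)
  rintro h ⟨-, y, ⟨k, rfl⟩, hh⟩
  change h ∈ C (k • x) at hh
  rw [hC.smul_eq_map] at hh
  obtain ⟨l, hl, rfl⟩ := hh
  exact hK.conj_mem l (hle hl) k

end IsEquivariantPartition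

theorem two_le_card_of_mem {G : Type*} [Group G] [Finite G] {H : Subgroup G} {g : G} (hg : g ∈ H)
    (hg1 : g ≠ 1) : 2 ≤ Nat.card H :=
  (Subgroup.one_lt_card_iff_ne_bot H).2 fun h => hg1 (by rwa [h] at hg)

/-- The orbit of axes of order 3 has 24/6 = 4 points. The action on it is faithful, and 24 = 4!. -/
theorem nonempty_mulEquiv_perm_four [Finite Γ] [Finite X] (hC : IsEquivariantPartition C)
    (h : IsOctahedral hC.orbitCard orbitStab (Nat.card Γ)) (hfix : ∀ x : X, ∃ g : Γ, g • x ≠ x) :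
    Nonempty (Γ ≃* Equiv.Perm (Fin 4)) := by
  obtain ⟨hN, ω, he, hs, hthree⟩ := h
  induction ω using Quotient.inductionOn' with | _ x => ?_
  change Nat.card (C x) = 3 at he
  change Nat.card (stabilizer Γ x) = 6 at hs
  have horb : Nat.card (orbit Γ x) = 4 := by
    have := card_orbit_mul_card_stabilizer (Γ := Γ) x
    rw [hs, hN] at this
    omega
  let f : Γ →* Equiv.Perm (orbit Γ x) := MulAction.toPermHom Γ (orbit Γ x)
  have hle : f.ker ≤ stabilizer Γ x := by
    intro g hg
    have h1 : f g ⟨x, mem_orbit_self x⟩ = ⟨x, mem_orbit_self x⟩ := by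
      rw [MonoidHom.mem_ker.1 hg]; rfl
    exact congrArg Subtype.val h1
  have hdvd : Nat.card f.ker ∣ 6 := hs ▸ Subgroup.card_dvd_of_le hle
  -- A kernel element of order 3 would bring all 4 · 2 elements of this orbit into a group of order
  -- at most 6.
  have h3 : ¬ 3 ∣ Nat.card f.ker := by
    intro h3
    have : Fact (Nat.Prime 3) := ⟨Nat.prime_three⟩
    obtain ⟨g, hg⟩ := exists_prime_orderOf_dvd_card' 3 h3
    have hg' : orderOf g.1 = 3 := by rw [← hg]; exact Subgroup.orderOf_coe g
    have hg1 : g.1 ≠ 1 := by intro H; rw [H, orderOf_one] at hg'; omega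
    obtain ⟨y, hy, -⟩ := hC.existsUnique g.1 hg1
    have hy3 : 3 ∣ Nat.card (C y) := hg' ▸ Subgroup.orderOf_dvd_natCard _ hy
    have hyx : y ∈ orbit Γ x := Quotient.eq''.1 (hthree (Quotient.mk'' y) hy3)
    have hcy : Nat.card (C y) = 3 := (hC.card_of_mem_orbit hyx).trans he
    have h4 := hC.card_orbit_mul_le f.ker y
      (hC.orbitElements_subset (by rw [hcy]; exact Nat.prime_three) g.2 hy hg1)
    rw [orbit_eq_iff.2 hyx, horb, hcy] at h4
    have := Nat.le_of_dvd (by norm_num) hdvd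
    omega
  -- Otherwise the kernel has order two and its generator is central, so its axis would be fixed by
  -- Γ.
  have hker : f.ker = ⊥ := by
    by_contra hne
    have h2 : Nat.card f.ker = 2 := by
      have h1 := (Subgroup.one_lt_card_iff_ne_bot f.ker).2 hne
      have := Nat.le_of_dvd (by norm_num) hdvd
      generalize Nat.card f.ker = n at *
      interval_cases n <;> omega
    obtain ⟨⟨g, hg⟩, hg1⟩ := Subgroup.ne_bot_iff_exists_ne_one.1 hne
    have hg1 : g ≠ 1 := fun H => hg1 (Subtype.ext H)
    obtain ⟨y, hy, -⟩ := hC.existsUnique g hg1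
    obtain ⟨k, hk⟩ := hfix y
    have hconj : k * g * k⁻¹ ∈ f.ker := (inferInstance : f.ker.Normal).conj_mem g hg k
    have heq : k * g * k⁻¹ = g := by
      obtain ⟨a, b, hab, hall⟩ := Nat.card_eq_two_iff.1 h2
      have hm (z : f.ker) : z = a ∨ z = b := by
        have : z ∈ ({a, b} : Set f.ker) := hall ▸ Set.mem_univ z
        simpa using this
      have hne2 : (⟨k * g * k⁻¹, hconj⟩ : f.ker) ≠ 1 := fun H => hg1 (by
        simpa using congrArg Subtype.val H)
      have hne3 : (⟨g, hg⟩ : f.ker) ≠ 1 := fun H => hg1 (congrArg Subtype.val H)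
      have : (⟨k * g * k⁻¹, hconj⟩ : f.ker) = ⟨g, hg⟩ := by
        rcases hm 1 with h1 | h1 <;> rcases hm ⟨k * g * k⁻¹, hconj⟩ with h2 | h2 <;>
          rcases hm ⟨g, hg⟩ with h3 | h3 <;> simp_all
      exact congrArg Subtype.val this
    exact hk (hC.eq_of_mem hg1 (heq ▸ hC.conj k g y hy) hy)
  have hinj : Function.Injective f := (MonoidHom.ker_eq_bot_iff f).1 hker
  have e : orbit Γ x ≃ Fin 4 := Finite.equivFinOfCardEq horb
  have hcard : Nat.card Γ = Nat.card (Equiv.Perm (orbit Γ x)) := by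
    rw [Nat.card_perm, horb, hN]; rfl
  exact ⟨(MulEquiv.ofBijective f
    ((Nat.bijective_iff_injective_and_card f).2 ⟨hinj, hcard⟩)).trans e.permCongrHom⟩

/-- The 15 involutions are distributed in threes among the Sylow 2-subgroups, so there are five of
these; the action on them is faithful, and a subgroup of index two in Sym(5) is Alt(5). -/
theorem nonempty_mulEquiv_alternating_five [Finite Γ] [Finite X]
    (hC : IsEquivariantPartition C)
    (h : IsIcosahedral hC.orbitCard orbitStab (Nat.card Γ)) :
    Nonempty (Γ ≃* alternatingGroup (Fin 5)) := by
  obtain ⟨hN, hall, ω, he, htwo⟩ := h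
  induction ω using Quotient.inductionOn' with | _ x => ?_
  change Nat.card (C x) = 2 at he
  have hall' (y : X) (hy : 2 ≤ Nat.card (C y)) :
      (Nat.card (C y) = 2 ∧ Nat.card (stabilizer Γ y) = 4) ∨
      (Nat.card (C y) = 3 ∧ Nat.card (stabilizer Γ y) = 6) ∨
      (Nat.card (C y) = 5 ∧ Nat.card (stabilizer Γ y) = 10) := hall (Quotient.mk'' y) hy
  have hfact : Fact (Nat.Prime 2) := ⟨Nat.prime_two⟩
  have hsyl (P : Sylow 2 Γ) : Nat.card P = 4 := by
    rw [P.card_eq_multiplicity, hN]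
    rw [show (60 : ℕ).factorization 2 = 2 by
      rw [show 60 = 2 ^ 2 * 15 by norm_num, Nat.factorization_mul (by norm_num) (by norm_num),
        Nat.Prime.factorization_pow Nat.prime_two, Finsupp.add_apply, Finsupp.single_eq_same,
        Nat.factorization_eq_zero_of_not_dvd (by norm_num)]]
    norm_num
  -- P has order 4 and is abelian, so it stabilises the axis of each of its nontrivial elements, and
  -- this stabiliser has order 4. Hence distinct Sylow 2-subgroups meet trivially.
  have hPelt (P : Sylow 2 Γ) {g : Γ} (hg : g ∈ P) (hg1 : g ≠ 1) {y : X} (hy : g ∈ C y) :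
      y ∈ orbit Γ x ∧ (P : Subgroup Γ) = stabilizer Γ y := by
    have h2 : 2 ∣ Nat.card (C y) := by
      have h3 : orderOf g ∣ 4 := by rw [← hsyl P]; exact Subgroup.orderOf_dvd_natCard _ hg
      have h4 : orderOf g ∣ Nat.card (C y) := Subgroup.orderOf_dvd_natCard _ hy
      have h5 : orderOf g ≠ 1 := fun H => hg1 (orderOf_eq_one_iff.1 H)
      refine Dvd.dvd.trans ?_ h4
      have h6 := Nat.le_of_dvd (by norm_num) h3
      generalize orderOf g = n at *
      interval_cases n <;> omega
    have hyx : y ∈ orbit Γ x := Quotient.eq''.1 (htwo (Quotient.mk'' y) h2)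
    refine ⟨hyx, ?_⟩
    have hs : Nat.card (stabilizer Γ y) = 4 := by
      have := hC.card_of_mem_orbit hyx
      have := hall' y (two_le_card_of_mem hy hg1)
      omega
    refine Subgroup.eq_of_le_of_card_ge ?_ (by rw [hs]; exact (hsyl P).ge)
    intro k hk
    have hcomm := (IsPGroup.isMulCommutative_of_card_eq_prime_sq (p := 2) (G := P)
      (by rw [hsyl P]; rfl)).is_comm.comm
    have h7 : k * g * k⁻¹ = g := by
      have := congrArg Subtype.val (hcomm ⟨k, hk⟩ ⟨g, hg⟩)
      change k * g = g * k at this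
      rw [this, mul_inv_cancel_right]
    exact hC.eq_of_mem hg1 (h7 ▸ hC.conj k g y hy) hy
  have hcount : Nat.card (Sylow 2 Γ) = 5 := by
    have h1 := hC.ncard_orbitElements x
    have hsx : Nat.card (stabilizer Γ x) = 4 := by
      have := hall' x he.ge
      omega
    have horb := card_orbit_mul_card_stabilizer (Γ := Γ) x
    rw [he] at h1
    have h2 := card_sigma_ne_one (fun P : Sylow 2 Γ => (P : Subgroup Γ)) hsyl
    have h3 : Nat.card (Σ P : Sylow 2 Γ, {g : Γ // g ∈ (P : Subgroup Γ) ∧ g ≠ 1}) =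
        (orbitElements C x).ncard := by
      rw [← Nat.card_coe_set_eq]
      refine Nat.card_congr (Equiv.ofBijective (fun p => (⟨p.2.1, p.2.2.2, ?_⟩ :
        orbitElements C x)) ⟨?_, ?_⟩)
      · obtain ⟨y, hy, -⟩ := hC.existsUnique p.2.1 p.2.2.2
        exact ⟨y, (hPelt p.1 p.2.2.1 p.2.2.2 hy).1, hy⟩
      · rintro ⟨P, g, hg, hg1⟩ ⟨R, h, hh, hh1⟩ H
        obtain rfl : g = h := congrArg Subtype.val H
        obtain ⟨y, hy, -⟩ := hC.existsUnique g hg1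
        obtain rfl : P = R := Sylow.ext
          ((hPelt P hg hg1 hy).2.trans (hPelt R hh hg1 hy).2.symm)
        rfl
      · rintro ⟨g, hg1, y, hy, hg⟩
        have hz : IsPGroup 2 (C y) := IsPGroup.of_card (n := 1) (by
          rw [hC.card_of_mem_orbit hy, he]; rfl)
        obtain ⟨P, hP⟩ := hz.exists_le_sylow
        exact ⟨⟨P, g, hP hg, hg1⟩, rfl⟩
    rw [hsx, hN] at horb
    rw [h3, h1] at h2
    omega
  let f : Γ →* Equiv.Perm (Sylow 2 Γ) := MulAction.toPermHom Γ (Sylow 2 Γ)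
  obtain ⟨P⟩ : Nonempty (Sylow 2 Γ) := inferInstance
  have hker12 : Nat.card f.ker ∣ 12 := by
    have hle : f.ker ≤ stabilizer Γ P := by
      intro g hg
      have h1 : f g P = P := by rw [MonoidHom.mem_ker.1 hg]; rfl
      exact h1
    have h2 : Nat.card (stabilizer Γ P) = 12 := by
      have h3 := card_orbit_mul_card_stabilizer (Γ := Γ) P
      have h4 : Nat.card (orbit Γ P) = 5 := by
        rw [orbit_eq_univ, ← hcount]; exact Nat.card_congr (Equiv.Set.univ _)
      rw [h4, hN] at h3
      omega
    exact h2 ▸ Subgroup.card_dvd_of_le hle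
  -- A nontrivial normal subgroup contains a full class of 15, 20 or 24 elements, too many for an
  -- order dividing 12.
  have hker : f.ker = ⊥ := by
    by_contra hne
    have h1 := (Subgroup.one_lt_card_iff_ne_bot f.ker).2 hne
    obtain ⟨l, hl, hlk⟩ := Nat.exists_prime_and_dvd h1.ne'
    have : Fact l.Prime := ⟨hl⟩
    obtain ⟨g, hg⟩ := exists_prime_orderOf_dvd_card' l hlk
    have hg' : orderOf g.1 = l := by rw [← hg]; exact Subgroup.orderOf_coe g
    have hg1 : g.1 ≠ 1 := by
      intro H; rw [H, orderOf_one] at hg'; exact hl.one_lt.ne hg'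
    obtain ⟨y, hy, -⟩ := hC.existsUnique g.1 hg1
    have hly : l ∣ Nat.card (C y) := hg' ▸ Subgroup.orderOf_dvd_natCard _ hy
    have hy2 := hall' y (two_le_card_of_mem hy hg1)
    have hpr : (Nat.card (C y)).Prime := by
      rcases hy2 with ⟨h, -⟩ | ⟨h, -⟩ | ⟨h, -⟩ <;> rw [h] <;> norm_num
    have hle := hC.card_orbit_mul_le f.ker y (hC.orbitElements_subset hpr g.2 hy hg1)
    have horb := card_orbit_mul_card_stabilizer (Γ := Γ) y
    have h12 := Nat.le_of_dvd (by norm_num) hker12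
    rcases hy2 with ⟨h, h'⟩ | ⟨h, h'⟩ | ⟨h, h'⟩ <;> rw [h] at hle <;> rw [h'] at horb <;> omega
  have hinj : Function.Injective f := (MonoidHom.ker_eq_bot_iff f).1 hker
  have e : Sylow 2 Γ ≃ Fin 5 := Finite.equivFinOfCardEq hcount
  let f' : Γ →* Equiv.Perm (Fin 5) := e.permCongrHom.toMonoidHom.comp f
  have hinj' : Function.Injective f' := e.permCongrHom.injective.comp hinj
  have hr : Nat.card f'.range = 60 := by
    rw [← hN]; exact (Nat.card_congr (MonoidHom.ofInjective hinj').toEquiv).symm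
  have hidx : f'.range.index = 2 := by
    have := Subgroup.card_mul_index f'.range
    rw [hr, Nat.card_perm, Nat.card_fin] at this
    have h120 : Nat.factorial 5 = 120 := rfl
    omega
  rw [← Equiv.Perm.eq_alternatingGroup_of_index_eq_two hidx]
  exact ⟨MonoidHom.ofInjective hinj'⟩

end SmallGroups

/-! ### Isometries defined over a subfield -/

section SubfieldGroups

open Projectivization

variable {F : Type*} [Field F]

/-- Matrices over a subfield, seen over the field. -/
noncomputable def subfieldEmb (K : Subfield F) : GL (Fin 3) K →* GL (Fin 3) F :=
  Matrix.GeneralLinearGroup.map K.subtype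

theorem subfieldEmb_apply (K : Subfield F) (g : GL (Fin 3) K) (i j : Fin 3) :
    (subfieldEmb K g).1 i j = (g.1 i j : F) := rfl

theorem subfieldEmb_injective (K : Subfield F) : Function.Injective (subfieldEmb K) := by
  intro g h H
  apply Units.ext
  ext i j
  have := congrArg (fun x : GL (Fin 3) F => x.1 i j) H
  simpa [subfieldEmb_apply] using this

/-- The isometries of the standard ternary form defined over a subfield. -/
noncomputable def rationalSO (K : Subfield F) : Subgroup (GL (Fin 3) F) :=
  (specialOrthogonalGroupOf (standardTernaryForm K)).map (subfieldEmb K)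

variable {K : Subfield F}

theorem subfieldEmb_affineElt (a : Kˣ) (c : K) :
    subfieldEmb K (affineElt a c) = affineElt (Units.map K.subtype.toMonoidHom a) (c : F) := by
  apply Units.ext
  ext i j
  rw [subfieldEmb_apply]
  have h2 : ((2 : K) : F) = 2 := rfl
  fin_cases i <;> fin_cases j <;> simp [affineElt, h2]

theorem affineElt_mem_rationalSO {a : Fˣ} {c : F} (ha : a.1 ∈ K) (hc : c ∈ K) :
    affineElt a c ∈ rationalSO K := by
  have ha0 : (⟨a.1, ha⟩ : K) ≠ 0 := fun H => a.ne_zero (congrArg Subtype.val H)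
  refine ⟨affineElt (Units.mk0 ⟨a.1, ha⟩ ha0) ⟨c, hc⟩, affineElt_mem _ _, ?_⟩
  rw [subfieldEmb_affineElt]
  congr 1
  ext; rfl

theorem swapElt_mem_rationalSO : swapElt ∈ rationalSO K := by
  refine ⟨swapElt, swapElt_mem, ?_⟩
  apply Units.ext
  ext i j
  rw [subfieldEmb_apply]
  fin_cases i <;> fin_cases j <;> simp [swapElt]

theorem coe_mem_of_mem_rationalSO {g : GL (Fin 3) F} (hg : g ∈ rationalSO K) (i j : Fin 3) :
    g.1 i j ∈ K := by
  obtain ⟨x, -, rfl⟩ := hg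
  exact (x.1 i j).2

theorem mem_of_affineElt_mem_rationalSO {a : Fˣ} {c : F} (h : affineElt a c ∈ rationalSO K) :
    a.1 ∈ K ∧ c ∈ K := by
  have h1 : a.1 ∈ K := coe_mem_of_mem_rationalSO h 2 2
  have h2 : (a⁻¹ : Fˣ).1 * c ∈ K := coe_mem_of_mem_rationalSO h 1 0
  have h3 := mul_mem h1 h2
  simp at h3
  exact ⟨h1, h3⟩

theorem rationalSO_le :
    rationalSO K ≤ specialOrthogonalGroupOf (standardTernaryForm F) := by
  rintro _ ⟨g, hg, rfl⟩
  obtain ⟨h1, h2⟩ := mem_specialOrthogonal.1 hg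
  rw [mem_specialOrthogonal]
  have hcoe (v : Fin 3 → K) (i : Fin 3) : (subfieldEmb K g • fun j => (v j : F)) i = (g • v) i := by
    simp [GL_smul_eq_mulVec, Matrix.mulVec, dotProduct, subfieldEmb_apply]
  have hdet : (subfieldEmb K g).1.det = ((g.1.det : K) : F) := by
    rw [Matrix.det_fin_three, Matrix.det_fin_three]
    simp [subfieldEmb_apply]
  have hpol (u v : Fin 3 → K) : ternaryPolar (subfieldEmb K g • fun j => (u j : F))
      (subfieldEmb K g • fun j => (v j : F)) = ternaryPolar (fun j => (u j : F)) fun j => v j := by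
    have := congrArg K.subtype (ternaryPolar_smul hg u v)
    simp only [ternaryPolar, hcoe, map_add, map_sub, map_mul, map_ofNat] at this ⊢
    exact this
  have hQ (u : Fin 3 → K) : standardTernaryForm F (subfieldEmb K g • fun j => (u j : F)) =
      standardTernaryForm F (fun j => (u j : F)) := by
    have := h1 u
    simp only [standardTernaryForm_apply, hcoe] at this ⊢
    exact_mod_cast congrArg (Subtype.val : K → F) this
  refine ⟨fun v => ?_, by rw [hdet, h2]; rfl⟩
  -- The form is determined by its values and polar values on the standard basis, which is defined
  -- over K.
  set e : Fin 3 → Fin 3 → F := fun i => (fun j => ((Pi.single i 1 : Fin 3 → K) j : F)) with he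
  have hv : v = v 0 • e 0 + v 1 • e 1 + v 2 • e 2 := by
    ext i; fin_cases i <;> simp [he, Pi.single_apply]
  have expand (x y z : Fin 3 → F) (a b c : F) : standardTernaryForm F (a • x + b • y + c • z) =
      a ^ 2 * standardTernaryForm F x + b ^ 2 * standardTernaryForm F y +
      c ^ 2 * standardTernaryForm F z + a * b * ternaryPolar x y + a * c * ternaryPolar x z +
      b * c * ternaryPolar y z := by
    simp only [standardTernaryForm_apply, ternaryPolar, Pi.add_apply, Pi.smul_apply, smul_eq_mul]
    ring
  rw [hv, smul_add, smul_add, smul_comm _ (v 0), smul_comm _ (v 1), smul_comm _ (v 2), expand,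
    expand, hQ, hQ, hQ, hpol, hpol, hpol]

/-- A point of the standard conic defined over a subfield. -/
def IsRationalPt (K : Subfield F) (x : ℙ F (Fin 3 → F)) : Prop :=
  x = infPt ∨ ∃ c ∈ K, x = finPt c

theorem isRationalPt_smul {g : GL (Fin 3) F} (hg : g ∈ rationalSO K) {x : ℙ F (Fin 3 → F)}
    (hx : IsRationalPt K x) : IsRationalPt K (g • x) := by
  obtain ⟨v, hv, hvx, hK⟩ : ∃ (v : Fin 3 → F) (hv : v ≠ 0), x = mk F v hv ∧ ∀ i, v i ∈ K := by
    rcases hx with rfl | ⟨c, hc, rfl⟩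
    · refine ⟨_, conicInf_ne_zero, rfl, fun i => ?_⟩
      fin_cases i <;> simp [conicInf]
    · refine ⟨_, conicVec_ne_zero c, rfl, fun i => ?_⟩
      fin_cases i
      · simp [conicVec]
      · simpa [conicVec] using hc
      · simpa [conicVec] using pow_mem hc 2
  have hQ : standardTernaryForm F v = 0 := by
    rw [← isIsotropicPt_mk hv, ← hvx, isIsotropicPt_iff]
    exact hx.imp id fun ⟨c, _, h⟩ => ⟨c, h⟩
  have hgK (i : Fin 3) : (g • v) i ∈ K := by
    rw [GL_smul_eq_mulVec]
    change (∑ j, g.1 i j * v j) ∈ K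
    exact sum_mem fun j _ => mul_mem (coe_mem_of_mem_rationalSO hg i j) (hK j)
  rw [hvx, smul_mk]
  have hgv := (mem_specialOrthogonal.1 (rationalSO_le hg)).1 v
  rw [hQ] at hgv
  rcases isotropic_cases hgv with h | ⟨h0, h⟩
  · left
    rw [infPt, mk_eq_mk_iff']
    exact ⟨_, h.symm⟩
  · right
    refine ⟨(g • v) 1 / (g • v) 0, div_mem (hgK 1) (hgK 0), ?_⟩
    rw [finPt, mk_eq_mk_iff']
    exact ⟨_, h.symm⟩

variable [NeZero (2 : F)]

/-- After composition with a rational isometry g fixes infinity, so it is t ↦ at + c, and the images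
of 0 and 1 show that a and c lie in K. -/
theorem mem_rationalSO {g : GL (Fin 3) F}
    (hg : g ∈ specialOrthogonalGroupOf (standardTernaryForm F))
    (h : ∀ x, IsRationalPt K x → IsRationalPt K (g • x)) : g ∈ rationalSO K := by
  have key (g : GL (Fin 3) F) (hg : g ∈ specialOrthogonalGroupOf (standardTernaryForm F))
      (h : ∀ x, IsRationalPt K x → IsRationalPt K (g • x))
      (hinf : g • (infPt : ℙ F (Fin 3 → F)) = infPt) :
      g ∈ rationalSO K := by
    obtain ⟨a, c, rfl⟩ := smul_infPt_eq hg hinf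
    have h0 := h (finPt 0) (Or.inr ⟨0, zero_mem _, rfl⟩)
    have h1 := h (finPt 1) (Or.inr ⟨1, one_mem _, rfl⟩)
    rw [affineElt_smul_finPt] at h0 h1
    obtain ⟨x, hx, hx'⟩ := h0.resolve_left (finPt_ne_infPt _)
    obtain ⟨y, hy, hy'⟩ := h1.resolve_left (finPt_ne_infPt _)
    have hx'' := finPt_injective hx'
    have hy'' := finPt_injective hy'
    simp only [mul_zero, zero_add, mul_one] at hx'' hy''
    subst hx''
    refine affineElt_mem_rationalSO ?_ hx
    rw [eq_sub_of_add_eq hy'']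
    exact sub_mem hy hx
  rcases h infPt (Or.inl rfl) with hinf | ⟨x, hx, hgx⟩
  · exact key g hg h hinf
  · set k : GL (Fin 3) F := swapElt * affineElt 1 (-x) with hk
    have hkS : k ∈ rationalSO K := mul_mem swapElt_mem_rationalSO
      (affineElt_mem_rationalSO (by rw [Units.val_one]; exact one_mem _) (neg_mem hx))
    have h1 := key (k * g) (mul_mem (rationalSO_le hkS) hg)
      (fun y hy => by rw [mul_smul]; exact isRationalPt_smul hkS (h y hy)) (by
        rw [mul_smul, hgx, hk, mul_smul, affineElt_smul_finPt, Units.val_one, one_mul,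
          add_neg_cancel, swapElt_smul_finPt_zero])
    exact (Subgroup.mul_mem_cancel_left _ hkS).1 h1

theorem exists_affineElt_of_smul_eq {g h : GL (Fin 3) F} (hg : g ∈ rationalSO K)
    (hh : h ∈ rationalSO K) (H : h • infPt = g • (infPt : ℙ F (Fin 3 → F))) :
    ∃ (a : Fˣ) (c : F), a.1 ∈ K ∧ c ∈ K ∧ g = h * affineElt a c := by
  have hm := mul_mem (inv_mem hh) hg
  obtain ⟨a, c, hac⟩ := smul_infPt_eq (rationalSO_le hm) (by
    rw [mul_smul, ← H, inv_smul_smul])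
  rw [hac] at hm
  obtain ⟨ha, hc⟩ := mem_of_affineElt_mem_rationalSO hm
  exact ⟨a, c, ha, hc, by rw [← hac, mul_inv_cancel_left]⟩

end SubfieldGroups

/-! ### Passage to the projective groups -/

section ProjectiveImages

variable {K : Type*} [Field K]

/-- A scalar u preserving the form has u² = 1, and determinant one gives u³ = 1. -/
theorem eq_one_of_mk_eq_one {g : GL (Fin 3) K}
    (hg : g ∈ specialOrthogonalGroupOf (standardTernaryForm K))
    (h : (Matrix.ProjGenLinGroup.mk g : PGL(3, K)) = 1) : g = 1 := by
  rw [← map_one Matrix.ProjGenLinGroup.mk, eq_comm, Matrix.ProjGenLinGroup.mk_eq_mk_iff] at h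
  obtain ⟨u, hu⟩ := h
  rw [one_mul] at hu
  obtain ⟨h1, h2⟩ := mem_specialOrthogonal.1 hg
  have hs (v : Fin 3 → K) : g • v = u.1 • v := by
    rw [← hu, GL_smul_eq_mulVec]
    ext i
    simp [Matrix.GeneralLinearGroup.scalar, Matrix.scalar, Matrix.mulVec_diagonal]
  have h3 := h1 ![1, 0, 1]
  rw [hs, QuadraticMap.map_smul, standardTernaryForm_apply] at h3
  simp at h3
  have h4 : u.1 ^ 3 = 1 := by
    rw [← h2, ← hu]
    simp [Matrix.GeneralLinearGroup.scalar, Matrix.scalar, Matrix.det_diagonal]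
  have h5 : u.1 = 1 := by linear_combination h4 - u.1 * h3
  apply GL_ext_smul
  intro v
  rw [hs, h5, one_smul, one_smul]

theorem nonempty_mulEquiv_map_of_injOn {G G' : Type*} [Group G] [Group G'] (φ : G →* G')
    (H : Subgroup G) (h : ∀ x ∈ H, φ x = 1 → x = 1) : Nonempty (H ≃* H.map φ) := by
  refine ⟨MulEquiv.ofBijective (φ.subgroupMap H) ⟨?_, φ.subgroupMap_surjective _⟩⟩
  rw [injective_iff_map_eq_one]
  intro g hg
  exact Subtype.ext (h _ g.2 (congrArg Subtype.val hg))

theorem nonempty_mulEquiv_map_mk_of_le {H : Subgroup (GL (Fin 3) K)}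
    (hH : H ≤ specialOrthogonalGroupOf (standardTernaryForm K)) :
    Nonempty (H ≃* H.map (Matrix.ProjGenLinGroup.mk : GL (Fin 3) K →* PGL(3, K))) :=
  nonempty_mulEquiv_map_of_injOn _ H fun _ hg h => eq_one_of_mk_eq_one (hH hg) h

/-- An isometry of a ternary form is, up to sign, of determinant one. -/
theorem exists_sign {g : GL (Fin 3) K} (hg : g ∈ orthogonalGroupOf (standardTernaryForm K))
    [NeZero (2 : K)] :
    g ∈ specialOrthogonalGroupOf (standardTernaryForm K) ∨
      -g ∈ specialOrthogonalGroupOf (standardTernaryForm K) := by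
  have t2 : (2 : K) ≠ 0 := two_ne_zero
  set J : Matrix (Fin 3) (Fin 3) K := !![0, 0, 1; 0, -2, 0; 1, 0, 0] with hJ
  have hJ0 : J.det ≠ 0 := by simp [hJ, Matrix.det_fin_three, t2]
  have hpol (u v : Fin 3 → K) : dotProduct u (J.mulVec v) = ternaryPolar u v := by
    simp [hJ, ternaryPolar, Matrix.mulVec, dotProduct, Fin.sum_univ_three]; ring
  have hQ (v : Fin 3 → K) : standardTernaryForm K (g • v) = standardTernaryForm K v := hg v
  have hJg : g.1.transpose * J * g.1 = J := by
    apply Matrix.ext_of_mulVec_single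
    intro j
    ext i
    have : ternaryPolar (g • (Pi.single i 1 : Fin 3 → K)) (g • Pi.single j 1) =
        ternaryPolar (Pi.single i 1) (Pi.single j 1) := by
      rw [ternaryPolar_eq, ternaryPolar_eq, ← smul_add, hQ, hQ, hQ]
    rw [← hpol, ← hpol, GL_smul_eq_mulVec, GL_smul_eq_mulVec] at this
    rw [← single_one_dotProduct i (Matrix.mulVec _ _), ← single_one_dotProduct i (J.mulVec _),
      ← this, ← Matrix.mulVec_mulVec, ← Matrix.mulVec_mulVec, Matrix.dotProduct_mulVec,
      Matrix.vecMul_transpose]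
  have hdet : g.1.det * g.1.det = 1 := by
    have := congrArg Matrix.det hJg
    rw [Matrix.det_mul, Matrix.det_mul, Matrix.det_transpose] at this
    apply mul_right_cancel₀ hJ0
    linear_combination this
  rcases mul_self_eq_one_iff.1 hdet with h | h
  · left; exact mem_specialOrthogonal.2 ⟨hQ, h⟩
  · right
    refine mem_specialOrthogonal.2 ⟨fun v => ?_, ?_⟩
    · have : (-g) • v = - (g • v) := by simp [GL_smul_eq_mulVec]
      rw [this, QuadraticMap.map_neg, hQ]
    · rw [Units.val_neg, Matrix.det_neg, h]; norm_num

open scoped commutatorElement in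
-- Every isometry has determinant one up to the central sign -1, which cancels in commutators.
theorem omegaGroupOf_eq [NeZero (2 : K)] : omegaGroupOf (standardTernaryForm K) =
    ⁅specialOrthogonalGroupOf (standardTernaryForm K),
      specialOrthogonalGroupOf (standardTernaryForm K)⁆ := by
  apply le_antisymm
  · rw [omegaGroupOf, Subgroup.commutator_le]
    intro a ha b hb
    have hneg (x y : GL (Fin 3) K) : ⁅-x, y⁆ = ⁅x, y⁆ ∧ ⁅x, -y⁆ = ⁅x, y⁆ := by
      simp [commutatorElement_def]
    rcases exists_sign ha with h1 | h1 <;> rcases exists_sign hb with h2 | h2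
    · exact Subgroup.commutator_mem_commutator h1 h2
    · rw [← (hneg a b).2]; exact Subgroup.commutator_mem_commutator h1 h2
    · rw [← (hneg a b).1]; exact Subgroup.commutator_mem_commutator h1 h2
    · rw [← (hneg a b).1, ← (hneg (-a) b).2]; exact Subgroup.commutator_mem_commutator h1 h2
  · exact Subgroup.commutator_mono inf_le_left inf_le_left

end ProjectiveImages

/-! ### Identification with SO or Ω over a subfield -/

section Identification

open Projectivization

variable {F : Type*} [Field F]

/-- An additive subgroup containing one, stable under a group of units comprising at least half of
its nonzero elements, is a subfield. -/
theorem exists_subfield_of_units [Finite F] (A : Subgroup Fˣ) (B : AddSubgroup F) (h1 : (1 : F) ∈ B)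
    (h : ∀ a ∈ A, ∀ b ∈ B, a.1 * b ∈ B) (hcard : Nat.card B ≤ 2 * Nat.card A + 1) :
    ∃ K : Subfield F, ∀ x, x ∈ K ↔ x ∈ B := by
  have hAB : ∀ a ∈ A, a.1 ∈ B := fun a ha => by simpa using h a ha 1 h1
  set R : AddSubgroup F := AddSubgroup.closure ((fun a : Fˣ => a.1) '' (A : Set Fˣ)) with hR
  have hRB : R ≤ B := by
    rw [hR, AddSubgroup.closure_le]
    rintro _ ⟨a, ha, rfl⟩
    exact hAB a ha
  have hRcard : Nat.card A + 1 ≤ Nat.card R := by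
    have h2 : (insert (0 : F) ((fun a : Fˣ => a.1) '' (A : Set Fˣ))).ncard = Nat.card A + 1 := by
      rw [Set.ncard_insert_of_notMem, Set.ncard_image_of_injective _ Units.val_injective]
      · rfl
      · rintro ⟨a, -, ha⟩
        exact a.ne_zero ha
    rw [← h2]
    refine Set.ncard_le_ncard (Set.insert_subset (zero_mem R) AddSubgroup.subset_closure)
      (Set.toFinite _)
  -- The additive span R of the units has more than half the elements of B, so it is B by Lagrange.
  -- Stability of B under the units then becomes closure under products.
  have hRB' : R = B := by
    obtain ⟨d, hd⟩ := AddSubgroup.card_dvd_of_le hRB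
    have hB : 0 < Nat.card B := Nat.card_pos
    have hd1 : d = 1 := by
      have h0 : d ≠ 0 := by rintro rfl; omega
      by_contra H
      have : 2 ≤ d := by omega
      have : Nat.card R * 2 ≤ Nat.card R * d := Nat.mul_le_mul_left _ this
      omega
    rw [hd1, mul_one] at hd
    exact AddSubgroup.eq_of_le_of_card_ge hRB hd.le
  have hmul : ∀ {x y : F}, x ∈ B → y ∈ B → x * y ∈ B := by
    intro x y hx hy
    rw [← hRB', hR] at hx
    induction hx using AddSubgroup.closure_induction with
    | mem x hx => obtain ⟨a, ha, rfl⟩ := hx; exact h a ha y hy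
    | zero => rw [zero_mul]; exact zero_mem _
    | add x z _ _ hx hz => rw [add_mul]; exact add_mem hx hz
    | neg x _ hx => rw [neg_mul]; exact neg_mem hx
  let S : Subring F :=
    { B with
      one_mem' := h1
      mul_mem' := hmul }
  refine ⟨{ S with
    inv_mem' := fun x hx => ?_ }, fun x => Iff.rfl⟩
  by_cases hx0 : x = 0
  · rw [hx0, inv_zero]; exact zero_mem S
  · have := Fintype.ofFinite F
    have h3 : x⁻¹ = x ^ (Fintype.card F - 2) := by
      apply inv_eq_of_mul_eq_one_right
      rw [← pow_succ']
      have : 1 < Fintype.card F := Fintype.one_lt_card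
      rw [show Fintype.card F - 2 + 1 = Fintype.card F - 1 by omega]
      exact FiniteField.pow_card_sub_one_eq_one x hx0
    rw [h3]
    have hx' : x ∈ S := hx
    exact (pow_mem hx' _ : x ^ _ ∈ S)

variable {Γ : Subgroup (GL (Fin 3) F)} {K : Subfield F}

/-- A group of isometries whose orbit of the infinite point is the conic over a subfield, and whose
translations are those by the subfield. -/
structure IsConicGroup (K : Subfield F) (Γ : Subgroup (GL (Fin 3) F)) : Prop where
  le : Γ ≤ specialOrthogonalGroupOf (standardTernaryForm F)
  mem_translation : ∀ c, affineElt 1 c ∈ Γ ↔ c ∈ K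
  orbit_rational : ∀ g ∈ Γ, IsRationalPt K (g • (infPt : ℙ F (Fin 3 → F)))
  zero_mem_orbit : ∃ g ∈ Γ, g • (infPt : ℙ F (Fin 3 → F)) = finPt 0

namespace IsConicGroup

theorem exists_smul_eq (h : IsConicGroup K Γ) {x : ℙ F (Fin 3 → F)} (hx : IsRationalPt K x) :
    ∃ g ∈ Γ, g • infPt = x := by
  rcases hx with rfl | ⟨c, hc, rfl⟩
  · exact ⟨1, one_mem _, one_smul _ _⟩
  · obtain ⟨g, hg, h0⟩ := h.zero_mem_orbit
    refine ⟨affineElt 1 c * g, mul_mem ((h.mem_translation c).2 hc) hg, ?_⟩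
    rw [mul_smul, h0, affineElt_smul_finPt]; simp

theorem le_rationalSO [NeZero (2 : F)] (h : IsConicGroup K Γ) : Γ ≤ rationalSO K := by
  intro g hg
  refine mem_rationalSO (h.le hg) fun x hx => ?_
  obtain ⟨k, hk, rfl⟩ := h.exists_smul_eq hx
  rw [← mul_smul]
  exact h.orbit_rational _ (mul_mem hg hk)

theorem mem_of_mem_multiplierGroup [NeZero (2 : F)] (h : IsConicGroup K Γ)
    {a : Fˣ} (ha : a ∈ multiplierGroup Γ)
    {c : F} (hc : c ∈ K) : affineElt a c ∈ Γ := by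
  obtain ⟨d, hd⟩ := ha
  have hdK := (mem_of_affineElt_mem_rationalSO (h.le_rationalSO hd)).2
  have := mul_mem ((h.mem_translation (c - d)).2 (sub_mem hc hdK)) hd
  rw [affineElt_mul] at this
  simpa using this

/-- Every rational isometry is the product of an element of the group and a diagonal one. -/
theorem exists_eq_mul_diag [NeZero (2 : F)] (h : IsConicGroup K Γ)
    {g : GL (Fin 3) F} (hg : g ∈ rationalSO K) :
    ∃ k ∈ Γ, ∃ a : Fˣ, a.1 ∈ K ∧ g = k * affineElt a 0 := by
  obtain ⟨k, hk, hk'⟩ := h.exists_smul_eq (isRationalPt_smul hg (Or.inl rfl))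
  obtain ⟨a, c, ha, hc, hac⟩ := exists_affineElt_of_smul_eq hg (h.le_rationalSO hk) hk'
  refine ⟨k * affineElt 1 c, mul_mem hk ((h.mem_translation c).2 hc), a, ha, ?_⟩
  rw [mul_assoc, affineElt_mul, hac]
  simp

theorem mul_diag_mem_iff [NeZero (2 : F)] (h : IsConicGroup K Γ)
    {k : GL (Fin 3) F} (hk : k ∈ Γ) (a : Fˣ) :
    k * affineElt a 0 ∈ Γ ↔ a ∈ multiplierGroup Γ := by
  rw [Subgroup.mul_mem_cancel_left _ hk]
  exact ⟨fun H => ⟨0, H⟩, fun H => h.mem_of_mem_multiplierGroup H (zero_mem _)⟩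

/-- The units of a subfield that are multipliers of the group. -/
def rationalMultipliers (K : Subfield F) (Γ : Subgroup (GL (Fin 3) F)) : Subgroup Kˣ :=
  (multiplierGroup Γ).comap (Units.map K.subtype.toMonoidHom)

theorem card_rationalMultipliers [NeZero (2 : F)] (h : IsConicGroup K Γ) :
    Nat.card (rationalMultipliers K Γ) = Nat.card (multiplierGroup Γ) := by
  refine Nat.card_congr (Equiv.ofBijective (fun a => (⟨_, a.2⟩ : multiplierGroup Γ)) ⟨?_, ?_⟩)
  · intro a b hab
    have h1 : Units.map K.subtype.toMonoidHom a.1 = Units.map K.subtype.toMonoidHom b.1 :=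
      congrArg Subtype.val hab
    exact Subtype.ext (Units.map_injective (f := K.subtype.toMonoidHom) Subtype.val_injective h1)
  · rintro ⟨a, c, hc⟩
    have ha := (mem_of_affineElt_mem_rationalSO (h.le_rationalSO hc)).1
    have ha0 : (⟨a.1, ha⟩ : K) ≠ 0 := fun H => a.ne_zero (congrArg Subtype.val H)
    have hu : Units.map K.subtype.toMonoidHom (Units.mk0 ⟨a.1, ha⟩ ha0) = a := Units.ext rfl
    refine ⟨⟨Units.mk0 ⟨a.1, ha⟩ ha0, ?_⟩, Subtype.ext hu⟩
    change Units.map _ _ ∈ multiplierGroup Γ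
    rw [hu]
    exact ⟨c, hc⟩

theorem mem_multiplierGroup_iff {a : Fˣ} (ha : a.1 ∈ K) (ha0 : (⟨a.1, ha⟩ : K) ≠ 0) :
    a ∈ multiplierGroup Γ ↔ Units.mk0 ⟨a.1, ha⟩ ha0 ∈ rationalMultipliers K Γ := by
  change _ ↔ Units.map _ _ ∈ multiplierGroup Γ
  rw [show Units.map K.subtype.toMonoidHom (Units.mk0 ⟨a.1, ha⟩ ha0) = a from Units.ext rfl]

theorem card_units_eq [Finite F] : Nat.card Kˣ = Nat.card K - 1 := by
  have := Fintype.ofFinite K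
  classical
  rw [Nat.card_eq_fintype_card, Nat.card_eq_fintype_card, Fintype.card_units]

/-- Γ is transitive on the rational points and contains all rational translations, so only
multipliers can be missing; here every unit of K is one. -/
theorem eq_rationalSO [Finite F] [NeZero (2 : F)] (h : IsConicGroup K Γ)
    (hcard : Nat.card (multiplierGroup Γ) = Nat.card K - 1) : Γ = rationalSO K := by
  refine le_antisymm h.le_rationalSO fun g hg => ?_
  obtain ⟨k, hk, a, ha, rfl⟩ := h.exists_eq_mul_diag hg
  rw [h.mul_diag_mem_iff hk]
  have ha0 : (⟨a.1, ha⟩ : K) ≠ 0 := fun H => a.ne_zero (congrArg Subtype.val H)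
  rw [mem_multiplierGroup_iff ha ha0, Subgroup.eq_top_of_card_eq (rationalMultipliers K Γ)
    (by rw [h.card_rationalMultipliers, hcard, card_units_eq])]
  trivial

/-- When half of the units are multipliers, the group has index at most two. -/
theorem mul_mem_iff_of_half [Finite F] [NeZero (2 : F)] (h : IsConicGroup K Γ)
    (hcard : 2 * Nat.card (multiplierGroup Γ) = Nat.card K - 1) {x y : GL (Fin 3) F}
    (hx : x ∈ rationalSO K) (hy : y ∈ rationalSO K) : x * y ∈ Γ ↔ (x ∈ Γ ↔ y ∈ Γ) := by
  obtain ⟨k, hk, a, ha, rfl⟩ := h.exists_eq_mul_diag hx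
  obtain ⟨l, hl, b, hb, hlb⟩ := h.exists_eq_mul_diag (inv_mem hy)
  have hy' : y = affineElt b⁻¹ 0 * l⁻¹ := by
    rw [← inv_inv y, hlb, mul_inv_rev, affineElt_inv]; simp
  have ha0 : (⟨a.1, ha⟩ : K) ≠ 0 := fun H => a.ne_zero (congrArg Subtype.val H)
  have hb0 : (⟨b.1, hb⟩ : K) ≠ 0 := fun H => b.ne_zero (congrArg Subtype.val H)
  -- Membership of x and y in Γ is decided by the classes of a and b modulo a subgroup of index two
  -- of the units of K.
  have hidx : (rationalMultipliers K Γ).index = 2 := by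
    have h1 := Subgroup.card_mul_index (rationalMultipliers K Γ)
    rw [h.card_rationalMultipliers, card_units_eq, ← hcard, mul_comm] at h1
    exact Nat.eq_of_mul_eq_mul_right Nat.card_pos h1
  have hy2 : y ∈ Γ ↔ b ∈ multiplierGroup Γ := by
    rw [← inv_mem_iff, hlb, h.mul_diag_mem_iff hl]
  have hxy : k * affineElt a 0 * y ∈ Γ ↔ a * b⁻¹ ∈ multiplierGroup Γ := by
    rw [hy', mul_assoc, ← mul_assoc (affineElt a 0), affineElt_mul, mul_zero, add_zero,
      ← mul_assoc, Subgroup.mul_mem_cancel_right _ (inv_mem hl), h.mul_diag_mem_iff hk]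
  have hab : (a * b⁻¹).1 ∈ K := by
    rw [Units.val_mul, Units.val_inv_eq_inv_val]; exact mul_mem ha (inv_mem hb)
  have hab0 : (⟨(a * b⁻¹).1, hab⟩ : K) ≠ 0 :=
    fun H => (a * b⁻¹).ne_zero (congrArg Subtype.val H)
  have hbinv : Units.mk0 ⟨b.1, hb⟩ hb0 ∈ rationalMultipliers K Γ ↔
      (Units.mk0 ⟨b.1, hb⟩ hb0)⁻¹ ∈ rationalMultipliers K Γ := inv_mem_iff.symm
  rw [hxy, hy2, h.mul_diag_mem_iff hk, mem_multiplierGroup_iff ha ha0,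
    mem_multiplierGroup_iff hb hb0, mem_multiplierGroup_iff hab hab0,
    hbinv, ← Subgroup.mul_mem_iff_of_index_two hidx]
  rw [show Units.mk0 (⟨(a * b⁻¹).1, hab⟩ : K) hab0 =
    Units.mk0 ⟨a.1, ha⟩ ha0 * (Units.mk0 ⟨b.1, hb⟩ hb0)⁻¹ from ?_]
  apply Units.ext
  apply Subtype.ext
  simp

/-- The Weyl element as a product of unipotents: a normal subgroup of `rationalSO K` containing the
translations contains `swapElt`. -/
theorem swapElt_eq : (swapElt : GL (Fin 3) F) =
    affineElt 1 1 * (swapElt * affineElt 1 1 * swapElt⁻¹) * affineElt 1 1 := by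
  have : (swapElt : GL (Fin 3) F)⁻¹ = swapElt := inv_eq_of_mul_eq_one_right swapElt_mul_self
  rw [this]
  apply GL_ext_smul
  intro v
  simp only [mul_smul, swapElt_smul, affineElt_smul]
  ext i; fin_cases i <;> simp <;> ring

theorem swapElt_conj (a : Fˣ) : swapElt * affineElt a 0 * swapElt⁻¹ =
    (affineElt a⁻¹ 0 : GL (Fin 3) F) := by
  have : (swapElt : GL (Fin 3) F)⁻¹ = swapElt := inv_eq_of_mul_eq_one_right swapElt_mul_self
  rw [this]
  apply GL_ext_smul
  intro v
  simp only [mul_smul, swapElt_smul, affineElt_smul]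
  ext i; fin_cases i <;> simp

open scoped commutatorElement in
-- Γ has index at most two, so it contains the commutators. Conversely, the commutator subgroup
-- contains the translations, `swapElt` and the diagonal elements with square multiplier, and these
-- generate Γ.
theorem eq_commutator [Finite F] [NeZero (2 : F)] (h : IsConicGroup K Γ)
    (hcard : 2 * Nat.card (multiplierGroup Γ) = Nat.card K - 1) :
    Γ = ⁅rationalSO K, rationalSO K⁆ := by
  have hle : ⁅rationalSO K, rationalSO K⁆ ≤ Γ := by
    rw [Subgroup.commutator_le]
    intro x hx y hy
    rw [commutatorElement_def, h.mul_mem_iff_of_half hcard (mul_mem (mul_mem hx hy) (inv_mem hx))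
      (inv_mem hy), h.mul_mem_iff_of_half hcard (mul_mem hx hy) (inv_mem hx),
      h.mul_mem_iff_of_half hcard hx hy, inv_mem_iff, inv_mem_iff]
    tauto
  have t2 : (2 : F) ≠ 0 := two_ne_zero
  -- The commutator of t ↦ -t with translation by s is translation by -2s, whence s = -c/2.
  have htrans (c : F) (hc : c ∈ K) : affineElt 1 c ∈ ⁅rationalSO K, rationalSO K⁆ := by
    have h1 : affineElt (-1 : Fˣ) (0 : F) ∈ rationalSO K :=
      affineElt_mem_rationalSO (by simp) (zero_mem _)
    have hc2 : - c / 2 ∈ K := div_mem (neg_mem hc) (ofNat_mem K 2)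
    have h2 : affineElt (1 : Fˣ) (- c / 2) ∈ rationalSO K :=
      affineElt_mem_rationalSO (by simp) hc2
    have h3 := Subgroup.commutator_mem_commutator h1 h2
    rw [commutatorElement_def, affineElt_inv, affineElt_inv, affineElt_mul, affineElt_mul,
      affineElt_mul] at h3
    convert h3 using 2
    · simp
    · simp; field_simp; ring
  have hconj (x y : GL (Fin 3) F) (hx : x ∈ rationalSO K)
      (hy : y ∈ ⁅rationalSO K, rationalSO K⁆) : x * y * x⁻¹ ∈ ⁅rationalSO K, rationalSO K⁆ := by
    have h1 : y ∈ rationalSO K := h.le_rationalSO (hle hy)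
    have h2 := mul_mem (Subgroup.commutator_mem_commutator hx h1) hy
    rw [commutatorElement_def] at h2
    simpa using h2
  have hswap : swapElt ∈ ⁅rationalSO K, rationalSO K⁆ := by
    rw [swapElt_eq]
    have h1 := htrans 1 (one_mem _)
    exact mul_mem (mul_mem h1 (hconj _ _ swapElt_mem_rationalSO h1)) h1
  have hdiag (a : Fˣ) (ha : a.1 ∈ K) : affineElt (a * a) 0 ∈ ⁅rationalSO K, rationalSO K⁆ := by
    have h1 := Subgroup.commutator_mem_commutator
      (affineElt_mem_rationalSO ha (zero_mem K)) (swapElt_mem_rationalSO (K := K))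
    have h2 : ⁅affineElt a 0, swapElt⁆ = affineElt (a * a) (0 : F) := by
      have h3 := swapElt_conj a⁻¹
      rw [inv_inv] at h3
      rw [commutatorElement_def, affineElt_inv, mul_assoc, mul_assoc, ← mul_assoc swapElt]
      simp only [mul_zero, neg_zero]
      rw [h3, affineElt_mul]
      simp
    rwa [h2] at h1
  -- Euler's criterion: the multipliers form a group of order (|K| - 1)/2.
  have hsq (a : Fˣ) (ha : a ∈ multiplierGroup Γ) : ∃ b : Fˣ, b.1 ∈ K ∧ a = b * b := by
    obtain ⟨c, hc⟩ := ha
    have haK := (mem_of_affineElt_mem_rationalSO (h.le_rationalSO hc)).1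
    have ha0 : (⟨a.1, haK⟩ : K) ≠ 0 := fun H => a.ne_zero (congrArg Subtype.val H)
    have := Fintype.ofFinite K
    have t2' : (2 : K) ≠ 0 := fun H => t2 (congrArg Subtype.val H)
    have hchar : ringChar K ≠ 2 := by
      intro H
      apply t2'
      have := ringChar.Nat.cast_ringChar (R := K)
      rw [H] at this
      exact_mod_cast this
    have h1 : a ^ Nat.card (multiplierGroup Γ) = 1 := by
      have := pow_card_eq_one' (x := (⟨a, c, hc⟩ : multiplierGroup Γ))
      exact congrArg Subtype.val this
    have h2 : IsSquare (⟨a.1, haK⟩ : K) := by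
      rw [FiniteField.isSquare_iff hchar ha0]
      have h3 : Fintype.card K / 2 = Nat.card (multiplierGroup Γ) := by
        rw [Nat.card_eq_fintype_card (α := K)] at hcard
        have : 0 < Fintype.card K := Fintype.card_pos
        have h4 : 0 < Nat.card (multiplierGroup Γ) := Nat.card_pos
        omega
      rw [h3]
      apply Subtype.ext
      have := congrArg (fun u : Fˣ => u.1) h1
      simpa using this
    obtain ⟨r, hr⟩ := h2
    have hr' : a.1 = r.1 * r.1 := congrArg Subtype.val hr
    have hr0 : r.1 ≠ 0 := by
      intro H; rw [H, mul_zero] at hr'; exact a.ne_zero hr'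
    exact ⟨Units.mk0 r.1 hr0, r.2, Units.ext hr'⟩
  refine le_antisymm (fun g hg => ?_) hle
  obtain ⟨k, hk, hk'⟩ : ∃ k ∈ ⁅rationalSO K, rationalSO K⁆,
      k • (infPt : ℙ F (Fin 3 → F)) = g • infPt := by
    rcases h.orbit_rational g hg with h1 | ⟨x, hx, h1⟩
    · exact ⟨1, one_mem _, by rw [h1, one_smul]⟩
    · refine ⟨affineElt 1 x * swapElt, mul_mem (htrans x hx) hswap, ?_⟩
      rw [h1, mul_smul, swapElt_smul_infPt, affineElt_smul_finPt]
      simp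
  obtain ⟨a, c, ha, hc, hac⟩ :=
    exists_affineElt_of_smul_eq (h.le_rationalSO hg) (h.le_rationalSO (hle hk)) hk'
  have hm : a ∈ multiplierGroup Γ := by
    have : affineElt a c ∈ Γ := by
      rw [hac] at hg
      exact (Subgroup.mul_mem_cancel_left _ (hle hk)).1 hg
    exact ⟨c, this⟩
  obtain ⟨b, hb, rfl⟩ := hsq a hm
  have h4 := mul_mem (htrans c hc) (hdiag b hb)
  rw [affineElt_mul] at h4
  rw [hac]
  refine mul_mem hk ?_
  simpa using h4

theorem nonempty_mulEquiv [Finite F] [NeZero (2 : F)] (h : IsConicGroup K Γ)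
    (hcard : Nat.card (multiplierGroup Γ) = Nat.card K - 1 ∨
      2 * Nat.card (multiplierGroup Γ) = Nat.card K - 1) :
    Nonempty (Γ ≃* POmega3 K) ∨ Nonempty (Γ ≃* PSO3 K) := by
  have : NeZero (2 : K) := ⟨fun H => two_ne_zero (α := F) (congrArg Subtype.val H)⟩
  rcases hcard with hcard | hcard
  · right
    obtain ⟨e⟩ := nonempty_mulEquiv_map_mk_of_le (K := K)
      (le_refl (specialOrthogonalGroupOf (standardTernaryForm K)))
    rw [h.eq_rationalSO hcard]
    exact ⟨(Subgroup.equivMapOfInjective _ _ (subfieldEmb_injective K)).symm.trans e⟩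
  · left
    have hle : omegaGroupOf (standardTernaryForm K) ≤
        specialOrthogonalGroupOf (standardTernaryForm K) := by
      rw [omegaGroupOf_eq, Subgroup.commutator_le]
      intro x hx y hy
      exact mul_mem (mul_mem (mul_mem hx hy) (inv_mem hx)) (inv_mem hy)
    obtain ⟨e⟩ := nonempty_mulEquiv_map_mk_of_le hle
    have h1 : Γ = (omegaGroupOf (standardTernaryForm K)).map (subfieldEmb K) := by
      rw [omegaGroupOf_eq, Subgroup.map_commutator]
      exact h.eq_commutator hcard
    rw [h1]
    exact ⟨(Subgroup.equivMapOfInjective _ _ (subfieldEmb_injective K)).symm.trans e⟩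

end IsConicGroup
end Identification

/-! ### Classification of the groups of isometries with enough involutions -/

section SubgroupsOfConicGroup

open MulAction Projectivization

variable {F : Type*} [Field F] {Γ : Subgroup (GL (Fin 3) F)}

/-- A group of isometries of the standard conic without fixed points, with involutions of at least
four different axes. -/
structure IsInvolutory (Γ : Subgroup (GL (Fin 3) F)) : Prop where
  le : Γ ≤ specialOrthogonalGroupOf (standardTernaryForm F)
  not_fixed : ∀ x : ℙ F (Fin 3 → F), ∃ g ∈ Γ, g • x ≠ x
  exists_axes : ∃ T : Set (ℙ F (Fin 3 → F)), T.ncard = 4 ∧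
    ∀ x ∈ T, ∃ g ∈ Γ, g ≠ 1 ∧ g * g = 1 ∧ ∀ v ∈ x.submodule, g • v = v

theorem mem_map_conj {G : Type*} [Group G] {H : Subgroup G} {h g : G} :
    g ∈ H.map (MulAut.conj h).toMonoidHom ↔ h⁻¹ * g * h ∈ H := by
  rw [Subgroup.mem_map]
  constructor
  · rintro ⟨x, hx, rfl⟩
    simpa [mul_assoc] using hx
  · intro hg
    exact ⟨_, hg, by simp [mul_assoc]⟩

theorem nonempty_mulEquiv_map_conj {G : Type*} [Group G] (H : Subgroup G) (h : G) :
    Nonempty (H ≃* H.map (MulAut.conj h).toMonoidHom) :=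
  ⟨Subgroup.equivMapOfInjective _ _ (MulAut.conj h).injective⟩

theorem smul_mem_submodule {h : GL (Fin 3) F} {x : ℙ F (Fin 3 → F)} {v : Fin 3 → F}
    (hv : v ∈ (h • x).submodule) : h⁻¹ • v ∈ x.submodule := by
  induction x using Projectivization.ind with | _ u hu => ?_
  rw [smul_mk, submodule_mk, Submodule.mem_span_singleton] at hv
  obtain ⟨a, rfl⟩ := hv
  rw [smul_comm, inv_smul_smul, submodule_mk]
  exact Submodule.smul_mem _ _ (Submodule.mem_span_singleton_self u)

theorem isInvolutory_map_conj (h : GL (Fin 3) F)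
    (hle : Γ.map (MulAut.conj h).toMonoidHom ≤ specialOrthogonalGroupOf (standardTernaryForm F))
    (hfix : ∀ x : ℙ F (Fin 3 → F), ∃ g ∈ Γ, g • x ≠ x)
    (haxes : ∃ T : Set (ℙ F (Fin 3 → F)), T.ncard = 4 ∧
      ∀ x ∈ T, ∃ g ∈ Γ, g ≠ 1 ∧ g * g = 1 ∧ ∀ v ∈ x.submodule, g • v = v) :
    IsInvolutory (Γ.map (MulAut.conj h).toMonoidHom) where
  le := hle
  not_fixed x := by
    obtain ⟨g, hg, hgx⟩ := hfix (h⁻¹ • x)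
    refine ⟨h * g * h⁻¹, mem_map_conj.2 (by simpa [mul_assoc] using hg), fun H => hgx ?_⟩
    rw [eq_inv_smul_iff, ← mul_smul, ← mul_smul]
    exact H
  exists_axes := by
    obtain ⟨T, hT, hT2⟩ := haxes
    refine ⟨(fun x => h • x) '' T, ?_, ?_⟩
    · rw [Set.ncard_image_of_injective _ (MulAction.injective h), hT]
    · rintro _ ⟨x, hx, rfl⟩
      obtain ⟨g, hg, hg1, hg2, hgv⟩ := hT2 x hx
      refine ⟨h * g * h⁻¹, mem_map_conj.2 (by simpa [mul_assoc] using hg), ?_, ?_, ?_⟩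
      · intro H
        exact hg1 (by simpa using H)
      · calc h * g * h⁻¹ * (h * g * h⁻¹) = h * (g * g) * h⁻¹ := by group
          _ = 1 := by rw [hg2]; group
      · intro v hv
        rw [mul_smul, mul_smul, hgv _ (smul_mem_submodule hv), smul_inv_smul]

namespace IsInvolutory

theorem conj (hΓ : IsInvolutory Γ) {h : GL (Fin 3) F}
    (hh : h ∈ specialOrthogonalGroupOf (standardTernaryForm F)) :
    IsInvolutory (Γ.map (MulAut.conj h).toMonoidHom) := by
  refine isInvolutory_map_conj h ?_ hΓ.not_fixed hΓ.exists_axes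
  rintro _ ⟨g, hg, rfl⟩
  exact mul_mem (mul_mem hh (hΓ.le hg)) (inv_mem hh)

theorem two_dvd (hΓ : IsInvolutory Γ) :
    ∃ T : Set (ℙ F (Fin 3 → F)), T.ncard = 4 ∧ ∀ x ∈ T, 2 ∣ Nat.card (axisFixer Γ x) := by
  obtain ⟨T, hT, hT2⟩ := hΓ.exists_axes
  refine ⟨T, hT, fun x hx => ?_⟩
  obtain ⟨g, hg, hg1, hg2, hgv⟩ := hT2 x hx
  have h1 : orderOf (⟨⟨g, hg⟩, hgv⟩ : axisFixer Γ x) = 2 := by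
    apply orderOf_eq_prime
    · apply Subtype.ext
      apply Subtype.ext
      simpa [sq] using hg2
    · intro H
      exact hg1 (congrArg (fun y : axisFixer Γ x => y.1.1) H)
  rw [← h1]
  exact orderOf_dvd_natCard _

theorem not_fixed' (hΓ : IsInvolutory Γ) (x : ℙ F (Fin 3 → F)) : ∃ g : Γ, g • x ≠ x := by
  obtain ⟨g, hg, h⟩ := hΓ.not_fixed x
  exact ⟨⟨g, hg⟩, h⟩

/-- A group whose orbit of the infinite point consists of the translates of a finite point is
conjugate to a group of a conic over a subfield. -/
theorem nonempty_mulEquiv_of_orbit [Finite F] [NeZero (2 : F)]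
    (hle : Γ ≤ specialOrthogonalGroupOf (standardTernaryForm F))
    (hfix : ∃ g : Γ, g • (infPt : ℙ F (Fin 3 → F)) ≠ infPt)
    (hinf : axisFixer Γ infPt ≠ ⊥)
    (horb : Nat.card (orbit Γ (infPt : ℙ F (Fin 3 → F))) = Nat.card (translationGroup Γ) + 1)
    (hcard : Nat.card (multiplierGroup Γ) = Nat.card (translationGroup Γ) - 1 ∨
      2 * Nat.card (multiplierGroup Γ) = Nat.card (translationGroup Γ) - 1) :
    ∃ K : Subfield F, Nonempty (Γ ≃* POmega3 K) ∨ Nonempty (Γ ≃* PSO3 K) := by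
  obtain ⟨t, ht⟩ := exists_finPt_mem_orbit hle hfix
  have horbit : insert infPt ((fun c => finPt (t + c)) '' (translationGroup Γ : Set F)) =
      orbit Γ infPt := by
    refine Set.eq_of_subset_of_ncard_le (translates_subset_orbit ht) ?_ (Set.toFinite _)
    rw [ncard_translates, ← Nat.card_coe_set_eq, horb]
  obtain ⟨b, hb, hb0⟩ : ∃ b ∈ translationGroup Γ, b ≠ 0 := by
    obtain ⟨g, hg, hg1⟩ := (Subgroup.bot_or_exists_ne_one (axisFixer Γ infPt)).resolve_left hinf
    obtain ⟨c, hc, hgc⟩ := (mem_axisFixer_infPt hle).1 hg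
    refine ⟨c, hc, ?_⟩
    rintro rfl
    rw [affineElt_one] at hgc
    exact hg1 (Subtype.ext hgc)
  obtain ⟨b, rfl⟩ : ∃ u : Fˣ, u.1 = b := ⟨Units.mk0 b hb0, rfl⟩
  -- The substitution x ↦ (x - t)/b moves the finite point t of the orbit to 0 and the translation b
  -- to 1, and keeps the multipliers.
  set k : GL (Fin 3) F := affineElt b⁻¹ (-((b⁻¹ : Fˣ).1 * t)) with hk
  set Δ := Γ.map (MulAut.conj k).toMonoidHom with hΔ
  have hkinv : k⁻¹ = affineElt b t := by
    rw [hk, affineElt_inv]; simp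
  have hconj (a : Fˣ) (c : F) : affineElt a c ∈ Δ ↔ affineElt a (b * c + (t - a * t)) ∈ Γ := by
    rw [hΔ, mem_map_conj, hkinv, hk, affineElt_mul, affineElt_mul]
    rw [mul_right_comm, mul_inv_cancel, one_mul, Units.val_mul]
    have : b.1 * a.1 * -((b⁻¹ : Fˣ).1 * t) + (b.1 * c + t) = b * c + (t - a * t) := by
      have : b.1 * (b⁻¹ : Fˣ).1 = 1 := by simp
      linear_combination (-a.1 * t) * this
    rw [this]
  have htr (c : F) : c ∈ translationGroup Δ ↔ b * c ∈ translationGroup Γ := by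
    rw [mem_translationGroup, mem_translationGroup, hconj]; simp
  have hmul : multiplierGroup Δ = multiplierGroup Γ := by
    ext a
    rw [mem_multiplierGroup, mem_multiplierGroup]
    constructor
    · rintro ⟨c, hc⟩
      exact ⟨_, (hconj a c).1 hc⟩
    · rintro ⟨c, hc⟩
      refine ⟨(b⁻¹ : Fˣ).1 * (c - (t - a * t)), (hconj a _).2 ?_⟩
      rw [← mul_assoc]
      simpa using hc
  have hcardΔ : Nat.card (translationGroup Δ) = Nat.card (translationGroup Γ) := by
    refine Nat.card_congr ⟨fun c => ⟨b * c.1, (htr c).1 c.2⟩,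
      fun c => ⟨(b⁻¹ : Fˣ).1 * c.1, (htr _).2 ?_⟩, fun c => ?_, fun c => ?_⟩
    · rw [← mul_assoc]; simp [c.2]
    · apply Subtype.ext
      simp
    · apply Subtype.ext
      simp
  have hpos : 0 < Nat.card (translationGroup Γ) := Nat.card_pos
  obtain ⟨K, hK⟩ := exists_subfield_of_units (multiplierGroup Δ) (translationGroup Δ)
    ((htr 1).2 (by rwa [mul_one])) (fun a ha c hc => mul_mem_translationGroup ha hc)
    (by rw [hmul, hcardΔ]; omega)
  have hcardK : Nat.card K = Nat.card (translationGroup Γ) := by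
    rw [← hcardΔ]
    exact Nat.card_congr (Equiv.subtypeEquivRight hK)
  have hconic : IsConicGroup K Δ :=
    { le := by
        rintro _ ⟨g, hg, rfl⟩
        exact mul_mem (mul_mem (affineElt_mem _ _) (hle hg)) (inv_mem (affineElt_mem _ _))
      mem_translation := fun c => (hK c).symm
      orbit_rational := by
        rintro _ ⟨g, hg, rfl⟩
        change IsRationalPt K ((k * g * k⁻¹) • infPt)
        rw [mul_smul, mul_smul, hkinv, affineElt_smul_infPt]
        have h1 : g • infPt ∈ orbit Γ (infPt : ℙ F (Fin 3 → F)) := ⟨⟨g, hg⟩, rfl⟩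
        rw [← horbit] at h1
        rcases h1 with h1 | ⟨c, hc, h1⟩
        · rw [h1, hk, affineElt_smul_infPt]
          exact Or.inl rfl
        · refine Or.inr ⟨(b⁻¹ : Fˣ).1 * c, (hK _).2 ((htr _).2 ?_), ?_⟩
          · rw [← mul_assoc]; simpa using hc
          · rw [← h1]
            change k • finPt (t + c) = _
            rw [hk, affineElt_smul_finPt]
            congr 1; ring
      zero_mem_orbit := by
        obtain ⟨⟨g, hg⟩, h1⟩ := ht
        replace h1 : g • infPt = finPt t := h1
        refine ⟨k * g * k⁻¹, ⟨g, hg, rfl⟩, ?_⟩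
        rw [mul_smul, mul_smul, hkinv, affineElt_smul_infPt, h1, hk, affineElt_smul_finPt]
        congr 1; ring }
  obtain ⟨e⟩ := nonempty_mulEquiv_map_conj Γ k
  refine ⟨K, ?_⟩
  rcases hconic.nonempty_mulEquiv (by rw [hmul, hcardK]; exact hcard) with ⟨⟨f⟩⟩ | ⟨⟨f⟩⟩
  · exact Or.inl ⟨e.trans f⟩
  · exact Or.inr ⟨e.trans f⟩

/-- An isotropic axis with nontrivial fixer, if there is one, can be conjugated to infinity; so the
two numerical classifications cover all cases. -/
theorem nonempty_mulEquiv [Finite F] [NeZero (2 : F)] (hΓ : IsInvolutory Γ) :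
    Nonempty (Γ ≃* Equiv.Perm (Fin 4)) ∨ Nonempty (Γ ≃* alternatingGroup (Fin 5)) ∨
      ∃ K : Subfield F, Nonempty (Γ ≃* POmega3 K) ∨ Nonempty (Γ ≃* PSO3 K) := by
  by_cases hiso : ∀ x : ℙ F (Fin 3 → F), IsIsotropicPt x → axisFixer Γ x = ⊥
  · have := Fintype.ofFinite (orbitRel.Quotient Γ (ℙ F (Fin 3 → F)))
    rcases classify_of_no_isotropic hΓ.le hΓ.not_fixed' hΓ.two_dvd hiso with h | h
    · exact Or.inl (nonempty_mulEquiv_perm_four _ h hΓ.not_fixed')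
    · exact Or.inr (Or.inl (nonempty_mulEquiv_alternating_five _ h))
  · push Not at hiso
    obtain ⟨x, hx, hx'⟩ := hiso
    obtain ⟨k, hk, rfl⟩ : ∃ k ∈ specialOrthogonalGroupOf (standardTernaryForm F),
        x = k⁻¹ • infPt := by
      obtain ⟨k, hk, h⟩ := exists_smul_eq_infPt hx
      exact ⟨k, hk, by rw [← h, inv_smul_smul]⟩
    obtain ⟨e⟩ := nonempty_mulEquiv_map_conj Γ k
    have hΔ := hΓ.conj hk
    have hinf : axisFixer (Γ.map (MulAut.conj k).toMonoidHom) infPt ≠ ⊥ := by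
      obtain ⟨g, hg, hg1⟩ := (Subgroup.bot_or_exists_ne_one _).resolve_left hx'
      intro H
      have h1 : (⟨k * g.1 * k⁻¹, ⟨g.1, g.2, rfl⟩⟩ : Γ.map (MulAut.conj k).toMonoidHom) ∈
          axisFixer (Γ.map (MulAut.conj k).toMonoidHom) infPt := by
        intro v hv
        change (k * g.1 * k⁻¹) • v = v
        have h2 : k⁻¹ • v ∈ (k⁻¹ • (infPt : ℙ F (Fin 3 → F))).submodule := by
          apply smul_mem_submodule
          rwa [smul_inv_smul]
        have h3 : g.1 • k⁻¹ • v = k⁻¹ • v := hg _ h2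
        rw [mul_smul, mul_smul, h3, smul_inv_smul]
      rw [H, Subgroup.mem_bot] at h1
      have h2 : k * g.1 * k⁻¹ = 1 := congrArg Subtype.val h1
      exact hg1 (Subtype.ext (by simpa using h2))
    generalize Γ.map (MulAut.conj k).toMonoidHom = Δ at e hΔ hinf
    have := Fintype.ofFinite (orbitRel.Quotient Δ (ℙ F (Fin 3 → F)))
    rcases classify_of_isotropic hΔ.le hΔ.not_fixed' hΔ.two_dvd hinf with h | h | ⟨h, h'⟩
    · obtain ⟨f⟩ := nonempty_mulEquiv_perm_four _ h hΔ.not_fixed'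
      exact Or.inl ⟨e.trans f⟩
    · obtain ⟨f⟩ := nonempty_mulEquiv_alternating_five _ h
      exact Or.inr (Or.inl ⟨e.trans f⟩)
    · obtain ⟨K, ⟨⟨f⟩⟩ | ⟨⟨f⟩⟩⟩ := nonempty_mulEquiv_of_orbit hΔ.le (hΔ.not_fixed' _) hinf h h'
      · exact Or.inr (Or.inr ⟨K, Or.inl ⟨e.trans f⟩⟩)
      · exact Or.inr (Or.inr ⟨K, Or.inr ⟨e.trans f⟩⟩)

end IsInvolutory
end SubgroupsOfConicGroup

/-! ### Involutions of determinant one as homologies -/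

section Generators

open MulAction Projectivization Matrix

variable {F : Type*} [Field F]

/-- An involution of determinant one is the homology attached to a point and a line. -/
theorem exists_homology [NeZero (2 : F)] {g : GL (Fin 3) F} (hdet : g.1.det = 1) (hg : g * g = 1)
    (hg1 : g ≠ 1) :
    ∃ p f : Fin 3 → F, f ⬝ᵥ p = 1 ∧ ∀ v : Fin 3 → F, g • v = - v + (2 * (f ⬝ᵥ v)) • p := by
  have t2 : (2 : F) ≠ 0 := two_ne_zero
  obtain ⟨M, hM⟩ : ∃ M, g.1 = M := ⟨_, rfl⟩
  have hMM : M * M = 1 := by rw [← hM, ← Units.val_mul, hg]; rfl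
  rw [hM] at hdet
  have hadj : M.adjugate = M := by
    rw [← mul_one M.adjugate, ← hMM, ← mul_assoc, adjugate_mul, hdet, one_smul, one_mul]
  -- For 3 × 3 matrices adj(1 + M) = 1 + tr(M) - M + adj(M), and adj(M) = M⁻¹ = M here.
  have hadj2 : (1 + M).adjugate = (1 + M.trace) • (1 : Matrix (Fin 3) (Fin 3) F) := by
    have h (i j : Fin 3) : M.adjugate i j = M i j := by rw [hadj]
    have h00 := h 0 0
    have h01 := h 0 1
    have h02 := h 0 2
    have h10 := h 1 0
    have h11 := h 1 1
    have h12 := h 1 2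
    have h20 := h 2 0
    have h21 := h 2 1
    have h22 := h 2 2
    simp [adjugate_fin_three] at h00 h01 h02 h10 h11 h12 h20 h21 h22
    ext i j
    fin_cases i <;> fin_cases j <;> simp [adjugate_fin_three, trace, Fin.sum_univ_three]
    · linear_combination h00
    · linear_combination h01
    · linear_combination h02
    · linear_combination h10
    · linear_combination h11
    · linear_combination h12
    · linear_combination h20
    · linear_combination h21
    · linear_combination h22
  have htr : 1 + M.trace = 0 := by
    by_contra H
    have h1 : (M - 1) * (1 + M) = 0 := by
      rw [mul_add, mul_one, sub_mul, hMM, one_mul]; abel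
    have h2 : (1 + M.trace) • (M - 1) = 0 := by
      have h3 := mul_adjugate (1 + M)
      have h4 : (M - 1) * ((1 + M) * (1 + M).adjugate) = 0 := by
        rw [← mul_assoc, h1, zero_mul]
      rw [h3] at h4
      have h5 : (1 + M).det = 0 ∨ M - 1 = 0 := by
        rw [Matrix.mul_smul, mul_one] at h4
        exact smul_eq_zero.1 h4
      rcases h5 with h5 | h5
      · rw [h5, zero_smul, hadj2, Matrix.mul_smul, mul_one] at h3
        have h6 : 1 + M = 0 := (smul_eq_zero.1 h3).resolve_left H
        have h7 : M = -1 := by rw [← sub_eq_zero, sub_neg_eq_add, add_comm, h6]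
        rw [h7, det_neg] at hdet
        exfalso
        apply t2
        simp at hdet
        linear_combination -hdet
      · rw [h5, smul_zero]
    have h3 : M - 1 = 0 := (smul_eq_zero.1 h2).resolve_left H
    apply hg1
    apply Units.ext
    rw [hM, sub_eq_zero.1 h3]; rfl
  rw [htr, zero_smul] at hadj2
  obtain ⟨N, hN⟩ : ∃ N, N = 1 + M := ⟨_, rfl⟩
  have hMN : M = N - 1 := by rw [hN]; abel
  have hNN (i j : Fin 3) : (N * N) i j = 2 * N i j := by
    have : N * N = (2 : F) • N := by
      rw [hN, mul_add, add_mul, add_mul, hMM, mul_one, mul_one, one_mul, two_smul]; abel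
    rw [this]; rfl
  rw [← hN] at hadj2
  -- N = 1 + M has trace 3 - 1 = 2, so some diagonal entry is nonzero.
  obtain ⟨k, hk⟩ : ∃ k, N k k ≠ 0 := by
    by_contra! H
    apply t2
    have : N.trace = 3 + M.trace := by
      rw [hN, trace_add, trace_one]; simp
    simp only [trace, diag, H, Finset.sum_const_zero] at this htr
    linear_combination -this - htr
  have hminor (i j : Fin 3) : N i j * N k k = N i k * N k j := by
    have h (i j : Fin 3) : N.adjugate i j = 0 := by rw [hadj2]; rfl
    have h00 := h 0 0
    have h01 := h 0 1
    have h02 := h 0 2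
    have h10 := h 1 0
    have h11 := h 1 1
    have h12 := h 1 2
    have h20 := h 2 0
    have h21 := h 2 1
    have h22 := h 2 2
    simp [adjugate_fin_three] at h00 h01 h02 h10 h11 h12 h20 h21 h22
    clear hk
    fin_cases k <;> fin_cases i <;> fin_cases j <;> simp <;> first | ring1 | grind
  -- N has rank one, since its 2 × 2 minors vanish; column k and the scaled row k factor it as 2 p
  -- f, and N² = 2N gives f(p) = 1.
  refine ⟨fun i => N i k, fun j => N k j / (2 * N k k), ?_, fun v => ?_⟩
  · have := hNN k k
    simp only [mul_apply, Fin.sum_univ_three] at this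
    simp only [dotProduct, Fin.sum_univ_three]
    field_simp
    linear_combination this
  · rw [GL_smul_eq_mulVec, hM, hMN, sub_mulVec, one_mulVec]
    ext i
    simp only [mulVec, dotProduct, Fin.sum_univ_three, Pi.add_apply, Pi.neg_apply, Pi.smul_apply,
      smul_eq_mul, Pi.sub_apply]
    field_simp
    linear_combination v 0 * hminor i 0 + v 1 * hminor i 1 + v 2 * hminor i 2

/-- Distinct commuting homologies have each their centre on the axis of the other. -/
theorem dotProduct_eq_zero_of_commute [NeZero (2 : F)] {g h : GL (Fin 3) F} (hgh : Commute g h)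
    (hne : g ≠ h) {p f p' f' : Fin 3 → F} (hp : f ⬝ᵥ p = 1) (hp' : f' ⬝ᵥ p' = 1)
    (hg : ∀ v : Fin 3 → F, g • v = - v + (2 * (f ⬝ᵥ v)) • p)
    (hh : ∀ v : Fin 3 → F, h • v = - v + (2 * (f' ⬝ᵥ v)) • p') :
    f ⬝ᵥ p' = 0 ∧ f' ⬝ᵥ p = 0 := by
  have t2 : (2 : F) ≠ 0 := two_ne_zero
  have key (v : Fin 3 → F) :
      ((f' ⬝ᵥ v) * (f ⬝ᵥ p')) • p = ((f ⬝ᵥ v) * (f' ⬝ᵥ p)) • p' := by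
    have h1 : g • h • v = h • g • v := by rw [← mul_smul, hgh, mul_smul]
    rw [hh, hg, hg v, hh] at h1
    simp only [dotProduct_add, dotProduct_neg, dotProduct_smul, smul_eq_mul] at h1
    have h2 : (4 : F) • (((f' ⬝ᵥ v) * (f ⬝ᵥ p')) • p - ((f ⬝ᵥ v) * (f' ⬝ᵥ p)) • p') = 0 := by
      linear_combination (norm := module) h1
    have h4 : (4 : F) ≠ 0 := by
      rw [show (4 : F) = 2 * 2 by norm_num]; exact mul_ne_zero t2 t2
    exact sub_eq_zero.1 ((smul_eq_zero.1 h2).resolve_left h4)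
  have hp0' : p' ≠ 0 := by rintro rfl; simp at hp'
  -- Otherwise `key` makes p, p' and f, f' proportional with inverse factors, and then g = h.
  have hzero : f ⬝ᵥ p' = 0 := by
    by_contra H
    have e1 := key p'
    rw [hp', one_mul, mul_smul] at e1
    have e2 : p = (f' ⬝ᵥ p) • p' := smul_right_injective _ H e1
    have e3 : (f' ⬝ᵥ p) * (f ⬝ᵥ p') = 1 := by
      rw [← hp]
      conv_rhs => rw [e2]
      rw [dotProduct_smul, smul_eq_mul]
    have e4 (v : Fin 3 → F) : f' ⬝ᵥ v = (f ⬝ᵥ v) * (f' ⬝ᵥ p) := by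
      have e5 := key v
      have e6 : ((f' ⬝ᵥ v) * (f ⬝ᵥ p')) • p = (f' ⬝ᵥ v) • p' := by
        conv_lhs => rw [e2]
        rw [smul_smul, mul_assoc, mul_comm (f ⬝ᵥ p'), e3, mul_one]
      rw [e6] at e5
      exact smul_left_injective F hp0' e5
    apply hne
    apply GL_ext_smul
    intro v
    rw [hg, hh, e4 v]
    conv_lhs => rw [e2]
    rw [smul_smul, mul_assoc]
  refine ⟨hzero, ?_⟩
  have e1 := key p
  rw [hzero, mul_zero, zero_smul, hp, one_mul] at e1
  exact (smul_eq_zero.1 e1.symm).resolve_right hp0'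

end Generators

/-! ### The invariant conic of three homologies -/

section HomologyTriples

open MulAction Projectivization Matrix

variable {F : Type*} [Field F]

theorem exists_mul_sq_add_mul_sq [Finite F] [NeZero (2 : F)] {u w : F} (hu : u ≠ 0) (hw : w ≠ 0)
    (d : F) : ∃ x z : F, u * x ^ 2 + w * z ^ 2 = d := by
  have := Fintype.ofFinite F
  have hcard : Fintype.card F % 2 = 1 := by
    refine FiniteField.odd_card_of_char_ne_two fun H => two_ne_zero (α := F) ?_
    have := ringChar.Nat.cast_ringChar (R := F)
    rw [H] at this
    exact_mod_cast this
  obtain ⟨x, z, h⟩ := FiniteField.exists_root_sum_quadratic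
    (f := Polynomial.C u * Polynomial.X ^ 2 + Polynomial.C 0 * Polynomial.X + Polynomial.C (-d))
    (g := Polynomial.C w * Polynomial.X ^ 2 + Polynomial.C 0 * Polynomial.X + Polynomial.C 0)
    (Polynomial.degree_quadratic hu) (Polynomial.degree_quadratic hw) hcard
  refine ⟨x, z, ?_⟩
  simp at h
  linear_combination h

/-- Three homologies, with the centre of each of the outer two on the axis of the other. -/
structure IsHomologyTriple (B : Fin 3 → GL (Fin 3) F) (p f : Fin 3 → Fin 3 → F) : Prop where
  smul_eq : ∀ (i : Fin 3) (v : Fin 3 → F), B i • v = - v + (2 * (f i ⬝ᵥ v)) • p i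
  dot_self : ∀ i, f i ⬝ᵥ p i = 1
  dot_two : f 0 ⬝ᵥ p 2 = 0
  dot_zero : f 2 ⬝ᵥ p 0 = 0

namespace IsHomologyTriple

variable {B : Fin 3 → GL (Fin 3) F} {p f : Fin 3 → Fin 3 → F}

/-- A vanishing value makes the axis of the outer homology an invariant line in the first case, and
its centre a fixed point in the second. -/
theorem dot_ne_zero (h : IsHomologyTriple B p f)
    (hpt : ∀ v : Fin 3 → F, v ≠ 0 → ∃ i, ∀ c : F, B i • v ≠ c • v)
    (hln : ∀ l : Fin 3 → F, l ≠ 0 → ∃ i, ∀ c : F, ∃ v, l ⬝ᵥ (B i • v) ≠ c * (l ⬝ᵥ v))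
    {i : Fin 3} (hi : i = 0 ∨ i = 2) : f i ⬝ᵥ p 1 ≠ 0 ∧ f 1 ⬝ᵥ p i ≠ 0 := by
  have hp0 : p i ≠ 0 := fun H => by simpa [H] using h.dot_self i
  have hf0 : f i ≠ 0 := fun H => by simpa [H] using h.dot_self i
  constructor
  · intro H
    obtain ⟨j, hj⟩ := hln (f i) hf0
    by_cases hij : j = i
    · subst hij
      obtain ⟨v, hv⟩ := hj 1
      apply hv
      rw [h.smul_eq, dotProduct_add, dotProduct_neg, dotProduct_smul, h.dot_self, smul_eq_mul]
      ring
    · obtain ⟨v, hv⟩ := hj (-1)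
      apply hv
      have : f i ⬝ᵥ p j = 0 := by
        fin_cases j <;> rcases hi with rfl | rfl <;>
          simp_all [h.dot_two, h.dot_zero]
      rw [h.smul_eq]; simp [this]
  · intro H
    obtain ⟨j, hj⟩ := hpt (p i) hp0
    by_cases hij : j = i
    · subst hij
      apply hj 1
      rw [h.smul_eq, h.dot_self]
      module
    · apply hj (-1)
      have : f j ⬝ᵥ p i = 0 := by
        fin_cases j <;> rcases hi with rfl | rfl <;>
          simp_all [h.dot_two, h.dot_zero]
      rw [h.smul_eq, this]
      module

/-- The expression is f₁(p') for p' = p₁ - f₀(p₁) p₀ - f₂(p₁) p₂, which f₀ and f₂ kill. If it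
vanishes, either p' ≠ 0 is a fixed point, or p' = 0 and the line through all three centres is fixed.
-/
theorem sum_ne_one (h : IsHomologyTriple B p f)
    (hpt : ∀ v : Fin 3 → F, v ≠ 0 → ∃ i, ∀ c : F, B i • v ≠ c • v)
    (hln : ∀ l : Fin 3 → F, l ≠ 0 → ∃ i, ∀ c : F, ∃ v, l ⬝ᵥ (B i • v) ≠ c * (l ⬝ᵥ v)) :
    1 - (f 0 ⬝ᵥ p 1) * (f 1 ⬝ᵥ p 0) - (f 2 ⬝ᵥ p 1) * (f 1 ⬝ᵥ p 2) ≠ 0 := by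
  intro H
  by_cases hv : p 1 - (f 0 ⬝ᵥ p 1) • p 0 - (f 2 ⬝ᵥ p 1) • p 2 = 0
  · have hl : crossProduct (p 0) (p 2) ≠ 0 := by
      rw [crossProduct_ne_zero_iff_linearIndependent, LinearIndependent.pair_iff]
      intro s t hst
      have e0 := congrArg (fun v => f 0 ⬝ᵥ v) hst
      have e2 := congrArg (fun v => f 2 ⬝ᵥ v) hst
      simp [h.dot_self, h.dot_two, h.dot_zero] at e0 e2
      exact ⟨e0, e2⟩
    obtain ⟨j, hj⟩ := hln _ hl
    obtain ⟨v, hv'⟩ := hj (-1)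
    apply hv'
    have e0 : crossProduct (p 0) (p 2) ⬝ᵥ p 0 = 0 := by
      rw [dotProduct_comm]; exact dot_self_cross _ _
    have e2 : crossProduct (p 0) (p 2) ⬝ᵥ p 2 = 0 := by
      rw [dotProduct_comm]; exact dot_cross_self _ _
    have e1 : crossProduct (p 0) (p 2) ⬝ᵥ p 1 = 0 := by
      have := congrArg (fun v => crossProduct (p 0) (p 2) ⬝ᵥ v) hv
      simpa [dotProduct_sub, dotProduct_smul, e0, e2] using this
    have e : crossProduct (p 0) (p 2) ⬝ᵥ p j = 0 := by
      fin_cases j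
      exacts [e0, e1, e2]
    rw [h.smul_eq, dotProduct_add, dotProduct_smul, e]
    simp
  · obtain ⟨j, hj⟩ := hpt _ hv
    apply hj (-1)
    have : f j ⬝ᵥ (p 1 - (f 0 ⬝ᵥ p 1) • p 0 - (f 2 ⬝ᵥ p 1) • p 2) = 0 := by
      fin_cases j <;>
        simp [dotProduct_sub, dotProduct_smul, h.dot_self, h.dot_two, h.dot_zero]
      linear_combination H
    rw [h.smul_eq, this]
    module

/-- The homologies preserve a conic, which is projectively equivalent to the standard one. -/
theorem exists_conj_mem [Finite F] [NeZero (2 : F)] (h : IsHomologyTriple B p f)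
    (hdet : ∀ i, (B i).1.det = 1)
    (h0 : f 0 ⬝ᵥ p 1 ≠ 0 ∧ f 1 ⬝ᵥ p 0 ≠ 0) (h2 : f 2 ⬝ᵥ p 1 ≠ 0 ∧ f 1 ⬝ᵥ p 2 ≠ 0)
    (hne : 1 - (f 0 ⬝ᵥ p 1) * (f 1 ⬝ᵥ p 0) - (f 2 ⬝ᵥ p 1) * (f 1 ⬝ᵥ p 2) ≠ 0) :
    ∃ g : GL (Fin 3) F, ∀ i,
      g⁻¹ * B i * g ∈ specialOrthogonalGroupOf (standardTernaryForm F) := by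
  have t2 : (2 : F) ≠ 0 := two_ne_zero
  obtain ⟨a, ha⟩ : ∃ a, f 0 ⬝ᵥ p 1 = a := ⟨_, rfl⟩
  obtain ⟨d, hd⟩ : ∃ d, f 2 ⬝ᵥ p 1 = d := ⟨_, rfl⟩
  obtain ⟨u, hu⟩ : ∃ u, f 1 ⬝ᵥ p 0 = a * u := ⟨(f 1 ⬝ᵥ p 0) / a, by
    rw [mul_div_cancel₀ _ (ha ▸ h0.1)]⟩
  obtain ⟨w, hw⟩ : ∃ w, f 1 ⬝ᵥ p 2 = d * w := ⟨(f 1 ⬝ᵥ p 2) / d, by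
    rw [mul_div_cancel₀ _ (hd ▸ h2.1)]⟩
  rw [ha, hu] at h0
  rw [hd, hw] at h2
  rw [ha, hd, hu, hw] at hne
  obtain ⟨ha0, hau⟩ := h0
  obtain ⟨hd0, hdw⟩ := h2
  have hu0 : u ≠ 0 := right_ne_zero_of_mul hau
  have hw0 : w ≠ 0 := right_ne_zero_of_mul hdw
  obtain ⟨e, he⟩ : ∃ e, e = 1 - a * (a * u) - d * (d * w) := ⟨_, rfl⟩
  rw [← he] at hne
  -- In the basis p₀, p', p₂ the invariant form q below is diagonal with entries eu, e², ew; this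
  -- equation makes x p₀ ± p' + z p₂ isotropic.
  obtain ⟨x, z, hxz⟩ := exists_mul_sq_add_mul_sq hu0 hw0 (-e)
  obtain ⟨p', hp'⟩ : ∃ p', p' = p 1 - a • p 0 - d • p 2 := ⟨_, rfl⟩
  have f0p' : f 0 ⬝ᵥ p' = 0 := by
    rw [hp']; simp [dotProduct_sub, dotProduct_smul, h.dot_self, h.dot_two, ha]
  have f2p' : f 2 ⬝ᵥ p' = 0 := by
    rw [hp']; simp [dotProduct_sub, dotProduct_smul, h.dot_self, h.dot_zero, hd]
  have f1p' : f 1 ⬝ᵥ p' = e := by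
    rw [hp', he]; simp [dotProduct_sub, dotProduct_smul, h.dot_self, hu, hw]
  -- Scales one isotropic vector so that q becomes u w e² times x₀x₂ - x₁², without the need for a
  -- square root.
  obtain ⟨k, hk⟩ : ∃ k : F, 4 * k = - (u * w) := ⟨-(u * w) / (2 * 2), by field_simp; norm_num⟩
  have hk0 : k ≠ 0 := by
    rintro rfl
    rw [mul_zero, eq_comm, neg_eq_zero] at hk
    exact mul_ne_zero hu0 hw0 hk
  -- The outer columns are the two isotropic vectors, the middle one is orthogonal to both.
  let T : Matrix (Fin 3) (Fin 3) F := (Matrix.of ![k • (x • p 0 + p' + z • p 2),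
    (-(w * z)) • p 0 + (u * x) • p 2, x • p 0 - p' + z • p 2])ᵀ
  have hT (v : Fin 3 → F) : T.mulVec v = v 0 • (k • (x • p 0 + p' + z • p 2)) +
      v 1 • ((-(w * z)) • p 0 + (u * x) • p 2) + v 2 • (x • p 0 - p' + z • p 2) := by
    ext i
    simp [T, mulVec, dotProduct, Fin.sum_univ_three]
    ring
  have hT0 (v : Fin 3 → F) :
      f 0 ⬝ᵥ T.mulVec v = v 0 * (k * x) - v 1 * (w * z) + v 2 * x := by
    rw [hT]
    simp only [dotProduct_add, dotProduct_sub, dotProduct_smul, f0p', h.dot_self, h.dot_two,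
      smul_eq_mul]
    ring
  have hT2 (v : Fin 3 → F) :
      f 2 ⬝ᵥ T.mulVec v = v 0 * (k * z) + v 1 * (u * x) + v 2 * z := by
    rw [hT]
    simp only [dotProduct_add, dotProduct_sub, dotProduct_smul, f2p', h.dot_self, h.dot_zero,
      smul_eq_mul]
    ring
  have hT1 (v : Fin 3 → F) : f 1 ⬝ᵥ T.mulVec v =
      a * u * (f 0 ⬝ᵥ T.mulVec v) + d * w * (f 2 ⬝ᵥ T.mulVec v) + e * (k * v 0 - v 2) := by
    rw [hT0, hT2, hT]
    simp only [dotProduct_add, dotProduct_sub, dotProduct_smul, f1p', hu, hw, smul_eq_mul]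
    ring
  have hdetT : T.det ≠ 0 := by
    intro H
    obtain ⟨v, hv0, hv⟩ := Matrix.exists_mulVec_eq_zero_iff.2 H
    have e0 := hT0 v
    have e1 := hT1 v
    have e2 := hT2 v
    rw [hv] at e0 e1 e2
    simp only [dotProduct_zero, mul_zero, zero_add] at e0 e1 e2
    have e3 : k * v 0 - v 2 = 0 := (mul_eq_zero.1 e1.symm).resolve_left hne
    have e4 : 2 * k * e * v 0 = 0 := by
      linear_combination (u * x) * e0 + (w * z) * e2 - (u * x ^ 2 + w * z ^ 2) * e3
        - (2 * k * v 0) * (-hxz)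
    have e5 : v 0 = 0 := by simpa [t2, hk0, hne] using e4
    have e6 : v 2 = 0 := by simpa [e5] using e3
    have e7 : v 1 * e = 0 := by
      simp [e5, e6] at e0 e2
      rcases e0 with e0 | e0 | e0
      · simp [e0]
      · exact absurd e0 hw0
      · rcases e2 with e2 | e2 | e2
        · simp [e2]
        · exact absurd e2 hu0
        · exfalso; apply hne; simpa [e0, e2] using hxz.symm
    have e8 : v 1 = 0 := by simpa [hne] using e7
    apply hv0
    ext i; fin_cases i <;> assumption
  obtain ⟨g, hg⟩ : ∃ g : GL (Fin 3) F, g.1 = T :=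
    ⟨Matrix.GeneralLinearGroup.mkOfDetNeZero T hdetT, rfl⟩
  let q (v : Fin 3 → F) : F := e * u * (f 0 ⬝ᵥ v) ^ 2 +
    (f 1 ⬝ᵥ v - a * u * (f 0 ⬝ᵥ v) - d * w * (f 2 ⬝ᵥ v)) ^ 2 + e * w * (f 2 ⬝ᵥ v) ^ 2
  have hqg (v : Fin 3 → F) : q (g • v) = u * w * e ^ 2 * standardTernaryForm F v := by
    rw [GL_smul_eq_mulVec, hg]
    simp only [q]
    rw [hT1, hT0, hT2, standardTernaryForm_apply]
    linear_combination (e * ((k * v 0 + v 2) ^ 2 + u * w * v 1 ^ 2)) * hxz - e ^ 2 * v 0 * v 2 * hk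
  have hqB (i : Fin 3) (v : Fin 3 → F) : q (B i • v) = q v := by
    simp only [q]
    rw [h.smul_eq]
    simp only [dotProduct_add, dotProduct_neg, dotProduct_smul, smul_eq_mul]
    fin_cases i <;> simp only [Fin.zero_eta, Fin.mk_one, Fin.reduceFinMk, h.dot_self, h.dot_two,
      h.dot_zero, ha, hd, hu, hw, he] <;> ring
  refine ⟨g, fun i => mem_specialOrthogonal.2 ⟨fun v => ?_, ?_⟩⟩
  · have h3 : u * w * e ^ 2 ≠ 0 := mul_ne_zero (mul_ne_zero hu0 hw0) (pow_ne_zero _ hne)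
    apply mul_left_cancel₀ h3
    rw [← hqg, ← hqg, mul_smul, mul_smul, smul_inv_smul, hqB]
  · have h3 : (g⁻¹).1.det * g.1.det = 1 := by
      rw [← det_mul, ← Units.val_mul, inv_mul_cancel]; simp
    rw [Units.val_mul, Units.val_mul, det_mul, det_mul, hdet i, mul_one, h3]

/-- The axes of the outer homologies, of their product and of the middle one are distinct. -/
theorem exists_axes [NeZero (2 : F)] (h : IsHomologyTriple B p f)
    (hsq : ∀ i, B i * B i = 1) (hcomm : Commute (B 0) (B 2)) (hone : ∀ i, B i ≠ 1)
    (hne02 : B 0 ≠ B 2)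
    (h0 : f 0 ⬝ᵥ p 1 ≠ 0 ∧ f 1 ⬝ᵥ p 0 ≠ 0) (h2 : f 2 ⬝ᵥ p 1 ≠ 0 ∧ f 1 ⬝ᵥ p 2 ≠ 0)
    (hne : 1 - (f 0 ⬝ᵥ p 1) * (f 1 ⬝ᵥ p 0) - (f 2 ⬝ᵥ p 1) * (f 1 ⬝ᵥ p 2) ≠ 0) :
    ∃ T : Set (ℙ F (Fin 3 → F)), T.ncard = 4 ∧ ∀ x ∈ T,
      ∃ g ∈ Subgroup.closure (Set.range B), g ≠ 1 ∧ g * g = 1 ∧ ∀ v ∈ x.submodule, g • v = v := by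
  have hp (i) : p i ≠ 0 := fun H => by simpa [H] using h.dot_self i
  obtain ⟨p', hp'⟩ : ∃ p', p' = p 1 - (f 0 ⬝ᵥ p 1) • p 0 - (f 2 ⬝ᵥ p 1) • p 2 := ⟨_, rfl⟩
  have f0p' : f 0 ⬝ᵥ p' = 0 := by
    rw [hp']; simp [dotProduct_sub, dotProduct_smul, h.dot_self, h.dot_two]
  have f2p' : f 2 ⬝ᵥ p' = 0 := by
    rw [hp']; simp [dotProduct_sub, dotProduct_smul, h.dot_self, h.dot_zero]
  have hp'0 : p' ≠ 0 := by
    rintro H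
    apply hne
    have := congrArg (fun v => f 1 ⬝ᵥ v) hp'
    rw [H] at this
    simp [dotProduct_sub, dotProduct_smul, h.dot_self] at this
    linear_combination -this
  have hdist {v w : Fin 3 → F} (hv : v ≠ 0) (hw : w ≠ 0) (l : Fin 3 → F) (h1 : l ⬝ᵥ v = 0)
      (h2 : l ⬝ᵥ w ≠ 0) : Projectivization.mk F v hv ≠ Projectivization.mk F w hw := by
    intro H
    rw [mk_eq_mk_iff'] at H
    obtain ⟨a, rfl⟩ := H
    rw [dotProduct_smul, smul_eq_mul] at h1
    rcases mul_eq_zero.1 h1 with rfl | h1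
    · simp at hv
    · exact h2 h1
  have hfix {x : Fin 3 → F} (hx : x ≠ 0) {g : GL (Fin 3) F} (hg : g • x = x) :
      ∀ v ∈ (Projectivization.mk F x hx).submodule, g • v = v := by
    intro v hv
    rw [submodule_mk, Submodule.mem_span_singleton] at hv
    obtain ⟨a, rfl⟩ := hv
    rw [smul_comm, hg]
  have hmem (i) : B i ∈ Subgroup.closure (Set.range B) := Subgroup.subset_closure ⟨i, rfl⟩
  have hself (i) : B i • p i = p i := by
    rw [h.smul_eq, h.dot_self]; module
  -- Both outer homologies negate p', so their product fixes it; the functionals f₀ and f₂ separate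
  -- the four points.
  refine ⟨{Projectivization.mk F (p 0) (hp 0), Projectivization.mk F (p 2) (hp 2),
      Projectivization.mk F p' hp'0, Projectivization.mk F (p 1) (hp 1)}, ?_, ?_⟩
  · rw [Set.ncard_eq_succ (Set.toFinite _)]
    refine ⟨Projectivization.mk F (p 0) (hp 0),
      {Projectivization.mk F (p 2) (hp 2),
      Projectivization.mk F p' hp'0, Projectivization.mk F (p 1) (hp 1)}, ?_, rfl, ?_⟩
    · rintro (H | H | H)
      · exact hdist _ _ (f 2) h.dot_zero (by simp [h.dot_self]) H
      · exact hdist _ _ (f 0) f0p' (by simp [h.dot_self]) H.symm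
      · exact hdist _ _ (f 2) h.dot_zero h2.1 H
    · rw [Set.ncard_eq_three]
      refine ⟨_, _, _, ?_, ?_, ?_, rfl⟩
      · exact (hdist _ _ (f 2) f2p' (by simp [h.dot_self])).symm
      · exact hdist _ _ (f 0) h.dot_two h0.1
      · exact hdist _ _ (f 0) f0p' h0.1
  · rintro x (rfl | rfl | rfl | rfl)
    · exact ⟨B 0, hmem 0, hone 0, hsq 0, hfix _ (hself 0)⟩
    · exact ⟨B 2, hmem 2, hone 2, hsq 2, hfix _ (hself 2)⟩
    · refine ⟨B 0 * B 2, mul_mem (hmem 0) (hmem 2), ?_, ?_, hfix _ ?_⟩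
      · intro H
        apply hne02
        rw [eq_inv_of_mul_eq_one_left H]
        exact (eq_inv_of_mul_eq_one_left (hsq 2)).symm
      · rw [hcomm.symm.mul_mul_mul_comm, hsq, hsq, mul_one]
      · rw [mul_smul, h.smul_eq 2, f2p', h.smul_eq 0]
        simp [f0p']
    · exact ⟨B 1, hmem 1, hone 1, hsq 1, hfix _ (hself 1)⟩

end IsHomologyTriple

/-- A group generated by three involutions of which the first and last commute, and fixing neither
a point nor a line, is conjugate to a group of isometries of the standard conic. -/
theorem exists_conj_isInvolutory [Finite F] [NeZero (2 : F)] (B : Fin 3 → GL (Fin 3) F)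
    (hdet : ∀ i, (B i).1.det = 1) (hsq : ∀ i, B i * B i = 1) (hone : ∀ i, B i ≠ 1)
    (hcomm : Commute (B 0) (B 2)) (hne02 : B 0 ≠ B 2)
    (hpt : ∀ v : Fin 3 → F, v ≠ 0 → ∃ i, ∀ c : F, B i • v ≠ c • v)
    (hln : ∀ l : Fin 3 → F, l ≠ 0 → ∃ i, ∀ c : F, ∃ v, l ⬝ᵥ (B i • v) ≠ c * (l ⬝ᵥ v)) :
    ∃ g : GL (Fin 3) F, IsInvolutory
      ((Subgroup.closure (Set.range B)).map (MulAut.conj g⁻¹).toMonoidHom) := by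
  choose p f hpf hB using fun i => exists_homology (hdet i) (hsq i) (hone i)
  obtain ⟨h1, h2⟩ := dotProduct_eq_zero_of_commute hcomm hne02 (hpf 0) (hpf 2) (hB 0) (hB 2)
  have h : IsHomologyTriple B p f := ⟨hB, hpf, h1, h2⟩
  have n0 := h.dot_ne_zero hpt hln (Or.inl rfl)
  have n2 := h.dot_ne_zero hpt hln (Or.inr rfl)
  have n1 := h.sum_ne_one hpt hln
  obtain ⟨g, hg⟩ := h.exists_conj_mem hdet n0 n2 n1
  refine ⟨g, isInvolutory_map_conj g⁻¹ ?_ ?_ (h.exists_axes hsq hcomm hone hne02 n0 n2 n1)⟩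
  · rw [MonoidHom.map_closure, Subgroup.closure_le]
    rintro _ ⟨_, ⟨i, rfl⟩, rfl⟩
    simpa using hg i
  · intro x
    induction x using Projectivization.ind with | _ v hv => ?_
    obtain ⟨i, hi⟩ := hpt v hv
    refine ⟨B i, Subgroup.subset_closure ⟨i, rfl⟩, fun H => ?_⟩
    rw [smul_mk, mk_eq_mk_iff'] at H
    obtain ⟨c, hc⟩ := H
    exact hi c hc.symm

end HomologyTriples

/-! ### Lifting from PSL(3,F) to SL(3,F) -/

section Lifting

open MulAction Projectivization Matrix

variable {F : Type*} [Field F]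

theorem pow_three_eq_one_of_mem_center {z : SL(3, F)} (hz : z ∈ Subgroup.center SL(3, F)) :
    z ^ 3 = 1 := by
  obtain ⟨r, hr, hrz⟩ := Matrix.SpecialLinearGroup.mem_center_iff.1 hz
  refine Subtype.ext ((Matrix.SpecialLinearGroup.coe_pow z 3).trans ?_)
  rw [Fintype.card_fin] at hr
  rw [← hrz, ← map_pow, hr, map_one]; rfl

/-- An involution of the projective group is the class of an involution. -/
theorem exists_lift_involution {x : PSL(3, F)} (hx : orderOf x = 2) :
    ∃ A : SL(3, F), (A : PSL(3, F)) = x ∧ A * A = 1 := by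
  obtain ⟨B, rfl⟩ := QuotientGroup.mk_surjective x
  have h1 : B ^ 2 ∈ Subgroup.center SL(3, F) := by
    rw [← QuotientGroup.eq_one_iff, QuotientGroup.mk_pow, ← hx, pow_orderOf_eq_one]
  -- Modulo scalars B³ = B, and (B³)² = (B²)³ = 1 because B² is a scalar of determinant one.
  refine ⟨B ^ 3, ?_, ?_⟩
  · rw [QuotientGroup.mk_pow, pow_succ, ← hx, pow_orderOf_eq_one, one_mul]
  · rw [← pow_add, show 3 + 3 = 2 * 3 from rfl, pow_mul]
    exact pow_three_eq_one_of_mem_center h1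

/-- The commutator z = ABAB is central, so z³ = 1; and zB = ABA is an involution, so z² = 1. -/
theorem commute_of_commute_mk {A B : SL(3, F)} (hA : A * A = 1) (hB : B * B = 1)
    (h : Commute (A : PSL(3, F)) (B : PSL(3, F))) : Commute A B := by
  obtain ⟨z, hz⟩ : ∃ z, z = A * B * A * B := ⟨_, rfl⟩
  have hzc : z ∈ Subgroup.center SL(3, F) := by
    rw [← QuotientGroup.eq_one_iff, hz]
    have hA' : (A : PSL(3, F)) * A = 1 := by rw [← QuotientGroup.mk_mul, hA]; rfl
    have hB' : (B : PSL(3, F)) * B = 1 := by rw [← QuotientGroup.mk_mul, hB]; rfl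
    rw [QuotientGroup.mk_mul, QuotientGroup.mk_mul, QuotientGroup.mk_mul, mul_assoc (A : PSL(3, F)),
      ← h.eq, ← mul_assoc, hA', one_mul, hB']
  have h1 : A * B * A = z * B := by rw [hz, mul_assoc _ B B, hB, mul_one]
  have h2 : z ^ 2 = 1 := by
    have h3 : (A * B * A) * (A * B * A) = 1 := by
      calc (A * B * A) * (A * B * A) = A * B * (A * A) * B * A := by group
        _ = A * (B * B) * A := by rw [hA]; group
        _ = 1 := by rw [hB, mul_one, hA]
    rw [h1, mul_assoc, ← mul_assoc B, ← Subgroup.mem_center_iff.1 hzc B |>.symm] at h3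
    rw [mul_assoc z, hB, mul_one] at h3
    rw [sq, h3]
  have h3 : z = 1 := by
    have := pow_three_eq_one_of_mem_center hzc
    rwa [pow_succ, h2, one_mul] at this
  rw [h3, one_mul] at h1
  calc A * B = A * B * (A * A) := by rw [hA, mul_one]
    _ = A * B * A * A := by group
    _ = B * A := by rw [h1]

theorem toGL_smul (A : SL(3, F)) (v : Fin 3 → F) :
    SpecialLinearGroup.toGL A • v = A.1.mulVec v := rfl

theorem mk_smul_mk (A : SL(3, F)) {v : Fin 3 → F} (hv : v ≠ 0) :
    (A : PSL(3, F)) • Projectivization.mk F v hv =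
      Projectivization.mk F (SpecialLinearGroup.toGL A • v) ((smul_ne_zero_iff_ne _).2 hv) := rfl

theorem submodule_mk_le_iff {v : Fin 3 → F} (hv : v ≠ 0) (W : Submodule F (Fin 3 → F)) :
    (Projectivization.mk F v hv).submodule ≤ W ↔ v ∈ W := by
  rw [Projectivization.submodule_mk, Submodule.span_singleton_le_iff_mem]

theorem mk_mem_conicPoints {Q : QuadraticForm F (Fin 3 → F)} {v : Fin 3 → F} (hv : v ≠ 0) :
    Projectivization.mk F v hv ∈ conicPoints Q ↔ Q v = 0 := by
  constructor
  · intro h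
    exact h v (by rw [submodule_mk]; exact Submodule.mem_span_singleton_self v)
  · intro h w hw
    rw [submodule_mk, Submodule.mem_span_singleton] at hw
    obtain ⟨a, rfl⟩ := hw
    rw [QuadraticMap.map_smul, h, smul_zero]

theorem stabilisesPoint_of_eigenvector {A : Fin 3 → SL(3, F)} {v : Fin 3 → F} (hv : v ≠ 0)
    (h : ∀ i, ∃ c : F, SpecialLinearGroup.toGL (A i) • v = c • v) :
    StabilisesPoint (Subgroup.closure (Set.range fun i => (A i : PSL(3, F)))) := by
  refine ⟨Projectivization.mk F v hv, fun g hg => ?_⟩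
  have : Subgroup.closure (Set.range fun i => (A i : PSL(3, F))) ≤
      stabilizer _ (Projectivization.mk F v hv) := by
    rw [Subgroup.closure_le]
    rintro _ ⟨i, rfl⟩
    obtain ⟨c, hc⟩ := h i
    change (A i : PSL(3, F)) • _ = _
    rw [mk_smul_mk, mk_eq_mk_iff']
    exact ⟨c, hc.symm⟩
  exact this hg

theorem stabilisesLine_of_eigenvector {A : Fin 3 → SL(3, F)} (hA : ∀ i, A i * A i = 1)
    {l : Fin 3 → F} (hl : l ≠ 0)
    (h : ∀ i, ∃ c : F, ∀ v, l ⬝ᵥ (SpecialLinearGroup.toGL (A i) • v) = c * (l ⬝ᵥ v)) :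
    StabilisesLine (Subgroup.closure (Set.range fun i => (A i : PSL(3, F)))) := by
  obtain ⟨L, hL⟩ : ∃ L : Module.Dual F (Fin 3 → F), ∀ v, L v = l ⬝ᵥ v :=
    ⟨dotProductBilin F F l, fun v => rfl⟩
  have hL0 : L ≠ 0 := by
    rintro rfl
    apply hl
    ext i
    have := hL (Pi.single i 1)
    simpa using this.symm
  have hW (v : Fin 3 → F) : v ∈ LinearMap.ker L ↔ l ⬝ᵥ v = 0 := by
    rw [LinearMap.mem_ker, hL]
  refine ⟨LinearMap.ker L, ?_, fun g hg P => ?_⟩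
  · have := Module.Dual.finrank_ker_add_one_of_ne_zero hL0
    rw [Module.finrank_fin_fun] at this
    omega
  -- The equivalence, unlike the implication, passes to inverses in the induction.
  · suffices H : ∀ P : ℙ F (Fin 3 → F),
        (g • P).submodule ≤ LinearMap.ker L ↔ P.submodule ≤ LinearMap.ker L from (H P).2
    clear P
    induction hg using Subgroup.closure_induction with
    | mem g hg =>
      obtain ⟨i, rfl⟩ := hg
      obtain ⟨c, hc⟩ := h i
      have hc0 : c ≠ 0 := by
        rintro rfl
        apply hL0
        refine LinearMap.ext fun v => ?_
        have h1 := hc (SpecialLinearGroup.toGL (A i) • v)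
        rw [← mul_smul, ← map_mul, hA, map_one, one_smul, zero_mul] at h1
        rw [hL, h1]; rfl
      intro P
      induction P using Projectivization.ind with | _ v hv => ?_
      dsimp only
      rw [mk_smul_mk, submodule_mk_le_iff, submodule_mk_le_iff, hW, hW, hc]
      simp [hc0]
    | one => intro P; rw [one_smul]
    | mul a b _ _ ha hb => intro P; rw [mul_smul, ha, hb]
    | inv a _ ha => intro P; rw [← ha, smul_inv_smul]

theorem standardTernaryForm_comp_nondegenerate [NeZero (2 : F)] (g : GL (Fin 3) F) :
    ((standardTernaryForm F).comp (Matrix.mulVecLin g.1)).Nondegenerate := by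
  have := invertibleOfNonzero (two_ne_zero (α := F))
  rw [QuadraticMap.nondegenerate_iff_radical_eq_bot, QuadraticMap.radical_eq_ker_polarBilin,
    LinearMap.ker_eq_bot']
  intro v hv
  have h1 : g • v = 0 := by
    apply eq_of_ternaryPolar_eq
    intro x
    have h2 := LinearMap.congr_fun hv (g⁻¹ • x)
    have h3 : ternaryPolar (g • v) (g • g⁻¹ • x) = 0 := by
      rw [ternaryPolar_eq, ← smul_add]
      exact h2
    rw [smul_inv_smul] at h3
    rw [h3]; simp [ternaryPolar]
  exact (smul_eq_zero_iff_eq g).1 h1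

/-- The image in the projective group of a group of special matrices conjugate to isometries of the
standard conic preserves a conic. -/
theorem preservesConic_map_mk [NeZero (2 : F)] {H : Subgroup SL(3, F)} {g : GL (Fin 3) F}
    (hH : ∀ A ∈ H, g⁻¹ * SpecialLinearGroup.toGL A * g ∈
      specialOrthogonalGroupOf (standardTernaryForm F)) :
    PreservesConic (H.map (QuotientGroup.mk' (Subgroup.center SL(3, F)))) := by
  obtain ⟨Q, hQ⟩ : ∃ Q, Q = (standardTernaryForm F).comp (Matrix.mulVecLin (g⁻¹).1) := ⟨_, rfl⟩
  have hQv (v : Fin 3 → F) : Q v = standardTernaryForm F (g⁻¹ • v) := by rw [hQ]; rfl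
  have hmul (A : SL(3, F)) (hA : (A : PSL(3, F)) ∈
      H.map (QuotientGroup.mk' (Subgroup.center SL(3, F)))) :
      ∃ c : F, c ≠ 0 ∧ ∀ v : Fin 3 → F, Q (A.1.mulVec v) = c * Q v := by
    obtain ⟨B, hB, hBA⟩ := hA
    obtain ⟨r, hr, hrA⟩ := Matrix.SpecialLinearGroup.mem_center_iff.1 (QuotientGroup.eq.1 hBA)
    have hr0 : r ≠ 0 := by
      rintro rfl
      simp at hr
    have hAB : A = B * (B⁻¹ * A) := by group
    refine ⟨r ^ 2, pow_ne_zero _ hr0, fun v => ?_⟩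
    -- An arbitrary matrix representative differs from one in H by a scalar r, which multiplies the
    -- form by r².
    have h1 : A.1.mulVec v = r • (SpecialLinearGroup.toGL B • v) := by
      have h2 : A.1 = B.1 * scalar (Fin 3) r := by
        rw [hrA]
        exact (congrArg Subtype.val hAB).trans (Matrix.SpecialLinearGroup.coe_mul _ _)
      rw [h2, ← mulVec_mulVec, toGL_smul, ← mulVec_smul]
      congr 1
      ext i
      simp [scalar, mulVec_diagonal]
    rw [h1, hQv, hQv, smul_comm, QuadraticMap.map_smul, smul_eq_mul, ← sq]
    congr 1
    have h2 := (mem_specialOrthogonal.1 (hH B hB)).1 (g⁻¹ • v)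
    rwa [mul_smul, mul_smul, smul_inv_smul] at h2
  refine ⟨Q, ?_, hmul, ?_⟩
  · rw [hQ]; exact standardTernaryForm_comp_nondegenerate _
  · intro x hx P
    obtain ⟨A, rfl⟩ := QuotientGroup.mk_surjective x
    obtain ⟨c, hc0, hc⟩ := hmul A hx
    induction P using Projectivization.ind with | _ v hv => ?_
    rw [mk_smul_mk, mk_mem_conicPoints, mk_mem_conicPoints, toGL_smul, hc]
    simp [hc0]

/-- The image in the projective group of a group of special matrices conjugate to isometries of the
standard conic is isomorphic to that group of isometries. -/
theorem nonempty_mulEquiv_map_mk {H : Subgroup SL(3, F)} {g : GL (Fin 3) F}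
    (hH : ∀ A ∈ H, g⁻¹ * SpecialLinearGroup.toGL A * g ∈
      specialOrthogonalGroupOf (standardTernaryForm F)) :
    Nonempty (H.map (QuotientGroup.mk' (Subgroup.center SL(3, F))) ≃*
      (H.map SpecialLinearGroup.toGL).map (MulAut.conj g⁻¹).toMonoidHom) := by
  obtain ⟨e⟩ := nonempty_mulEquiv_map_of_injOn (QuotientGroup.mk' (Subgroup.center SL(3, F))) H
    (fun A hA h => by
      have h1 : ProjGenLinGroup.mk (SpecialLinearGroup.toGL A) = 1 := by
        rw [← ProjectiveSpecialLinearGroup.toPGL_mk]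
        change ProjectiveSpecialLinearGroup.toPGL (QuotientGroup.mk' _ A) = 1
        rw [h, map_one]
      have h2 := eq_one_of_mk_eq_one (hH A hA) (by
        rw [map_mul, map_mul, h1, mul_one, ← map_mul, inv_mul_cancel, map_one])
      have h3 : SpecialLinearGroup.toGL A = 1 := by
        have : SpecialLinearGroup.toGL A = g * (g⁻¹ * SpecialLinearGroup.toGL A * g) * g⁻¹ := by
          group
        rw [this, h2]; group
      exact SpecialLinearGroup.toGL_injective (h3.trans (map_one _).symm))
  obtain ⟨f⟩ := nonempty_mulEquiv_map_conj (H.map SpecialLinearGroup.toGL) g⁻¹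
  exact ⟨e.symm.trans ((Subgroup.equivMapOfInjective H _
    SpecialLinearGroup.toGL_injective).trans f)⟩

end Lifting

/-! ### Assembly -/

theorem theorem5p2 {F : Type*} [Field F] [Finite F] (q : ℕ) (hq : Nat.card F = q) (hodd : Odd q)
    (G : Subgroup PSL(3, F)) (ρ : Fin 3 → PSL(3, F)) (hG : IsStringCGroup G ρ)
    (hpoint : ¬ StabilisesPoint G) (hline : ¬ StabilisesLine G) :
    PreservesConic G ∧
      (Nonempty (G ≃* Equiv.Perm (Fin 4)) ∨
        Nonempty (G ≃* alternatingGroup (Fin 5)) ∨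
        ∃ (q' n : ℕ) (K : Subfield F), q' ^ n = q ∧ Nat.card K = q' ∧
          (Nonempty (G ≃* POmega3 K) ∨ Nonempty (G ≃* PSO3 K))) := by
  have h2 : (2 : F) ≠ 0 := by
    intro h
    have := Fintype.ofFinite F
    have h1 : ringChar F = 2 := CharP.ringChar_of_prime_eq_zero Nat.prime_two (by exact_mod_cast h)
    have h3 := FiniteField.even_card_of_char_two h1
    rw [← Nat.card_eq_fintype_card, hq] at h3
    rw [Nat.odd_iff] at hodd
    omega
  have : NeZero (2 : F) := ⟨h2⟩
  choose A hAρ hA using fun i => exists_lift_involution (hG.involution i)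
  have hρ1 (i) : ρ i ≠ 1 := fun h => by
    have := hG.involution i
    rw [h, orderOf_one] at this
    omega
  have hgen : G = Subgroup.closure (Set.range fun i => (A i : PSL(3, F))) := by
    rw [← hG.generates]
    congr 2
    exact (funext hAρ).symm
  -- If they were equal, the intersection property for {0} and {2} would make the group generated by
  -- ρ 0 trivial.
  have hne : ρ 0 ≠ ρ 2 := by
    intro h
    have h1 := hG.intersection_property {0} {2}
    rw [Set.image_singleton, Set.image_singleton, ← h, inf_idem,
      Set.singleton_inter_eq_empty.2 (by simp), Set.image_empty, Subgroup.closure_empty,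
      Subgroup.closure_eq_bot_iff] at h1
    exact hρ1 0 (h1 rfl)
  have hinj := Matrix.SpecialLinearGroup.toGL_injective (n := Fin 3) (R := F)
  obtain ⟨g, hg⟩ := exists_conj_isInvolutory (fun i => Matrix.SpecialLinearGroup.toGL (A i))
    (fun i => (A i).2) (fun i => by rw [← map_mul, hA, map_one])
    (fun i h => hρ1 i (by rw [← hAρ, hinj (h.trans (map_one _).symm)]; rfl))
    ((commute_of_commute_mk (hA 0) (hA 2) (by
      rw [hAρ, hAρ]; exact hG.string_property 0 2 (by decide))).map _)
    (fun h => hne (by rw [← hAρ, ← hAρ, hinj h]))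
    (fun v hv => by
      by_contra! H
      exact hpoint (hgen ▸ stabilisesPoint_of_eigenvector hv H))
    (fun l hl => by
      by_contra! H
      exact hline (hgen ▸ stabilisesLine_of_eigenvector hA hl H))
  obtain ⟨H, hH⟩ : ∃ H, H = Subgroup.closure (Set.range A) := ⟨_, rfl⟩
  have hHG : G = H.map (QuotientGroup.mk' (Subgroup.center SL(3, F))) := by
    rw [hH, MonoidHom.map_closure, ← Set.range_comp]
    exact hgen
  have hHB : Subgroup.closure (Set.range fun i => Matrix.SpecialLinearGroup.toGL (A i)) =
      H.map Matrix.SpecialLinearGroup.toGL := by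
    rw [hH, MonoidHom.map_closure, ← Set.range_comp]
    rfl
  rw [hHB] at hg
  have hHS : ∀ A ∈ H, g⁻¹ * Matrix.SpecialLinearGroup.toGL A * g ∈
      specialOrthogonalGroupOf (standardTernaryForm F) := fun A hA =>
    hg.le ⟨_, ⟨A, hA, rfl⟩, by simp⟩
  obtain ⟨e⟩ := nonempty_mulEquiv_map_mk hHS
  rw [hHG]
  refine ⟨preservesConic_map_mk hHS, ?_⟩
  rcases hg.nonempty_mulEquiv with ⟨⟨f⟩⟩ | ⟨⟨f⟩⟩ | ⟨K, hK⟩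
  · exact Or.inl ⟨e.trans f⟩
  · exact Or.inr (Or.inl ⟨e.trans f⟩)
  -- The exponent n is the degree of F over K.
  · refine Or.inr (Or.inr ⟨Nat.card K, Module.finrank K F, K, ?_, rfl, ?_⟩)
    · rw [← hq, Module.natCard_eq_pow_finrank (K := K) (V := F)]
    · rcases hK with ⟨⟨f⟩⟩ | ⟨⟨f⟩⟩
      · exact Or.inl ⟨e.trans f⟩
      · exact Or.inr ⟨e.trans f⟩
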